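/- A 3-braid word is a finite word $\beta$ (not necessarily reduced) in the letters $\sigma_1^{\pm1},\sigma_2^{\pm1}$; its closure is an oriented link diagram with one crossing per letter. Switching a crossing means replacing the corresponding letter of $\beta$ by its inverse. Call $\beta$ everywhere different if the closures of the words obtained from $\beta$ by switching a single crossing are pairwise non-isotopic as oriented links in $\mathbb{R}^3$ (under ambient isotopy respecting orientations). Let $\beta$ be a 3-braid word of length at least $2$. Assume that $\beta$ is neither a word $\sigma_i^{\varepsilon}\sigma_i^{-\varepsilon}$ nor, up to cyclic permutation, a word $\sigma_i^{\varepsilon}\sigma_i^{-\varepsilon}\sigma_j^{\delta}$, where $\{i,j\}=\{1,2\}$ and $\varepsilon,\delta\in\{1,-1\}$. Then $\beta$ is not everywhere different: there are two different crossings of $\beta$ such that switching either one gives the same oriented link up to isotopy. In fact, if $\beta$ is moreover not one of the words $\sigma_i^{\varepsilon}\sigma_j^{-\varepsilon}$ with $\{i,j\}=\{1,2\}$, $\varepsilon\in\{1,-1\}$, then there are two different crossings such that the two words obtained by switching either one represent conjugate elements of the braid group $B_3=\langle\sigma_1,\sigma_2\mid\sigma_1\sigma_2\sigma_1=\sigma_2\sigma_1\sigma_2\rangle$,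 and their closures are isotopic as oriented links. -/

import Mathlib

namespace ThreeBraid

/-! ### Braid words and the braid group on three strings -/

/-- A letter `σ_i^{±1}` of a 3-braid word. The first component is the index (`0` for `σ₁`, `1` for
`σ₂`), the second one is `true` for `σ_i` and `false` for `σ_i⁻¹`. -/
abbrev Letter : Type := Fin 2 × Bool

/-- A 3-braid word, not necessarily reduced. -/
abbrev BraidWord : Type := List Letter

/-- The inverse letter. -/
def Letter.inv (a : Letter) : Letter := (a.1, !a.2)

/-- Switching the crossing in place `i`: the letter in this place is replaced by its inverse. -/
def switch (w : BraidWord) (i : Fin w.length) : BraidWord := w.set i (w.get i).inv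

/-- The relator of the braid relation `σ₁ σ₂ σ₁ = σ₂ σ₁ σ₂`. -/
def braidRelator : FreeGroup (Fin 2) :=
  FreeGroup.of 0 * FreeGroup.of 1 * FreeGroup.of 0 *
    (FreeGroup.of 1 * FreeGroup.of 0 * FreeGroup.of 1)⁻¹

/-- The 3-string braid group `B₃ = ⟨σ₁, σ₂ | σ₁ σ₂ σ₁ = σ₂ σ₁ σ₂⟩`. -/
abbrev B3 : Type := PresentedGroup ({braidRelator} : Set (FreeGroup (Fin 2)))

/-- The braid that is represented by a braid word. -/
def toBraid (w : BraidWord) : B3 :=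
  PresentedGroup.mk ({braidRelator} : Set (FreeGroup (Fin 2))) (FreeGroup.mk w)

/-! ### Oriented links in three-space up to ambient isotopy -/

/-- Euclidean three-space; only its topology is used. -/
abbrev Space : Type := Fin 3 → ℝ

/-- An oriented link: finitely many disjoint simple closed curves in three-space, each of them
parametrized with period `1` in the direction of its orientation. -/
structure OrientedLink where
  /-- the index type of the components -/
  ι : Type
  /-- there are only finitely many components -/
  fin : Finite ι
  /-- the closed curves -/
  curve : ι → ℝ → Space
  continuous_curve : ∀ i, Continuous (curve i)
  periodic_curve : ∀ i t, curve i (t + 1) = curve i t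
  injective_curve : ∀ i j s t, curve i s = curve j t → i = j ∧ ∃ n : ℤ, t = s + n

/-- Oriented isotopy: an ambient isotopy of three-space carries `K` to `L`, components to
components, and respects the orientations. The order isomorphisms `φ i` of the real line that commute
with the translation by `1` are the orientation preserving changes of parameter of a circle. -/
def OrientedLink.Isotopic (K L : OrientedLink) : Prop :=
  ∃ H : unitInterval → (Space ≃ₜ Space),
    Continuous (fun p : unitInterval × Space => H p.1 p.2) ∧
    (∀ x, H 0 x = x) ∧
    ∃ (e : K.ι ≃ L.ι) (φ : K.ι → (ℝ ≃o ℝ)),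
      (∀ i t, φ i (t + 1) = φ i t + 1) ∧
      ∀ i t, H 1 (K.curve i t) = L.curve (e i) (φ i t)

/-! ### The closure of a braid word

The strings occupy the three places `0, 1, 2`. The letters of `w` act one after the other in unit time
each, and they are followed by one unit of time in which nothing happens. This is the braid; it is
closed by running once around the vertical axis in the total time `w.length + 1`, where place `k` is at
distance `k + 1` from the axis. -/

/-- The permutation of the places that is effected by a letter (by no letter if `none`). -/
def letterPerm : Option Letter → Equiv.Perm (Fin 3)
  | none => 1
  | some a => Equiv.swap a.1.castSucc a.1.succ

/-- The distance from the axis, at time `s ∈ [0, 1]` within a letter, of the string that enters this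
letter in place `p`. -/
def radius : Option Letter → Fin 3 → ℝ → ℝ
  | none, p, _ => (p : ℝ) + 1
  | some a, p, s =>
    if p = a.1.castSucc then (p : ℝ) + 1 + s
    else if p = a.1.succ then (p : ℝ) + 1 - s
    else (p : ℝ) + 1

/-- The height, at time `s ∈ [0, 1]` within a letter, of the string that enters this letter in place
`p`. For a positive letter the outgoing string passes above the ingoing one (this is a positive
crossing when both strings run counterclockwise around the axis), for a negative letter below it. -/
def height : Option Letter → Fin 3 → ℝ → ℝ
  | none, _, _ => 0
  | some a, p, s =>
    (if a.2 then 1 else -1) *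
      (if p = a.1.castSucc then s * (1 - s)
        else if p = a.1.succ then -(s * (1 - s))
        else 0)

/-- The letter that acts in the time interval `[j, j + 1]`, periodically in `j`. -/
def letterAt (w : BraidWord) (j : ℕ) : Option Letter := w[j % (w.length + 1)]?

/-- The string that starts in place `k` is in place `place w j k` at the integral time `j`. -/
def place (w : BraidWord) : ℕ → Equiv.Perm (Fin 3)
  | 0 => 1
  | j + 1 => letterPerm (letterAt w j) * place w j

/-- The permutation of the braid. -/
def perm (w : BraidWord) : Equiv.Perm (Fin 3) := place w (w.length + 1)

/-- The point at distance `r` from the vertical axis, with polar angle `θ` and height `h`. -/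
noncomputable def cylindrical (r θ h : ℝ) : Space := ![r * Real.cos θ, r * Real.sin θ, h]

/-- The point that the string starting in place `k` has reached at time `u ≥ 0`. -/
noncomputable def point (w : BraidWord) (k : Fin 3) (u : ℝ) : Space :=
  cylindrical
    (radius (letterAt w ⌊u⌋₊) (place w ⌊u⌋₊ k) (u - ⌊u⌋₊))
    (2 * Real.pi * (u / (w.length + 1)))
    (height (letterAt w ⌊u⌋₊) (place w ⌊u⌋₊ k) (u - ⌊u⌋₊))

/-- The components of the closure are the cycles of the permutation; a cycle is given by its smallest
element. -/
def Component (w : BraidWord) : Type :=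
  {k : Fin 3 // ∀ l : Fin 3, (perm w).SameCycle k l → k ≤ l}

/-- The time after which a component closes up: a cycle of length `m` takes `m` rounds. -/
noncomputable def period (w : BraidWord) (k : Fin 3) : ℝ :=
  (Function.minimalPeriod (perm w) k : ℝ) * (w.length + 1)

/-- The parametrization of a component of the closure. -/
noncomputable def closureCurve (w : BraidWord) (c : Component w) (t : ℝ) : Space :=
  point w c.1 (period w c.1 * Int.fract t)

/-! The following facts show that these curves form a link. -/

lemma letterAt_add (w : BraidWord) (j l : ℕ) :
    letterAt w (j + (w.length + 1) * l) = letterAt w j := by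
  simp [letterAt, Nat.add_mul_mod_self_left]

lemma place_add (w : BraidWord) (j : ℕ) :
    place w (j + (w.length + 1)) = place w j * perm w := by
  induction j with
  | zero => simp [place, perm]
  | succ j ih =>
    have h := letterAt_add w j 1
    rw [mul_one] at h
    rw [Nat.add_right_comm, place, ih, h, place, mul_assoc]

lemma place_add_mul (w : BraidWord) (j l : ℕ) :
    place w (j + (w.length + 1) * l) = place w j * perm w ^ l := by
  induction l with
  | zero => simp
  | succ l ih => rw [Nat.mul_succ, ← Nat.add_assoc, place_add, ih, mul_assoc, pow_succ]

lemma radius_pos (a : Option Letter) (p : Fin 3) {s : ℝ} (h0 : 0 ≤ s) (h1 : s < 1) :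
    0 < radius a p s := by
  have hp : (0 : ℝ) ≤ (p : ℝ) := Nat.cast_nonneg _
  rcases a with _ | a
  · simp only [radius]; linarith
  · simp only [radius]; split_ifs <;> linarith

lemma radius_height_inj (a : Option Letter) (p q : Fin 3) {s : ℝ} (h0 : 0 ≤ s) (h1 : s < 1)
    (hr : radius a p s = radius a q s) (hh : height a p s = height a q s) : p = q := by
  rcases a with _ | ⟨i, b⟩
  · simp only [radius, add_left_inj, Nat.cast_inj] at hr
    exact Fin.ext hr
  · have hs : s * (1 - s) = -(s * (1 - s)) → s = 0 := by
      intro h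
      have : s * (1 - s) = 0 := by linarith
      rcases mul_eq_zero.1 this with h | h <;> linarith
    fin_cases i <;> fin_cases p <;> fin_cases q <;> cases b <;>
      simp [radius, height] at hr hh ⊢ <;>
      first
        | linarith
        | (have := hs (by linarith); subst this; linarith)

lemma continuous_radius (a : Option Letter) (p : Fin 3) : Continuous (fun s => radius a p s) := by
  rcases a with _ | a
  · simp only [radius]; fun_prop
  · simp only [radius]; split_ifs <;> fun_prop

lemma continuous_height (a : Option Letter) (p : Fin 3) : Continuous (fun s => height a p s) := by
  rcases a with _ | a
  · simp only [height]; fun_prop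
  · simp only [height]; split_ifs <;> fun_prop

lemma radius_zero (a : Option Letter) (p : Fin 3) : radius a p 0 = (p : ℝ) + 1 := by
  rcases a with _ | a <;> simp [radius]

lemma height_zero (a : Option Letter) (p : Fin 3) : height a p 0 = 0 := by
  rcases a with _ | a <;> simp [height]

lemma radius_one (a : Option Letter) (p : Fin 3) : radius a p 1 = (letterPerm a p : ℝ) + 1 := by
  rcases a with _ | ⟨i, b⟩
  · simp [radius, letterPerm]
  · fin_cases i <;> fin_cases p <;> simp [radius, letterPerm, Equiv.swap_apply_def] <;> norm_num

lemma height_one (a : Option Letter) (p : Fin 3) : height a p 1 = 0 := by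
  rcases a with _ | a <;> simp [height]

lemma continuous_glue (g : ℕ → ℝ → ℝ) (hg : ∀ j, Continuous (g j))
    (h : ∀ j, g j 1 = g (j + 1) 0) : Continuous (fun u : ℝ => g ⌊u⌋₊ (u - ⌊u⌋₊)) := by
  have key : ∀ N : ℕ, ContinuousOn (fun u : ℝ => g ⌊u⌋₊ (u - ⌊u⌋₊)) (Set.Iic (N : ℝ)) := by
    have hpiece : ∀ j : ℕ, ∀ u : ℝ, (u < 0 ∨ (j : ℝ) ≤ u) → u ≤ j + 1 → (u < 0 → j = 0) →
        g ⌊u⌋₊ (u - ⌊u⌋₊) = g j (u - j) := by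
      intro j u hu hu' hneg
      rcases hu with hu | hu
      · have := hneg hu
        subst this
        rw [Nat.floor_of_nonpos hu.le]
      · rcases hu'.lt_or_eq with hlt | heq
        · rw [(Nat.floor_eq_iff ((Nat.cast_nonneg j).trans hu)).2 ⟨hu, hlt⟩]
        · have : ⌊u⌋₊ = j + 1 := by
            rw [heq]; exact_mod_cast Nat.floor_natCast (R := ℝ) (j + 1)
          rw [this, heq]
          push_cast
          rw [sub_self, add_sub_cancel_left, h]
    intro N
    induction N with
    | zero =>
      refine ((hg 0).comp (continuous_id)).continuousOn.congr ?_
      intro u hu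
      have hu : u ≤ 0 := by simpa using hu
      simp [Nat.floor_of_nonpos hu]
    | succ N ih =>
      have hU : Set.Iic ((N + 1 : ℕ) : ℝ) = Set.Iic (N : ℝ) ∪ Set.Icc (N : ℝ) (N + 1) := by
        rw [Set.Iic_union_Icc_eq_Iic (by linarith)]; push_cast; rfl
      rw [hU]
      refine ih.union_of_isClosed ?_ isClosed_Iic isClosed_Icc
      refine ((hg N).comp (continuous_id.sub continuous_const)).continuousOn.congr
        (f := fun u : ℝ => g N (u - N)) ?_
      intro u hu
      refine hpiece N u (Or.inr hu.1) hu.2 ?_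
      intro hlt
      exact absurd hlt (not_lt.2 ((Nat.cast_nonneg N).trans hu.1))
  rw [continuous_iff_continuousAt]
  intro u
  obtain ⟨N, hN⟩ := exists_nat_gt u
  exact (key N).continuousAt (Iic_mem_nhds hN)

lemma continuous_point (w : BraidWord) (k : Fin 3) : Continuous (point w k) := by
  have h1 := continuous_glue (fun j => radius (letterAt w j) (place w j k))
    (fun j => continuous_radius _ _) (fun j => by
      rw [radius_one, radius_zero]; simp [place])
  have h2 := continuous_glue (fun j => height (letterAt w j) (place w j k))
    (fun j => continuous_height _ _) (fun j => by rw [height_one, height_zero])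
  refine continuous_pi fun i => ?_
  have h3 : Continuous (fun u : ℝ => 2 * Real.pi * (u / ((w.length : ℝ) + 1))) := by fun_prop
  fin_cases i
  · exact h1.mul (Real.continuous_cos.comp h3)
  · exact h1.mul (Real.continuous_sin.comp h3)
  · exact h2

lemma cylindrical_inj {r r' θ θ' h h' : ℝ} (hr : 0 < r) (hr' : 0 < r')
    (H : cylindrical r θ h = cylindrical r' θ' h') :
    r = r' ∧ h = h' ∧ ∃ n : ℤ, θ - θ' = 2 * Real.pi * n := by
  have h0 : r * Real.cos θ = r' * Real.cos θ' := by simpa [cylindrical] using congrFun H 0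
  have h1 : r * Real.sin θ = r' * Real.sin θ' := by simpa [cylindrical] using congrFun H 1
  have h2 : h = h' := by simpa [cylindrical] using congrFun H 2
  have hsq : r ^ 2 = r' ^ 2 := by
    have e1 : r ^ 2 = (r * Real.cos θ) ^ 2 + (r * Real.sin θ) ^ 2 := by
      have := Real.sin_sq_add_cos_sq θ
      linear_combination (-r ^ 2) * this
    have e2 : r' ^ 2 = (r' * Real.cos θ') ^ 2 + (r' * Real.sin θ') ^ 2 := by
      have := Real.sin_sq_add_cos_sq θ'
      linear_combination (-r' ^ 2) * this
    rw [e1, e2, h0, h1]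
  have hrr : r = r' := (pow_left_inj₀ hr.le hr'.le two_ne_zero).1 hsq
  subst hrr
  refine ⟨rfl, h2, ?_⟩
  exact Real.Angle.angle_eq_iff_two_pi_dvd_sub.1
    (Real.Angle.cos_sin_inj (mul_left_cancel₀ hr.ne' h0) (mul_left_cancel₀ hr.ne' h1))

lemma minimalPeriod_pos (w : BraidWord) (k : Fin 3) :
    0 < Function.minimalPeriod (perm w) k :=
  Function.minimalPeriod_pos_of_mem_periodicPts
    ((perm w).injective.mem_periodicPts k)

lemma point_period (w : BraidWord) (k : Fin 3) : point w k (period w k) = point w k 0 := by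
  set m := Function.minimalPeriod (perm w) k with hm
  have hp : period w k = (((w.length + 1) * m : ℕ) : ℝ) := by
    simp only [period, ← hm]; push_cast; ring
  have hl : letterAt w ((w.length + 1) * m) = letterAt w 0 := by
    simpa using letterAt_add w 0 m
  have hq : place w ((w.length + 1) * m) k = place w 0 k := by
    have := place_add_mul w 0 m
    rw [Nat.zero_add] at this
    rw [this, Equiv.Perm.mul_apply, ← Equiv.Perm.iterate_eq_pow, hm,
      Function.iterate_minimalPeriod]
  have hn : ((w.length : ℝ) + 1) ≠ 0 := by positivity
  have ha : 2 * Real.pi * ((((w.length + 1) * m : ℕ) : ℝ) / ((w.length : ℝ) + 1))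
      = (m : ℕ) * (2 * Real.pi) := by
    push_cast; field_simp
  have hf : ⌊(((w.length + 1) * m : ℕ) : ℝ)⌋₊ = (w.length + 1) * m := Nat.floor_natCast _
  rw [hp]
  simp only [point]
  have hsin : Real.sin ((m : ℝ) * (2 * Real.pi)) = 0 := by
    have := Real.sin_nat_mul_pi (m * 2)
    push_cast at this
    rwa [mul_assoc] at this
  rw [ha, hf, hl, hq]
  simp [cylindrical, hsin]

lemma point_inj (w : BraidWord) (k k' : Fin 3) {u u' : ℝ} (hu : 0 ≤ u) (huu : u ≤ u')
    (H : point w k u = point w k' u') :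
    ∃ l : ℕ, u' = u + ((w.length : ℝ) + 1) * l ∧ k = (perm w ^ l) k' := by
  have hu' : 0 ≤ u' := hu.trans huu
  have hn : (0 : ℝ) < (w.length : ℝ) + 1 := by positivity
  have fr : ∀ v : ℝ, 0 ≤ v → 0 ≤ v - ⌊v⌋₊ ∧ v - ⌊v⌋₊ < 1 := fun v hv =>
    ⟨sub_nonneg.2 (Nat.floor_le hv), by linarith [Nat.lt_floor_add_one v]⟩
  obtain ⟨hr, hh, n, hθ⟩ := cylindrical_inj
    (radius_pos _ _ (fr u hu).1 (fr u hu).2) (radius_pos _ _ (fr u' hu').1 (fr u' hu').2) H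
  have hdiff : u - u' = ((w.length : ℝ) + 1) * n := by
    have hpi := Real.pi_pos
    field_simp at hθ
    linarith
  have hn0 : n ≤ 0 := by
    by_contra hc
    have : (0 : ℝ) < n := by exact_mod_cast not_le.1 hc
    nlinarith
  obtain ⟨l, hl⟩ := Int.eq_ofNat_of_zero_le (neg_nonneg.2 hn0)
  have hnl : (n : ℝ) = -(l : ℝ) := by
    have : n = -(l : ℤ) := by omega
    rw [this]; push_cast; rfl
  have hul : u' = u + ((w.length : ℝ) + 1) * l := by
    rw [hnl] at hdiff; linarith
  refine ⟨l, hul, ?_⟩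
  have hfl : ⌊u'⌋₊ = ⌊u⌋₊ + (w.length + 1) * l := by
    have : u' = u + (((w.length + 1) * l : ℕ) : ℝ) := by rw [hul]; push_cast; ring
    rw [this, Nat.floor_add_natCast hu]
  have hs : u' - ⌊u'⌋₊ = u - ⌊u⌋₊ := by
    rw [hfl, hul]; push_cast; ring
  rw [hs, hfl, letterAt_add] at hr hh
  have := radius_height_inj _ _ _ (fr u hu).1 (fr u hu).2 hr hh
  rw [place_add_mul, Equiv.Perm.mul_apply] at this
  exact (place w ⌊u⌋₊).injective this

lemma component_finite (w : BraidWord) : Finite (Component w) := by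
  unfold Component; infer_instance

lemma closureCurve_inj_aux (w : BraidWord) (c d : Component w) (s t : ℝ)
    (hle : period w c.1 * Int.fract s ≤ period w d.1 * Int.fract t)
    (H : closureCurve w c s = closureCurve w d t) : c = d ∧ Int.fract s = Int.fract t := by
  have hn : (0 : ℝ) < (w.length : ℝ) + 1 := by positivity
  have hm := minimalPeriod_pos w d.1
  have hm' := minimalPeriod_pos w c.1
  obtain ⟨l, hl, hk⟩ := point_inj w c.1 d.1
    (mul_nonneg (by unfold period; positivity) (Int.fract_nonneg s)) hle H
  have hsc : (perm w).SameCycle d.1 c.1 := ⟨l, by rw [zpow_natCast]; exact hk.symm⟩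
  have hcd : c.1 = d.1 := le_antisymm (c.2 _ hsc.symm) (d.2 _ hsc)
  refine ⟨Subtype.ext hcd, ?_⟩
  rw [hcd] at hk hl hm'
  have hdvd : Function.minimalPeriod (perm w) d.1 ∣ l := by
    apply Function.IsPeriodicPt.minimalPeriod_dvd
    rw [Function.IsPeriodicPt, Function.IsFixedPt, Equiv.Perm.iterate_eq_pow]
    exact hk.symm
  have hP : (0 : ℝ) < period w d.1 := by
    unfold period
    exact mul_pos (by exact_mod_cast hm) hn
  have hlt : l < Function.minimalPeriod (perm w) d.1 := by
    have h1 : ((w.length : ℝ) + 1) * l < period w d.1 := by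
      have e1 := mul_nonneg hP.le (Int.fract_nonneg s)
      have e2 := mul_lt_mul_of_pos_left (Int.fract_lt_one t) hP
      linarith
    have h2 : (l : ℝ) < (Function.minimalPeriod (perm w) d.1 : ℝ) := by
      rw [period, mul_comm] at h1
      exact lt_of_mul_lt_mul_right h1 hn.le
    exact_mod_cast h2
  have hl0 : l = 0 := Nat.eq_zero_of_dvd_of_lt hdvd hlt
  subst hl0
  have : period w d.1 * Int.fract t = period w d.1 * Int.fract s := by simpa using hl
  exact (mul_left_cancel₀ hP.ne' this).symm

/-- The closure of a braid word, oriented in the direction in which the strings run. -/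
noncomputable def closure (w : BraidWord) : OrientedLink where
  ι := Component w
  fin := component_finite w
  curve := closureCurve w
  continuous_curve c := by
    have h : ContinuousOn (fun x : ℝ => point w c.1 (period w c.1 * x)) (Set.Icc 0 1) :=
      ((continuous_point w c.1).comp (continuous_const.mul continuous_id)).continuousOn
    exact h.comp_fract'' (by simp [point_period])
  periodic_curve c t := by simp [closureCurve]
  injective_curve c d s t H := by
    have key : c = d ∧ Int.fract s = Int.fract t := by
      rcases le_total (period w c.1 * Int.fract s) (period w d.1 * Int.fract t) with h | h
      · exact closureCurve_inj_aux w c d s t h H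
      · have := closureCurve_inj_aux w d c t s h H.symm
        exact ⟨this.1.symm, this.2.symm⟩
    refine ⟨key.1, ?_⟩
    obtain ⟨z, hz⟩ := Int.fract_eq_fract.1 key.2.symm
    exact ⟨z, by linarith⟩

/-- A braid word is everywhere different if the closures of the braid words that arise from it by
switching a single crossing are pairwise non-isotopic as oriented links. -/
def EverywhereDifferent (w : BraidWord) : Prop :=
  ∀ i j : Fin w.length, i ≠ j →
    ¬ (closure (switch w i)).Isotopic (closure (switch w j))

/-- The words `σ_i^{±1} σ_i^{∓1}`, and up to cyclic permutation the words
`σ_i^{±1} σ_i^{∓1} σ_j^{δ}` with `j ≠ i` and an arbitrary sign `δ`. -/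
def Degenerate (w : BraidWord) : Prop :=
  (∃ a : Letter, w = [a, a.inv]) ∨
  (∃ a b : Letter, a.1 ≠ b.1 ∧ w.IsRotated [a, a.inv, b])

/-- The words `σ₁^{±1} σ₂^{∓1}` and `σ₂^{±1} σ₁^{∓1}`. -/
def AlternatingPair (w : BraidWord) : Prop :=
  ∃ a b : Letter, a.1 ≠ b.1 ∧ a.2 ≠ b.2 ∧ w = [a, b]

end ThreeBraid

/-! The proof has an algebraic half, which finds two crossings whose switches give conjugate braids,
and a topological half, which shows that words representing conjugate braids have isotopic closures.

Algebra. Words are read cyclically. If a letter stands next to itself, switching either copy gives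
the same braid. If a letter `a` stands next to its inverse, the cancelling block `a a⁻¹` is enlarged
to a nested block for as long as the letters around it are inverse to each other. When this stops,
the neighbouring letters give two suitable crossings, unless the word is degenerate (`of_nested`).
Otherwise the two generators alternate around the word. If the signs alternate as well, a word of
length at least 3 is a power of `x y`, and its symmetry under rotation by one period carries one
crossing to another (`of_alternating_signs`). If two adjacent signs agree, a word of length at least
3 contains four alternating letters of equal sign, or a short pattern of runs of equal sign around a
change of sign. In each case a consequence of the braid relation makes the two switched braids
equal, or conjugate for some short words (`false_of_sign_change`, `false_of_eq_sign`).

Topology. A closed braid is a path of three distinct points in a half plane that closes up with a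
permutation. A homotopy of such paths with a fixed permutation is cut into short steps and
approximated by straight line motions of Lipschitz curves. These have Lipschitz displacements, which
extend to a perturbation of the identity of three-space (`of_displacement`,
`ambientIsotopic_trace_of_homotopicWith`). Explicit homotopies realize rotation of the word,
cancellation and the braid relation. So words modulo replacement in arbitrary contexts receive a
homomorphism from `B3`, and conjugate braids have isotopic closures (`wordEquiv_of_isConj`).

The pair `σ₁ σ₂⁻¹` is exceptional: its switches `σ₁⁻¹ σ₂⁻¹` and `σ₁ σ₂` have different exponent
sums, so they are not conjugate. Their closures are unknots, and an explicit isotopy through a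
planar ellipse joins them (`sameClosure_thirdTwist`). -/

namespace ThreeBraid

/-! ### Ambient isotopies between families of points -/

/-- An ambient isotopy of three-space carries the family `f` of points to the family `g`. -/
def AmbientIsotopic {ι : Type*} (f g : ι → Space) : Prop :=
  ∃ H : unitInterval → (Space ≃ₜ Space),
    Continuous (fun p : unitInterval × Space => H p.1 p.2) ∧
    (∀ x, H 0 x = x) ∧ ∀ i, H 1 (f i) = g i

namespace AmbientIsotopic

variable {ι κ : Type*} {f g h : ι → Space}

lemma refl (f : ι → Space) : AmbientIsotopic f f :=
  ⟨fun _ => Homeomorph.refl _, continuous_snd, fun _ => rfl, fun _ => rfl⟩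

lemma symm (h : AmbientIsotopic f g) : AmbientIsotopic g f := by
  obtain ⟨H, hc, h0, h1⟩ := h
  -- The isotopy is run backwards after undoing its final stage, so that it starts at the identity.
  refine ⟨fun t => (H 1).symm.trans (H (unitInterval.symm t)), ?_, ?_, ?_⟩
  · exact hc.comp ((unitInterval.continuous_symm.comp continuous_fst).prodMk
      ((H 1).symm.continuous.comp continuous_snd))
  · intro x
    simp
  · intro i
    simp [← h1, h0]

lemma trans (h₁ : AmbientIsotopic f g) (h₂ : AmbientIsotopic g h) : AmbientIsotopic f h := by
  obtain ⟨H, hc, h0, h1⟩ := h₁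
  obtain ⟨H', hc', h0', h1'⟩ := h₂
  refine ⟨fun t => (H t).trans (H' t), ?_, ?_, ?_⟩
  · exact hc'.comp (continuous_fst.prodMk hc)
  · intro x
    simp [h0, h0']
  · intro i
    simp [h1, h1']

lemma comp (h : AmbientIsotopic f g) (e : κ → ι) : AmbientIsotopic (f ∘ e) (g ∘ e) := by
  obtain ⟨H, hc, h0, h1⟩ := h
  exact ⟨H, hc, h0, fun i => h1 _⟩

open NNReal in
/-- A displacement with a small Lipschitz constant extends to an ambient isotopy. -/
lemma of_displacement {c : ℝ} (hc0 : 0 ≤ c) (hc : c < 1)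
    (hfg : ∀ i j, ‖(g i - f i) - (g j - f j)‖ ≤ c * ‖f i - f j‖) : AmbientIsotopic f g := by
  rcases isEmpty_or_nonempty ι with hι | hι
  · exact ⟨fun _ => Homeomorph.refl _, continuous_snd, fun _ => rfl, fun i => hι.elim i⟩
  lift c to ℝ≥0 using hc0
  have hc' : c < 1 := by exact_mod_cast hc
  have hex : ∀ x ∈ Set.range f, ∃ i, f i = x := fun x hx => hx
  choose! s hs using hex
  -- The displacement is a well-defined function of the point: by `hfg`, indices with the same
  -- `f`-value have the same displacement. The choice `s` is therefore harmless.
  set D : Space → Space := fun x => g (s x) - f (s x) with hD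
  have hDf : ∀ i, D (f i) = g i - f i := by
    intro i
    have := hfg (s (f i)) i
    rw [hs _ ⟨i, rfl⟩, sub_self, norm_zero, mul_zero] at this
    have := norm_le_zero_iff.1 this
    simp only [hD, hs _ (Set.mem_range_self i)]
    exact sub_eq_zero.1 this
  have hlip : LipschitzOnWith c D (Set.range f) := by
    refine LipschitzOnWith.of_dist_le_mul ?_
    rintro _ ⟨i, rfl⟩ _ ⟨j, rfl⟩
    rw [hDf, hDf, dist_eq_norm, dist_eq_norm]
    exact hfg i j
  -- The norm of `Space` is the sup norm, so extending coordinate by coordinate keeps the constant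
  -- `c`.
  obtain ⟨Φ, hΦ, hΦD⟩ := hlip.extend_pi
  -- For `c < 1` the map `x + t Φ x` is a Lipschitz perturbation of the identity, hence a
  -- homeomorphism for every `t`.
  have happrox : ∀ t : unitInterval, ApproximatesLinearOn (fun x : Space => x + (t : ℝ) • Φ x)
      ((ContinuousLinearEquiv.refl ℝ Space : Space ≃L[ℝ] Space) : Space →L[ℝ] Space)
      Set.univ c := by
    intro t x _ y _
    have h1 : (x + (t : ℝ) • Φ x) - (y + (t : ℝ) • Φ y)
        - ((ContinuousLinearEquiv.refl ℝ Space : Space ≃L[ℝ] Space) : Space →L[ℝ] Space) (x - y)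
        = (t : ℝ) • (Φ x - Φ y) := by
      simp only [ContinuousLinearEquiv.coe_coe, ContinuousLinearEquiv.refl_apply, smul_sub]
      abel
    rw [h1, norm_smul]
    have h2 := hΦ.dist_le_mul x y
    rw [dist_eq_norm, dist_eq_norm] at h2
    have h3 : ‖(t : ℝ)‖ ≤ 1 := by
      rw [Real.norm_eq_abs, abs_of_nonneg t.2.1]; exact t.2.2
    calc ‖(t : ℝ)‖ * ‖Φ x - Φ y‖ ≤ 1 * ‖Φ x - Φ y‖ := by gcongr
      _ ≤ _ := by rw [one_mul]; exact h2
  have hN : c < ‖((ContinuousLinearEquiv.refl ℝ Space).symm : Space →L[ℝ] Space)‖₊⁻¹ := by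
    have : ((ContinuousLinearEquiv.refl ℝ Space).symm : Space →L[ℝ] Space)
        = ContinuousLinearMap.id ℝ Space := rfl
    rw [this]
    have : ‖ContinuousLinearMap.id ℝ Space‖₊ = 1 := by
      ext; simp
    rw [this]; simpa using hc'
  refine ⟨fun t => (happrox t).toHomeomorph _ (Or.inr hN), ?_, ?_, ?_⟩
  · change Continuous fun p : unitInterval × Space => p.2 + (p.1 : ℝ) • Φ p.2
    have := hΦ.continuous
    fun_prop
  · intro x
    change x + ((0 : unitInterval) : ℝ) • Φ x = x
    simp
  · intro i
    change f i + ((1 : unitInterval) : ℝ) • Φ (f i) = g i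
    rw [← hΦD (Set.mem_range_self i), hDf]
    simp

/-- A straight line homotopy whose velocity is controlled by the distances gives an ambient
isotopy. -/
lemma of_straight_line {C : ℝ}
    (hC : ∀ τ ∈ Set.Icc (0 : ℝ) 1, ∀ i j, ‖(g i - f i) - (g j - f j)‖ ≤
      C * ‖(f i + τ • (g i - f i)) - (f j + τ • (g j - f j))‖) : AmbientIsotopic f g := by
  -- With `N > C`, each of `N` equal substeps has a displacement with Lipschitz constant at most
  -- `max C 0 / N < 1` relative to the current position.
  obtain ⟨N, hN⟩ := exists_nat_gt (max C 0)
  have hN0 : (0 : ℝ) < N := (le_max_right _ _).trans_lt hN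
  have key : ∀ k : ℕ, k ≤ N →
      AmbientIsotopic f (fun i => f i + ((k : ℝ) / N) • (g i - f i)) := by
    intro k
    induction k with
    | zero => intro _; simpa using refl f
    | succ k ih =>
      intro hk
      refine (ih (by omega)).trans (of_displacement (c := max C 0 / N) (by positivity)
        ((div_lt_one hN0).2 hN) ?_)
      intro i j
      have h1 : ∀ i, (f i + (((k + 1 : ℕ) : ℝ) / N) • (g i - f i))
          - (f i + ((k : ℝ) / N) • (g i - f i)) = (1 / (N : ℝ)) • (g i - f i) := by
        intro i
        rw [add_sub_add_left_eq_sub, ← sub_smul]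
        congr 1
        push_cast
        ring
      rw [h1, h1, ← smul_sub, norm_smul, Real.norm_eq_abs, abs_of_pos (by positivity)]
      have h2 := hC ((k : ℝ) / N) ⟨by positivity, (div_le_one hN0).2 (by exact_mod_cast (by omega))⟩
        i j
      have h3 := h2.trans (mul_le_mul_of_nonneg_right (le_max_left C 0) (norm_nonneg _))
      refine (mul_le_mul_of_nonneg_left h3 (by positivity : 0 ≤ 1 / (N : ℝ))).trans_eq ?_
      rw [← mul_assoc, one_div_mul_eq_div]
  have := key N le_rfl
  simpa [div_self hN0.ne'] using this

end AmbientIsotopic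

/-! ### Closed braids in cylindrical coordinates -/

/-- A separation estimate for closed curves that are transverse to the pages of an open book. -/
lemma norm_displacement_le {E : Type*} [NormedAddCommGroup E] {X D : Fin 3 → unitInterval → E}
    {σ : Equiv.Perm (Fin 3)} {K m B c : ℝ} (hK : 0 ≤ K) (hm : 0 < m) (hc : 0 < c)
    (hX : ∀ k u v, ‖X k u - X k v‖ ≤ K * |(u : ℝ) - v|)
    (hD : ∀ k u v, ‖D k u - D k v‖ ≤ K * |(u : ℝ) - v|)
    (hsep : ∀ k l u, k ≠ l → m ≤ ‖X k u - X l u‖)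
    (hB : ∀ k u, ‖D k u‖ ≤ B)
    (hnear : ∀ k l (u v : unitInterval), c * |(u : ℝ) - v| ≤ ‖X k u - X l v‖ ∨
      c * (1 - |(u : ℝ) - v|) ≤ ‖X k u - X l v‖)
    (hX1 : ∀ k, X k 1 = X (σ k) 0) (hD1 : ∀ k, D k 1 = D (σ k) 0)
    (k l : Fin 3) (u v : unitInterval) :
    ‖D k u - D l v‖ ≤ (K / c + 2 * B * (K + c) / (m * c)) * ‖X k u - X l v‖ := by
  have hB0 : 0 ≤ B := (norm_nonneg _).trans (hB 0 0)
  -- Here `δ` is the distance of the parameters on the circle. On one string the displacements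
  -- differ by at most `K δ`, and `c δ ≤ x`. On different strings `m ≤ x + K δ` bounds `x` below by
  -- `m c / (K + c)`, while the displacements differ by at most `2 B`. The constant is the sum of
  -- both bounds.
  have finish : ∀ δ : ℝ, c * δ ≤ ‖X k u - X l v‖ →
      (‖D k u - D l v‖ ≤ K * δ ∨ m - K * δ ≤ ‖X k u - X l v‖) →
      ‖D k u - D l v‖ ≤ (K / c + 2 * B * (K + c) / (m * c)) * ‖X k u - X l v‖ := by
    intro δ h1 h2
    set x := ‖X k u - X l v‖ with hx
    have hx0 : 0 ≤ x := norm_nonneg _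
    rw [add_mul]
    rcases h2 with h2 | h2
    · have : K * δ ≤ K / c * x := by
        rw [div_mul_eq_mul_div, le_div_iff₀ hc]; nlinarith
      have : 0 ≤ 2 * B * (K + c) / (m * c) * x := by positivity
      linarith
    · have e1 : ‖D k u - D l v‖ ≤ 2 * B := by
        have := norm_sub_le (D k u) (D l v)
        linarith [hB k u, hB l v]
      have e2 : m * c ≤ (K + c) * x := by nlinarith
      have e3 : 2 * B ≤ 2 * B * (K + c) / (m * c) * x := by
        rw [div_mul_eq_mul_div, le_div_iff₀ (by positivity)]
        nlinarith
      have : 0 ≤ K / c * x := by positivity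
      linarith
  -- Here the short way from `u` to `v` passes through the page of parameter 0, where string `l`
  -- continues as `σ l`; the labels to compare are `k` and `σ l`.
  have wrap : ∀ (k l : Fin 3) (u v : unitInterval), (u : ℝ) ≤ v →
      (‖D k u - D l v‖ ≤ K * (1 - |(u : ℝ) - v|) ∨
        m - K * (1 - |(u : ℝ) - v|) ≤ ‖X k u - X l v‖) := by
    intro k l u v huv
    have e : 1 - |(u : ℝ) - v|
        = |(u : ℝ) - (0 : unitInterval)| + |((1 : unitInterval) : ℝ) - v| := by
      rw [abs_of_nonpos (by linarith), abs_of_nonneg (by simpa using u.2.1),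
        abs_of_nonneg (by simpa using v.2.2)]
      simp; ring
    rw [e, mul_add]
    by_cases hkl : k = σ l
    · left
      have : D k u - D l v = (D k u - D k 0) + (D l 1 - D l v) := by rw [hD1, hkl]; abel
      rw [this]
      exact (norm_add_le _ _).trans (add_le_add (hD _ _ _) (hD _ _ _))
    · right
      have h1 := hsep k (σ l) 0 hkl
      have : X k 0 - X (σ l) 0 = (X k u - X l v) - (X k u - X k 0) - (X l 1 - X l v) := by
        rw [hX1]; abel
      rw [this] at h1
      have h2 := norm_sub_le ((X k u - X l v) - (X k u - X k 0)) (X l 1 - X l v)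
      have h3 := norm_sub_le (X k u - X l v) (X k u - X k 0)
      have h4 := hX k u 0
      have h5 := hX l 1 v
      linarith
  rcases hnear k l u v with h | h
  · refine finish _ h ?_
    by_cases hkl : k = l
    · left; subst hkl; exact hD _ _ _
    · right
      have h1 := hsep k l u hkl
      have : X k u - X l u = (X k u - X l v) - (X l u - X l v) := by abel
      rw [this] at h1
      have h2 := norm_sub_le (X k u - X l v) (X l u - X l v)
      have h3 := hX l u v
      linarith
  · refine finish _ h ?_
    rcases le_total (u : ℝ) v with huv | huv
    · exact wrap k l u v huv
    · have := wrap l k v u huv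
      rwa [norm_sub_rev (D l v), norm_sub_rev (X l v), abs_sub_comm (v : ℝ)] at this

/-- In the horizontal plane the squared chord is `(r - r')² + 2 r r' (1 - cos)`, so it is bounded
below by the difference of the angles once both radii are at least `r₀`. -/
lemma two_mul_abs_le_norm_cylindrical_sub {r₀ r r' θ θ' h h' d : ℝ} (h0 : 0 < r₀) (hr : r₀ ≤ r)
    (hr' : r₀ ≤ r') (hd : |d| ≤ 1 / 2) (hθ : Real.cos (θ - θ') = Real.cos (2 * Real.pi * d)) :
    2 * r₀ * |d| ≤ ‖cylindrical r θ h - cylindrical r' θ' h'‖ := by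
  have h1 : |r * Real.cos θ - r' * Real.cos θ'| ≤ ‖cylindrical r θ h - cylindrical r' θ' h'‖ :=
    norm_le_pi_norm (cylindrical r θ h - cylindrical r' θ' h') 0
  have h2 : |r * Real.sin θ - r' * Real.sin θ'| ≤ ‖cylindrical r θ h - cylindrical r' θ' h'‖ :=
    norm_le_pi_norm (cylindrical r θ h - cylindrical r' θ' h') 1
  generalize ‖cylindrical r θ h - cylindrical r' θ' h'‖ = x at h1 h2 ⊢
  have hx0 : 0 ≤ x := (abs_nonneg _).trans h1
  have h3 := sq_le_sq' (abs_le.1 h1).1 (abs_le.1 h1).2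
  have h4 := sq_le_sq' (abs_le.1 h2).1 (abs_le.1 h2).2
  have h5 : 2 * r * r' * (1 - Real.cos (θ - θ')) ≤ 2 * x ^ 2 := by
    rw [Real.cos_sub]
    have e1 := Real.sin_sq_add_cos_sq θ
    have e2 := Real.sin_sq_add_cos_sq θ'
    have e3 : 2 * r * r' * (1 - (Real.cos θ * Real.cos θ' + Real.sin θ * Real.sin θ'))
        = (r * Real.cos θ - r' * Real.cos θ') ^ 2 + (r * Real.sin θ - r' * Real.sin θ') ^ 2
          - (r - r') ^ 2 := by
      linear_combination -r ^ 2 * e1 - r' ^ 2 * e2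
    rw [e3]
    linarith [sq_nonneg (r - r')]
  -- Half-angle formula and Jordan's inequality: `1 - cos (2π d) = 2 sin² (π |d|)` and `sin (π |d|)
  -- ≥ 2 |d|` for `|d| ≤ 1/2`.
  have h6 : 8 * |d| ^ 2 ≤ 1 - Real.cos (θ - θ') := by
    have e : Real.cos (θ - θ') = 1 - 2 * Real.sin (Real.pi * |d|) ^ 2 := by
      rw [hθ, ← Real.cos_abs, abs_mul, abs_of_pos Real.two_pi_pos, mul_assoc, Real.cos_two_mul,
        Real.cos_sq']
      ring
    have hpi := Real.pi_pos
    have := Real.mul_le_sin (x := Real.pi * |d|) (by positivity) (by nlinarith)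
    have e2 : 2 / Real.pi * (Real.pi * |d|) = 2 * |d| := by field_simp
    rw [e2] at this
    have h0 : 0 ≤ 2 * |d| := by positivity
    rw [e]
    nlinarith
  have h7 : (2 * r₀ * |d|) ^ 2 ≤ x ^ 2 := by
    have e : r₀ * r₀ ≤ r * r' := mul_le_mul hr hr' h0.le (h0.le.trans hr)
    have e' : 0 ≤ 1 - Real.cos (θ - θ') := by linarith [Real.cos_le_one (θ - θ')]
    have e3 : r₀ * r₀ * (8 * |d| ^ 2) ≤ r * r' * (1 - Real.cos (θ - θ')) :=
      mul_le_mul e h6 (by positivity) (le_trans (by positivity) e)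
    nlinarith
  exact (pow_le_pow_iff_left₀ (by positivity) hx0 two_ne_zero).1 h7

/-- The curves in three-space that run once around the axis, with given distances from the axis and
heights. -/
noncomputable def trace (f : unitInterval → Fin 3 → ℝ × ℝ) (q : Fin 3 × unitInterval) : Space :=
  cylindrical (f q.2 q.1).1 (2 * Real.pi * q.2) (f q.2 q.1).2

/-- The parameter is the polar angle divided by `2π`, so points at different parameters lie in
different half planes through the axis. The second alternative measures the angle the other way
round. -/
lemma trace_near {f : unitInterval → Fin 3 → ℝ × ℝ} {r₀ : ℝ} (h0 : 0 < r₀)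
    (hf : ∀ u k, r₀ ≤ (f u k).1) (k l : Fin 3) (u v : unitInterval) :
    2 * r₀ * |(u : ℝ) - v| ≤ ‖trace f (k, u) - trace f (l, v)‖ ∨
      2 * r₀ * (1 - |(u : ℝ) - v|) ≤ ‖trace f (k, u) - trace f (l, v)‖ := by
  have hle : |(u : ℝ) - v| ≤ 1 := by
    rw [abs_le]; constructor <;> linarith [u.2.1, u.2.2, v.2.1, v.2.2]
  have e1 : 2 * Real.pi * (u : ℝ) - 2 * Real.pi * v = 2 * Real.pi * (u - v) := by ring
  rcases le_total |(u : ℝ) - v| (1 / 2) with h | h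
  · left
    exact two_mul_abs_le_norm_cylindrical_sub h0 (hf _ _) (hf _ _) h (by rw [e1])
  · right
    rw [← abs_of_nonneg (sub_nonneg.2 hle)]
    refine two_mul_abs_le_norm_cylindrical_sub h0 (hf _ _) (hf _ _) ?_ ?_
    · rw [abs_of_nonneg (sub_nonneg.2 hle)]; linarith
    · rw [e1, mul_sub (2 * Real.pi) 1, mul_one, Real.cos_two_pi_sub, ← Real.cos_abs, abs_mul,
        abs_of_pos Real.two_pi_pos]

lemma continuous_cylindrical_comp {α : Type*} [TopologicalSpace α] {r θ h : α → ℝ}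
    (hr : Continuous r) (hθ : Continuous θ) (hh : Continuous h) :
    Continuous (fun a => cylindrical (r a) (θ a) (h a)) := by
  refine continuous_pi fun i => ?_
  fin_cases i
  · exact hr.mul (Real.continuous_cos.comp hθ)
  · exact hr.mul (Real.continuous_sin.comp hθ)
  · exact hh

lemma norm_cylindrical_sub_le {r θ h r' θ' h' R : ℝ} (hR : |r'| ≤ R) :
    ‖cylindrical r θ h - cylindrical r' θ' h'‖ ≤ |r - r'| + R * |θ - θ'| + |h - h'| := by
  have hR0 : 0 ≤ R := (abs_nonneg _).trans hR
  have hb := abs_nonneg (r - r')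
  have hb' := abs_nonneg (h - h')
  have hb'' : 0 ≤ R * |θ - θ'| := by positivity
  have key : ∀ F : ℝ → ℝ, |F θ| ≤ 1 → |F θ - F θ'| ≤ |θ - θ'| →
      |r * F θ - r' * F θ'| ≤ |r - r'| + R * |θ - θ'| + |h - h'| := by
    intro F h1 h2
    have : r * F θ - r' * F θ' = (r - r') * F θ + r' * (F θ - F θ') := by ring
    rw [this]
    refine (abs_add_le _ _).trans ?_
    rw [abs_mul, abs_mul]
    have e1 : |r - r'| * |F θ| ≤ |r - r'| * 1 := by gcongr
    have e2 : |r'| * |F θ - F θ'| ≤ R * |θ - θ'| := by gcongr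
    linarith
  refine (pi_norm_le_iff_of_nonneg (by positivity)).2 fun i => ?_
  fin_cases i
  · simpa [cylindrical] using key Real.cos (Real.abs_cos_le_one _) (by
      simpa [Real.dist_eq] using Real.lipschitzWith_cos.dist_le_mul θ θ')
  · simpa [cylindrical] using key Real.sin (Real.abs_sin_le_one _) (by
      simpa [Real.dist_eq] using Real.lipschitzWith_sin.dist_le_mul θ θ')
  · simp only [cylindrical, Pi.sub_apply, Real.norm_eq_abs]
    change |h - h'| ≤ _
    linarith

open NNReal in
lemma exists_lipschitz_trace {f : unitInterval → Fin 3 → ℝ × ℝ} {K : ℝ≥0}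
    (hf : LipschitzWith K f) :
    ∃ C : ℝ, 0 ≤ C ∧ ∀ k u v, ‖trace f (k, u) - trace f (k, v)‖ ≤ C * |(u : ℝ) - v| := by
  obtain ⟨R, hR⟩ := (isCompact_range hf.continuous).isBounded.exists_norm_le
  have hR' : ∀ u k, |(f u k).1| ≤ R := fun u k =>
    ((norm_fst_le (f u k)).trans (norm_le_pi_norm _ k)).trans (hR _ ⟨u, rfl⟩)
  have hR0 : 0 ≤ R := (abs_nonneg _).trans (hR' 0 0)
  refine ⟨K + R * (2 * Real.pi) + K, by have := Real.pi_pos; positivity, fun k u v => ?_⟩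
  refine (norm_cylindrical_sub_le (hR' v k)).trans ?_
  have h1 : dist (f u k) (f v k) ≤ K * |(u : ℝ) - v| := by
    refine (dist_le_pi_dist _ _ k).trans ?_
    simpa [Subtype.dist_eq, Real.dist_eq] using hf.dist_le_mul u v
  rw [Prod.dist_eq, max_le_iff, Real.dist_eq, Real.dist_eq] at h1
  rw [← mul_sub, abs_mul, abs_of_pos Real.two_pi_pos]
  linarith [h1.1, h1.2]

lemma exists_pos_forall_le {α ι : Type*} [TopologicalSpace α] [CompactSpace α] [Finite ι]
    {f : ι → α → ℝ} (hc : ∀ i, Continuous (f i)) (hpos : ∀ i a, 0 < f i a) :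
    ∃ m : ℝ, 0 < m ∧ ∀ i a, m ≤ f i a := by
  rcases isEmpty_or_nonempty α with hα | hα
  · exact ⟨1, one_pos, fun i a => hα.elim a⟩
  rcases isEmpty_or_nonempty ι with hι | hι
  · exact ⟨1, one_pos, fun i a => hι.elim i⟩
  have : ∀ i, ∃ m : ℝ, 0 < m ∧ ∀ a, m ≤ f i a := by
    intro i
    obtain ⟨p, -, hp⟩ := isCompact_univ.exists_isMinOn Set.univ_nonempty (hc i).continuousOn
    exact ⟨_, hpos i p, fun a => hp (Set.mem_univ a)⟩
  choose m hm hm' using this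
  cases nonempty_fintype ι
  exact ⟨Finset.univ.inf' Finset.univ_nonempty m, by simp [Finset.lt_inf'_iff, hm],
    fun i a => (Finset.inf'_le _ (Finset.mem_univ i)).trans (hm' i a)⟩

lemma continuous_trace {α : Type*} [TopologicalSpace α] {f : α → unitInterval → Fin 3 → ℝ × ℝ}
    {u : α → unitInterval} {k : Fin 3} (hf : Continuous fun a => f a (u a) k) (hu : Continuous u) :
    Continuous fun a => trace (f a) (k, u a) :=
  continuous_cylindrical_comp hf.fst (by fun_prop) hf.snd

lemma trace_one {f : unitInterval → Fin 3 → ℝ × ℝ} {σ : Equiv.Perm (Fin 3)}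
    (hf : ∀ k, f 1 k = f 0 (σ k)) (k : Fin 3) : trace f (k, 1) = trace f (σ k, 0) := by
  simp [trace, cylindrical, hf]

/-- At a fixed parameter all curves lie in one half plane bounded by the axis, where radius and
height are linear coordinates. Straight line motions of configurations are therefore straight line
motions in space. -/
lemma trace_add_smul (f g : unitInterval → Fin 3 → ℝ × ℝ) (τ : ℝ) (q : Fin 3 × unitInterval) :
    trace (fun u k => f u k + τ • (g u k - f u k)) q = trace f q + τ • (trace g q - trace f q) := by
  ext i
  fin_cases i <;> simp [trace, cylindrical] <;> ring

/-- A straight line homotopy of closed braids keeps a positive distance from the axis, and positive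
distances between the strings. -/
lemma exists_separation {f g : unitInterval → Fin 3 → ℝ × ℝ} (hfc : Continuous f)
    (hgc : Continuous g) (hfpos : ∀ u k, 0 < (f u k).1) (hgpos : ∀ u k, 0 < (g u k).1)
    (hne : ∀ τ : unitInterval, ∀ u k l, k ≠ l →
      f u k + (τ : ℝ) • (g u k - f u k) ≠ f u l + (τ : ℝ) • (g u l - f u l)) :
    ∃ r₀ m : ℝ, 0 < r₀ ∧ 0 < m ∧
      (∀ (τ u : unitInterval) k, r₀ ≤ (f u k + (τ : ℝ) • (g u k - f u k)).1) ∧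
      ∀ (τ : unitInterval) k l u, k ≠ l →
        m ≤ ‖trace (fun u k => f u k + (τ : ℝ) • (g u k - f u k)) (k, u)
          - trace (fun u k => f u k + (τ : ℝ) • (g u k - f u k)) (l, u)‖ := by
  have hFc : ∀ k, Continuous fun p : unitInterval × unitInterval =>
      f p.2 k + (p.1 : ℝ) • (g p.2 k - f p.2 k) := by
    intro k; fun_prop
  have hFpos : ∀ (τ u : unitInterval) k, 0 < (f u k + (τ : ℝ) • (g u k - f u k)).1 := by
    intro τ u k
    have h1 := hfpos u k
    have h2 := hgpos u k
    have h3 := τ.2.1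
    have h4 := τ.2.2
    simp only [Prod.fst_add, Prod.smul_fst, Prod.fst_sub, smul_eq_mul]
    rcases h3.eq_or_lt with h | h
    · rw [← h]; linarith
    · nlinarith
  have hFtc : ∀ k, Continuous fun p : unitInterval × unitInterval =>
      trace (fun u k => f u k + (p.1 : ℝ) • (g u k - f u k)) (k, p.2) :=
    fun k => continuous_trace (hFc k) continuous_snd
  obtain ⟨r₀, hr₀, hr₀'⟩ := exists_pos_forall_le (fun k => (hFc k).fst) fun k p => hFpos p.1 p.2 k
  obtain ⟨m, hm, hm'⟩ := exists_pos_forall_le (ι := {q : Fin 3 × Fin 3 // q.1 ≠ q.2})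
    (fun q => ((hFtc q.1.1).sub (hFtc q.1.2)).norm) (by
      rintro ⟨⟨k, l⟩, hkl⟩ ⟨τ, u⟩
      refine norm_pos_iff.2 (sub_ne_zero.2 fun h => hne τ u k l hkl ?_)
      obtain ⟨e1, e2, -⟩ := cylindrical_inj (hFpos τ u k) (hFpos τ u l) h
      exact Prod.ext e1 e2)
  exact ⟨r₀, m, hr₀, hm, fun τ u k => hr₀' k (τ, u), fun τ k l u hkl => hm' ⟨(k, l), hkl⟩ (τ, u)⟩

open NNReal in
/-- Two closed braids such that the straight lines between them avoid collisions are ambient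
isotopic. -/
lemma ambientIsotopic_trace_of_straight_line {f g : unitInterval → Fin 3 → ℝ × ℝ}
    {K K' : ℝ≥0} (hf : LipschitzWith K f) (hg : LipschitzWith K' g) {σ : Equiv.Perm (Fin 3)}
    (hfσ : ∀ k, f 1 k = f 0 (σ k)) (hgσ : ∀ k, g 1 k = g 0 (σ k))
    (hfpos : ∀ u k, 0 < (f u k).1) (hgpos : ∀ u k, 0 < (g u k).1)
    (hne : ∀ τ : unitInterval, ∀ u k l, k ≠ l →
      f u k + (τ : ℝ) • (g u k - f u k) ≠ f u l + (τ : ℝ) • (g u l - f u l)) :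
    AmbientIsotopic (trace f) (trace g) := by
  obtain ⟨r₀, m, hr₀, hm, hr₀', hm'⟩ :=
    exists_separation hf.continuous hg.continuous hfpos hgpos hne
  obtain ⟨C, hC0, hC⟩ := exists_lipschitz_trace hf
  obtain ⟨C', hC0', hC'⟩ := exists_lipschitz_trace hg
  have hDlip : ∀ k u v, ‖(trace g (k, u) - trace f (k, u)) - (trace g (k, v) - trace f (k, v))‖ ≤
      (C + C') * |(u : ℝ) - v| := by
    intro k u v
    rw [sub_sub_sub_comm]
    have := norm_sub_le (trace g (k, u) - trace g (k, v)) (trace f (k, u) - trace f (k, v))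
    have := hC k u v
    have := hC' k u v
    linarith
  have hXlip : ∀ (τ : unitInterval) k u v,
      ‖trace (fun u k => f u k + (τ : ℝ) • (g u k - f u k)) (k, u)
        - trace (fun u k => f u k + (τ : ℝ) • (g u k - f u k)) (k, v)‖ ≤
      (2 * C + C') * |(u : ℝ) - v| := by
    intro τ k u v
    rw [trace_add_smul, trace_add_smul, add_sub_add_comm, ← smul_sub]
    refine (norm_add_le _ _).trans ?_
    rw [norm_smul, Real.norm_eq_abs, abs_of_nonneg τ.2.1]
    have h1 := hC k u v
    have h2 : (τ : ℝ) * ‖(trace g (k, u) - trace f (k, u)) - (trace g (k, v) - trace f (k, v))‖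
        ≤ 1 * ((C + C') * |(u : ℝ) - v|) :=
      mul_le_mul τ.2.2 (hDlip k u v) (norm_nonneg _) zero_le_one
    linarith
  obtain ⟨B, hB⟩ : ∃ B : ℝ, ∀ q, ‖trace g q - trace f q‖ ≤ B := by
    have hc : ∀ {f : unitInterval → Fin 3 → ℝ × ℝ}, Continuous f → Continuous (trace f) := by
      intro f hf
      refine continuous_cylindrical_comp ?_ (by fun_prop) ?_
      · exact continuous_fst.comp (continuous_pi_iff.1 hf |> fun h => by
          exact continuous_prod_of_discrete_left.2 fun k => (h k))
      · exact continuous_snd.comp (continuous_pi_iff.1 hf |> fun h => by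
          exact continuous_prod_of_discrete_left.2 fun k => (h k))
    obtain ⟨B, hB⟩ := (isCompact_range
      ((hc hg.continuous).sub (hc hf.continuous))).isBounded.exists_norm_le
    exact ⟨B, fun q => hB _ ⟨q, rfl⟩⟩
  -- This is the constant of `norm_displacement_le` with `2 * C + C'` for `K` and `2 * r₀` for `c`.
  refine AmbientIsotopic.of_straight_line
    (C := (2 * C + C') / (2 * r₀) + 2 * B * (2 * C + C' + 2 * r₀) / (m * (2 * r₀))) ?_
  rintro τ hτ ⟨k, u⟩ ⟨l, v⟩
  rw [← trace_add_smul f g τ, ← trace_add_smul f g τ]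
  exact norm_displacement_le
    (X := fun k u => trace (fun u k => f u k + τ • (g u k - f u k)) (k, u))
    (D := fun k u => trace g (k, u) - trace f (k, u)) (by positivity) hm (by positivity)
    (hXlip ⟨τ, hτ⟩) (fun k u v => (hDlip k u v).trans (by gcongr; linarith))
    (fun k l u => hm' ⟨τ, hτ⟩ k l u) (fun k u => hB (k, u))
    (fun k l u v => trace_near hr₀ (fun u k => hr₀' ⟨τ, hτ⟩ u k) k l u v)
    (trace_one (σ := σ) fun k => by simp only [hfσ, hgσ])
    (fun k => by rw [trace_one hfσ, trace_one hgσ]) k l u v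

end ThreeBraid

namespace ThreeBraid

/-! ### Paths of configurations and homotopies of closed braids -/

/-- The configurations of three distinct labelled points in an open half plane. -/
abbrev Conf : Type := {p : Fin 3 → ℝ × ℝ // (∀ k, 0 < (p k).1) ∧ Function.Injective p}

/-- A path of configurations closes up with the permutation `σ`. -/
def Closes (σ : Equiv.Perm (Fin 3)) (f : C(unitInterval, Conf)) : Prop :=
  ∀ k, (f 1).1 k = (f 0).1 (σ k)

open NNReal in
-- Bernstein polynomials are Lipschitz on the unit interval, converge uniformly, and keep both end
-- values, so an approximation closes up with the same permutation. This is needed because the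
-- intermediate stages of a homotopy are only continuous.
lemma exists_lipschitz_approximation {E : Type*} [NormedAddCommGroup E] [NormedSpace ℝ E]
    (f : C(unitInterval, E)) {ε : ℝ} (hε : 0 < ε) :
    ∃ g : C(unitInterval, E), g 0 = f 0 ∧ g 1 = f 1 ∧ (∀ u, ‖g u - f u‖ < ε) ∧
      ∃ K : ℝ≥0, LipschitzWith K g := by
  have h := bernsteinApproximation_uniform f
  have h1 := (Metric.tendsto_atTop.1 h ε hε)
  obtain ⟨N, hN⟩ := h1
  refine ⟨bernsteinApproximation (N + 1) f, bernsteinApproximation.apply_zero _ _,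
    bernsteinApproximation.apply_one (by omega) _, fun u => ?_, ?_⟩
  -- The degree is `N + 1` because the end value at 1 is reproduced only in positive degree.
  · rw [← dist_eq_norm]
    exact (ContinuousMap.dist_apply_le_dist u).trans_lt (hN (N + 1) (by omega))
  · have hb : ∀ k, ∃ K : ℝ≥0, LipschitzWith K (bernstein (N + 1) k) := by
      intro k
      have hd : ContDiff ℝ 1
          (fun x : ℝ => ((N + 1).choose k : ℝ) * x ^ k * (1 - x) ^ (N + 1 - k)) := by fun_prop
      obtain ⟨K, hK⟩ := hd.locallyLipschitz.locallyLipschitzOn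
        |>.exists_lipschitzOnWith_of_compact (isCompact_Icc (a := (0 : ℝ)) (b := 1))
      refine ⟨K, LipschitzWith.of_dist_le_mul fun u v => ?_⟩
      rw [bernstein_apply, bernstein_apply]
      exact hK.dist_le_mul u u.2 v v.2
    choose K hK using hb
    refine ⟨∑ k : Fin (N + 1 + 1), K k * ‖f (bernstein.z k)‖₊, LipschitzWith.of_dist_le_mul ?_⟩
    intro u v
    rw [bernsteinApproximation.apply, bernsteinApproximation.apply, dist_eq_norm,
      ← Finset.sum_sub_distrib]
    push_cast
    rw [Finset.sum_mul]
    refine norm_sum_le_of_le _ fun k _ => ?_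
    rw [← sub_smul, norm_smul]
    have := (hK k).dist_le_mul u v
    rw [dist_eq_norm] at this
    calc _ ≤ (K k * dist u v) * ‖f (bernstein.z k)‖ := by gcongr
      _ = _ := by ring

/-- The balls of radius `ε / 2` around the points `p k` are convex and pairwise disjoint, and each
contains the whole segment from `a k` to `b k`. -/
lemma straight_line_ne {p a b : Fin 3 → ℝ × ℝ} {ε : ℝ}
    (hp : ∀ k l, k ≠ l → ε ≤ ‖p k - p l‖) (ha : ‖a - p‖ < ε / 2) (hb : ‖b - p‖ < ε / 2)
    (τ : unitInterval) {k l : Fin 3} (hkl : k ≠ l) :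
    a k + (τ : ℝ) • (b k - a k) ≠ a l + (τ : ℝ) • (b l - a l) := by
  have hc : ∀ k, ‖(a k + (τ : ℝ) • (b k - a k)) - p k‖ < ε / 2 := by
    intro k
    have h1 := (norm_le_pi_norm (a - p) k).trans_lt ha
    have h2 := (norm_le_pi_norm (b - p) k).trans_lt hb
    have := (convex_ball (p k) (ε / 2)).add_smul_sub_mem (x := a k) (y := b k)
      (by simpa [dist_eq_norm] using h1) (by simpa [dist_eq_norm] using h2) τ.2
    simpa [dist_eq_norm] using this
  intro h
  have h1 := hc k
  have h2 := hc l
  rw [h] at h1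
  have h3 := hp k l hkl
  have h4 := norm_sub_le_norm_sub_add_norm_sub (p k) (a l + (τ : ℝ) • (b l - a l)) (p l)
  rw [norm_sub_rev (p k) (a l + _)] at h4
  linarith

open NNReal in
/-- Homotopic closed braids are ambient isotopic. -/
lemma ambientIsotopic_trace_of_homotopicWith {f g : C(unitInterval, Conf)}
    {σ : Equiv.Perm (Fin 3)} (h : f.HomotopicWith g (Closes σ)) {K K' : ℝ≥0}
    (hf : LipschitzWith K fun u => (f u).1) (hg : LipschitzWith K' fun u => (g u).1) :
    AmbientIsotopic (trace fun u => (f u).1) (trace fun u => (g u).1) := by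
  obtain ⟨H⟩ := h
  set F : unitInterval × unitInterval → Fin 3 → ℝ × ℝ := fun p => (H p).1 with hF
  have hFc : Continuous F := continuous_subtype_val.comp H.continuous
  have hF1 : ∀ τ k, F (τ, 1) k = F (τ, 0) (σ k) := fun τ => H.prop τ
  obtain ⟨ε₁, hε₁, hr⟩ := exists_pos_forall_le (f := fun k p => (F p k).1)
    (fun k => by fun_prop) (fun k p => (H p).2.1 k)
  obtain ⟨ε₂, hε₂, hm⟩ := exists_pos_forall_le (ι := {q : Fin 3 × Fin 3 // q.1 ≠ q.2})
    (f := fun q p => ‖F p q.1.1 - F p q.1.2‖) (fun q => by fun_prop)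
    (fun q p => norm_pos_iff.2 (sub_ne_zero.2 fun h => q.2 ((H p).2.2 h)))
  -- Throughout the homotopy, `ε` bounds from below both the distances from the axis and the mutual
  -- distances of the points.
  set ε := min ε₁ ε₂
  have hε : 0 < ε := lt_min hε₁ hε₂
  obtain ⟨δ, hδ, hunif⟩ := Metric.uniformContinuous_iff.1
    (CompactSpace.uniformContinuous_of_continuous hFc) (ε / 4) (by positivity)
  obtain ⟨N, hN⟩ := exists_nat_gt (1 / δ)
  have hN0 : (0 : ℝ) < N := (by positivity : 0 < 1 / δ).trans hN
  -- A partition so fine that successive stages of the homotopy are less than `ε / 4` apart.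
  set t : ℕ → unitInterval := fun i => Set.projIcc 0 1 zero_le_one ((i : ℝ) / N) with ht
  have ht1 : ∀ i, dist (t i) (t (i + 1)) < δ := by
    intro i
    refine (LipschitzWith.projIcc zero_le_one |>.dist_le_mul _ _).trans_lt ?_
    rw [Real.dist_eq]
    have : (i : ℝ) / N - ((i + 1 : ℕ) : ℝ) / N = -(1 / N) := by push_cast; ring
    rw [this, abs_neg, abs_of_pos (by positivity), NNReal.coe_one, one_mul]
    exact (one_div_lt hδ hN0).1 hN
  have hpos : ∀ (p : unitInterval × unitInterval) (a : Fin 3 → ℝ × ℝ), ‖a - F p‖ < ε / 2 →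
      ∀ k, 0 < (a k).1 := by
    intro p a ha k
    have h1 := (norm_le_pi_norm (a - F p) k).trans_lt ha
    have h2 := (norm_fst_le ((a - F p) k)).trans_lt h1
    have h3 : ε ≤ (F p k).1 := (min_le_left _ _).trans (hr k p)
    rw [Real.norm_eq_abs, abs_lt] at h2
    have h4 : ((a - F p) k).1 = (a k).1 - (F p k).1 := rfl
    rw [h4] at h2
    linarith [h2.1]
  have hsep : ∀ p k l, k ≠ l → ε ≤ ‖F p k - F p l‖ := fun p k l hkl =>
    (min_le_right _ _).trans (hm ⟨(k, l), hkl⟩ p)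
  have step : ∀ (τ : unitInterval) (a b : unitInterval → Fin 3 → ℝ × ℝ) (K K' : ℝ≥0),
      LipschitzWith K a → LipschitzWith K' b → (∀ k, a 1 k = a 0 (σ k)) →
      (∀ k, b 1 k = b 0 (σ k)) → (∀ u, ‖a u - F (τ, u)‖ < ε / 2) →
      (∀ u, ‖b u - F (τ, u)‖ < ε / 2) → AmbientIsotopic (trace a) (trace b) := by
    intro τ a b K K' ha hb ha1 hb1 haF hbF
    exact ambientIsotopic_trace_of_straight_line ha hb ha1 hb1 (fun u => hpos _ _ (haF u))
      (fun u => hpos _ _ (hbF u))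
      fun s u k l hkl => straight_line_ne (hsep (τ, u)) (haF u) (hbF u) s hkl
  -- Induction along the partition: every Lipschitz closed braid within `ε / 4` of stage `i` is
  -- isotopic to `f`. In the step a Lipschitz approximation of stage `i` is compared with `a`; both
  -- lie within `ε / 4 + ε / 4 = ε / 2` of that stage, so straight lines avoid collisions.
  have key : ∀ i : ℕ, ∀ (a : unitInterval → Fin 3 → ℝ × ℝ) (K' : ℝ≥0), LipschitzWith K' a →
      (∀ k, a 1 k = a 0 (σ k)) → (∀ u, ‖a u - F (t i, u)‖ < ε / 4) →
      AmbientIsotopic (trace fun u => (f u).1) (trace a) := by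
    intro i
    induction i with
    | zero =>
      intro a K' ha ha1 haF
      have h0 : t 0 = 0 := by simp [ht, Set.projIcc_left]
      refine step 0 _ _ K K' hf ha (fun k => ?_) ha1 (fun u => ?_) (fun u => ?_)
      · have := hF1 0 k
        simpa [hF] using this
      · simpa [hF] using hε
      · rw [← h0]; exact (haF u).trans (by linarith)
    | succ i ih =>
      intro a K' ha ha1 haF
      obtain ⟨b, hb0, hb1, hbF, Kb, hKb⟩ := exists_lipschitz_approximation
        ⟨fun u => F (t i, u), by fun_prop⟩ (by positivity : 0 < ε / 4)
      have hbσ : ∀ k, b 1 k = b 0 (σ k) := by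
        intro k; rw [hb0, hb1]; exact hF1 _ k
      refine (ih b Kb hKb hbσ hbF).trans (step (t i) _ _ Kb K' hKb ha hbσ ha1
        (fun u => (hbF u).trans (by linarith)) fun u => ?_)
      have h1 : dist (F (t (i + 1), u)) (F (t i, u)) < ε / 4 := by
        refine hunif ?_
        rw [Prod.dist_eq, dist_self, dist_comm]
        exact max_lt (ht1 i) hδ
      rw [dist_eq_norm] at h1
      have h2 := norm_sub_le_norm_sub_add_norm_sub (a u) (F (t (i + 1), u)) (F (t i, u))
      linarith [haF u]
  have hN1 : t N = 1 := by simp [ht, div_self hN0.ne', Set.projIcc_right]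
  refine key N _ K' hg (fun k => ?_) fun u => ?_
  · have := hF1 1 k
    simpa [hF] using this
  · rw [hN1]; simpa [hF] using hε

end ThreeBraid

namespace ThreeBraid

/-! ### Closed braids given by sequences of letters -/

/-- The string that starts in place `k` is in place `places ℓ j k` after `j` letters of `ℓ`. -/
def places (ℓ : ℕ → Option Letter) : ℕ → Equiv.Perm (Fin 3)
  | 0 => 1
  | j + 1 => letterPerm (ℓ j) * places ℓ j

/-- Distance from the axis and height, at time `v ≥ 0`, of the string that starts in place `k`. -/
noncomputable def strand (ℓ : ℕ → Option Letter) (v : ℝ) (k : Fin 3) : ℝ × ℝ :=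
  (radius (ℓ ⌊v⌋₊) (places ℓ ⌊v⌋₊ k) (v - ⌊v⌋₊), height (ℓ ⌊v⌋₊) (places ℓ ⌊v⌋₊ k) (v - ⌊v⌋₊))

variable {ℓ ℓ' : ℕ → Option Letter}

lemma continuous_strand (ℓ : ℕ → Option Letter) : Continuous (strand ℓ) := by
  refine continuous_pi fun k => Continuous.prodMk ?_ ?_
  · exact continuous_glue (fun j => radius (ℓ j) (places ℓ j k)) (fun j => continuous_radius _ _)
      fun j => by rw [radius_one, radius_zero]; simp [places]
  · exact continuous_glue (fun j => height (ℓ j) (places ℓ j k)) (fun j => continuous_height _ _)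
      fun j => by rw [height_one, height_zero]

/-- The value `s = 1` is included because the end of a letter agrees with the beginning of the next
one, although the floor has jumped there. -/
lemma strand_add (ℓ : ℕ → Option Letter) (j : ℕ) {s : ℝ} (h0 : 0 ≤ s) (h1 : s ≤ 1) (k : Fin 3) :
    strand ℓ (j + s) k = (radius (ℓ j) (places ℓ j k) s, height (ℓ j) (places ℓ j k) s) := by
  rcases h1.lt_or_eq with h1 | rfl
  · have : ⌊(j : ℝ) + s⌋₊ = j := (Nat.floor_eq_iff (by positivity)).2 ⟨by linarith, by linarith⟩
    simp only [strand, this, add_sub_cancel_left]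
  · have : ⌊(j : ℝ) + 1⌋₊ = j + 1 := by exact_mod_cast Nat.floor_natCast (R := ℝ) (j + 1)
    simp only [strand, this]
    push_cast
    rw [sub_self, radius_zero, height_zero, radius_one, height_one]
    simp [places]

lemma strand_natCast (ℓ : ℕ → Option Letter) (j : ℕ) (k : Fin 3) :
    strand ℓ j k = ((places ℓ j k : ℝ) + 1, 0) := by
  have := strand_add ℓ j le_rfl zero_le_one k
  rwa [add_zero, radius_zero, height_zero] at this

lemma exists_nat_add (v : ℝ) (hv : 0 ≤ v) : ∃ (j : ℕ) (s : ℝ), 0 ≤ s ∧ s < 1 ∧ v = j + s :=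
  ⟨⌊v⌋₊, v - ⌊v⌋₊, sub_nonneg.2 (Nat.floor_le hv), by linarith [Nat.lt_floor_add_one v], by ring⟩

lemma strand_fst_pos (ℓ : ℕ → Option Letter) {v : ℝ} (hv : 0 ≤ v) (k : Fin 3) :
    0 < (strand ℓ v k).1 := by
  obtain ⟨j, s, h0, h1, rfl⟩ := exists_nat_add v hv
  rw [strand_add ℓ j h0 h1.le]
  exact radius_pos _ _ h0 h1

lemma strand_injective (ℓ : ℕ → Option Letter) {v : ℝ} (hv : 0 ≤ v) :
    Function.Injective (strand ℓ v) := by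
  obtain ⟨j, s, h0, h1, rfl⟩ := exists_nat_add v hv
  intro k l h
  rw [strand_add ℓ j h0 h1.le, strand_add ℓ j h0 h1.le, Prod.mk.injEq] at h
  exact (places ℓ j).injective (radius_height_inj _ _ _ h0 h1 h.1 h.2)

/-- The glued function may have corners at the integers, but the floor is locally constant to the
right, so the mean value inequality for right derivatives applies. -/
lemma abs_glue_sub_le (g g' : ℕ → ℝ → ℝ)
    (hd : ∀ j s, HasDerivAt (g j) (g' j s) s) (hb : ∀ j s, 0 ≤ s → s ≤ 1 → |g' j s| ≤ 1)
    (h : ∀ j, g j 1 = g (j + 1) 0) {x y : ℝ} (hx : 0 ≤ x) (hxy : x ≤ y) :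
    |g ⌊y⌋₊ (y - ⌊y⌋₊) - g ⌊x⌋₊ (x - ⌊x⌋₊)| ≤ y - x := by
  have hcont : Continuous (fun u : ℝ => g ⌊u⌋₊ (u - ⌊u⌋₊)) :=
    continuous_glue g (fun j => continuous_iff_continuousAt.2 fun s => (hd j s).continuousAt) h
  have := norm_image_sub_le_of_norm_deriv_right_le_segment (C := 1) (a := x) (b := y)
    (f := fun u : ℝ => g ⌊u⌋₊ (u - ⌊u⌋₊)) (f' := fun u => g' ⌊u⌋₊ (u - ⌊u⌋₊))
    hcont.continuousOn ?_ ?_ y ⟨hxy, le_rfl⟩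
  · simpa using this
  · intro u hu
    have hu0 : 0 ≤ u := hx.trans hu.1
    have h1 : HasDerivAt (fun v : ℝ => g ⌊u⌋₊ (v - ⌊u⌋₊)) (g' ⌊u⌋₊ (u - ⌊u⌋₊)) u :=
      (hd ⌊u⌋₊ (u - ⌊u⌋₊)).comp_sub_const u _
    refine h1.hasDerivWithinAt.congr_of_eventuallyEq ?_ rfl
    have : Set.Ico u (⌊u⌋₊ + 1 : ℝ) ∈ nhdsWithin u (Set.Ici u) :=
      Ico_mem_nhdsGE (Nat.lt_floor_add_one u)
    filter_upwards [this] with v hv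
    have : ⌊v⌋₊ = ⌊u⌋₊ := (Nat.floor_eq_iff (hu0.trans hv.1)).2
      ⟨(Nat.floor_le hu0).trans hv.1, hv.2⟩
    rw [this]
  · intro u hu
    have hu0 : 0 ≤ u := hx.trans hu.1
    rw [Real.norm_eq_abs]
    exact hb _ _ (sub_nonneg.2 (Nat.floor_le hu0)) (by linarith [Nat.lt_floor_add_one u])

lemma exists_hasDerivAt_radius (a : Option Letter) (p : Fin 3) :
    ∃ r' : ℝ, (∀ s, HasDerivAt (radius a p) r' s) ∧ |r'| ≤ 1 := by
  rcases a with _ | a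
  · exact ⟨0, fun s => hasDerivAt_const _ _, by simp⟩
  · have h1 : ∀ s, HasDerivAt (fun s : ℝ => (p : ℝ) + 1 + s) 1 s := fun s =>
      (hasDerivAt_id s).const_add _
    have h2 : ∀ s, HasDerivAt (fun s : ℝ => (p : ℝ) + 1 - s) (-1) s := fun s =>
      (hasDerivAt_id s).const_sub _
    have h3 : ∀ s, HasDerivAt (fun _ : ℝ => (p : ℝ) + 1) 0 s := fun s => hasDerivAt_const _ _
    by_cases hp : p = a.1.castSucc
    · refine ⟨1, fun s => (h1 s).congr_of_eventuallyEq (.of_forall fun t => ?_), by simp⟩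
      simp [radius, hp]
    · by_cases hp' : p = a.1.succ
      · refine ⟨-1, fun s => (h2 s).congr_of_eventuallyEq (.of_forall fun t => ?_), by simp⟩
        simp [radius, hp', Fin.castSucc_lt_succ.ne']
      · refine ⟨0, fun s => (h3 s).congr_of_eventuallyEq (.of_forall fun t => ?_), by simp⟩
        simp [radius, hp, hp']

lemma exists_hasDerivAt_height (a : Option Letter) (p : Fin 3) :
    ∃ h' : ℝ → ℝ, (∀ s, HasDerivAt (height a p) (h' s) s) ∧ ∀ s, 0 ≤ s → s ≤ 1 → |h' s| ≤ 1 := by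
  have key : ∃ c : ℝ, |c| ≤ 1 ∧ ∀ s, height a p s = c * (s * (1 - s)) := by
    rcases a with _ | ⟨i, b⟩
    · exact ⟨0, by simp, by simp [height]⟩
    · refine ⟨(if b then 1 else -1) * (if p = i.castSucc then 1 else if p = i.succ then -1 else 0),
        ?_, fun s => ?_⟩
      · split_ifs <;> simp
      · simp only [height]
        split_ifs <;> ring
  obtain ⟨c, hc, h⟩ := key
  refine ⟨fun s => c * (1 * (1 - s) + s * (0 - 1)), fun s => ?_, fun s h0 h1 => ?_⟩
  · rw [funext h]
    exact ((hasDerivAt_id s).mul ((hasDerivAt_const s (1 : ℝ)).sub (hasDerivAt_id s))).const_mul c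
  · rw [abs_mul]
    have : |1 * (1 - s) + s * (0 - 1)| ≤ 1 := by rw [abs_le]; constructor <;> linarith
    exact mul_le_one₀ hc (abs_nonneg _) this

lemma dist_strand_le (ℓ : ℕ → Option Letter) {x y : ℝ} (hx : 0 ≤ x) (hy : 0 ≤ y) :
    dist (strand ℓ x) (strand ℓ y) ≤ dist x y := by
  wlog hxy : x ≤ y
  · rw [dist_comm, dist_comm x]
    exact this ℓ hy hx (le_of_not_ge hxy)
  refine (dist_pi_le_iff dist_nonneg).2 fun k => ?_
  rw [dist_comm, dist_comm x, Prod.dist_eq, max_le_iff, Real.dist_eq, Real.dist_eq, Real.dist_eq,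
    abs_of_nonneg (sub_nonneg.2 hxy)]
  constructor
  · choose r' hr hr' using fun j => exists_hasDerivAt_radius (ℓ j) (places ℓ j k)
    exact abs_glue_sub_le (fun j => radius (ℓ j) (places ℓ j k)) (fun j _ => r' j) hr
      (fun j _ _ _ => hr' j) (fun j => by rw [radius_one, radius_zero]; simp [places]) hx hxy
  · choose r' hr hr' using fun j => exists_hasDerivAt_height (ℓ j) (places ℓ j k)
    exact abs_glue_sub_le (fun j => height (ℓ j) (places ℓ j k)) r' hr hr'
      (fun j => by rw [height_one, height_zero]) hx hxy

/-- The configuration at time `v`. -/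
noncomputable def conf (ℓ : ℕ → Option Letter) (v : ℝ) : Conf :=
  -- Negative times get the configuration of time 0, so that `conf` is defined and continuous on the
  -- whole line.
  ⟨strand ℓ (max v 0), strand_fst_pos ℓ (le_max_right _ _), strand_injective ℓ (le_max_right _ _)⟩

lemma conf_val {v : ℝ} (hv : 0 ≤ v) : (conf ℓ v).1 = strand ℓ v := by
  simp [conf, hv]

lemma continuous_conf (ℓ : ℕ → Option Letter) : Continuous (conf ℓ) :=
  ((continuous_strand ℓ).comp (continuous_id.max continuous_const)).subtype_mk _

/-- The path of configurations that is given by the first `N` letters of `ℓ`. -/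
noncomputable def braid (ℓ : ℕ → Option Letter) (N : ℕ) : C(unitInterval, Conf) :=
  ⟨fun u => conf ℓ (N * u), (continuous_conf ℓ).comp (by fun_prop)⟩

lemma braid_val (ℓ : ℕ → Option Letter) (N : ℕ) (u : unitInterval) :
    (braid ℓ N u).1 = strand ℓ (N * u) := conf_val (mul_nonneg (Nat.cast_nonneg _) u.2.1)

lemma lipschitz_braid (ℓ : ℕ → Option Letter) (N : ℕ) :
    LipschitzWith N fun u => (braid ℓ N u).1 := by
  refine LipschitzWith.of_dist_le_mul fun u v => ?_
  rw [braid_val, braid_val]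
  refine (dist_strand_le ℓ (mul_nonneg (Nat.cast_nonneg _) u.2.1)
    (mul_nonneg (Nat.cast_nonneg _) v.2.1)).trans ?_
  rw [Real.dist_eq, ← mul_sub, abs_mul, Nat.abs_cast, Subtype.dist_eq, Real.dist_eq]
  simp

lemma strand_zero (ℓ : ℕ → Option Letter) (k : Fin 3) : strand ℓ 0 k = ((k : ℝ) + 1, 0) := by
  have := strand_natCast ℓ 0 k
  simpa [places] using this

/-- The curves of the closed braid that is given by the first `N` letters of `ℓ`. -/
noncomputable def closedBraid (ℓ : ℕ → Option Letter) (N : ℕ) : Fin 3 × unitInterval → Space :=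
  trace fun u => (braid ℓ N u).1

/-- Two closed braids are ambient isotopic after a permutation of the strings of the second. -/
def SameClosure (ℓ : ℕ → Option Letter) (N : ℕ) (ℓ' : ℕ → Option Letter) (N' : ℕ) : Prop :=
  ∃ ρ : Equiv.Perm (Fin 3),
    AmbientIsotopic (closedBraid ℓ N) (fun q => closedBraid ℓ' N' (ρ q.1, q.2))

namespace SameClosure

variable {N N' N'' : ℕ} {ℓ'' : ℕ → Option Letter}

lemma refl (ℓ : ℕ → Option Letter) (N : ℕ) : SameClosure ℓ N ℓ N := ⟨1, AmbientIsotopic.refl _⟩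

lemma symm (h : SameClosure ℓ N ℓ' N') : SameClosure ℓ' N' ℓ N := by
  obtain ⟨ρ, h⟩ := h
  refine ⟨ρ⁻¹, ?_⟩
  have := (h.symm.comp fun q : Fin 3 × unitInterval => (ρ⁻¹ q.1, q.2))
  have e : closedBraid ℓ' N' = (fun q : Fin 3 × unitInterval => closedBraid ℓ' N' (ρ q.1, q.2)) ∘
      fun q => (ρ⁻¹ q.1, q.2) := by
    ext1 q
    simp
  rw [e]
  exact this

lemma trans (h : SameClosure ℓ N ℓ' N') (h' : SameClosure ℓ' N' ℓ'' N'') :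
    SameClosure ℓ N ℓ'' N'' := by
  obtain ⟨ρ, h⟩ := h
  obtain ⟨ρ', h'⟩ := h'
  exact ⟨ρ' * ρ, h.trans (h'.comp fun q : Fin 3 × unitInterval => (ρ q.1, q.2))⟩

lemma of_homotopicWith {σ : Equiv.Perm (Fin 3)}
    (h : (braid ℓ N).HomotopicWith (braid ℓ' N') (Closes σ)) : SameClosure ℓ N ℓ' N' :=
  ⟨1, ambientIsotopic_trace_of_homotopicWith h (lipschitz_braid _ _) (lipschitz_braid _ _)⟩

end SameClosure

/-! ### Moves of closed braids: deletion of an idle unit, rotation, cancellation -/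

lemma places_congr {N : ℕ} (h : ∀ j < N, ℓ j = ℓ' j) : places ℓ N = places ℓ' N := by
  induction N with
  | zero => rfl
  | succ N ih => rw [places, places, h N (by omega), ih fun j hj => h j (by omega)]

lemma strand_congr {N : ℕ} (h : ∀ j < N, ℓ j = ℓ' j) {v : ℝ} (hv0 : 0 ≤ v) (hv : v ≤ N) :
    strand ℓ v = strand ℓ' v := by
  ext1 k
  rcases hv.lt_or_eq with hv | rfl
  · obtain ⟨j, s, h0, h1, rfl⟩ := exists_nat_add v hv0
    have hj : j < N := by
      have : (j : ℝ) < N := by linarith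
      exact_mod_cast this
    rw [strand_add _ _ h0 h1.le, strand_add _ _ h0 h1.le, h j hj,
      places_congr fun i hi => h i (by omega)]
  · rw [strand_natCast, strand_natCast, places_congr h]

/-- If two sequences agree after the time `c`, and if the strings are in the same places at this
time, then the strings agree afterwards. -/
lemma strand_congr_of_le {c : ℕ} (hc : places ℓ c = places ℓ' c) (h : ∀ j, c ≤ j → ℓ j = ℓ' j)
    {v : ℝ} (hv : (c : ℝ) ≤ v) : strand ℓ v = strand ℓ' v := by
  have hp : ∀ j, c ≤ j → places ℓ j = places ℓ' j := by
    intro j hj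
    induction j, hj using Nat.le_induction with
    | base => exact hc
    | succ j hj ih => rw [places, places, h j hj, ih]
  ext1 k
  obtain ⟨j, s, h0, h1, rfl⟩ := exists_nat_add v ((Nat.cast_nonneg _).trans hv)
  have hj : c ≤ j := by
    have : (c : ℝ) < j + 1 := by linarith
    have : c < j + 1 := by exact_mod_cast this
    omega
  rw [strand_add _ _ h0 h1.le, strand_add _ _ h0 h1.le, h j hj, hp j hj]

lemma sameClosure_of_eq {N : ℕ} (h : ∀ j < N, ℓ j = ℓ' j) : SameClosure ℓ N ℓ' N := by
  have : braid ℓ N = braid ℓ' N := by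
    ext1 u
    refine Subtype.ext ?_
    rw [braid_val, braid_val]
    exact strand_congr h (mul_nonneg (Nat.cast_nonneg _) u.2.1)
      (mul_le_of_le_one_right (Nat.cast_nonneg _) u.2.2)
  exact ⟨1, by rw [closedBraid, this]; exact AmbientIsotopic.refl _⟩

/-- Omitting a unit of time in which nothing happens. -/
lemma sameClosure_delete {c N : ℕ} (hcN : c ≤ N) (hlt : ∀ j < c, ℓ' j = ℓ j) (hc : ℓ c = none)
    (hge : ∀ j, c ≤ j → ℓ' j = ℓ (j + 1)) : SameClosure ℓ (N + 1) ℓ' N := by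
  have hpc : places ℓ' c = places ℓ c := places_congr hlt
  have hp : ∀ j, c ≤ j → places ℓ' j = places ℓ (j + 1) := by
    intro j hj
    induction j, hj using Nat.le_induction with
    | base => rw [hpc, places, hc]; simp [letterPerm]
    | succ j hj ih => rw [places, ih, hge j hj]; rfl
  -- This change of time rests at `c` during the idle unit `[c, c + 1]` and has slope 1 elsewhere.
  set g : ℝ → ℝ := fun v => min v c + max (v - (c + 1)) 0 with hg
  have hg0 : ∀ v, 0 ≤ v → 0 ≤ g v := fun v hv => by simp only [hg]; positivity
  have hstrand : ∀ v, 0 ≤ v → strand ℓ v = strand ℓ' (g v) := by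
    intro v hv
    rcases le_total v c with h1 | h1
    · have : g v = v := by
        simp only [hg]; rw [min_eq_left h1, max_eq_right (by linarith), add_zero]
      rw [this]
      exact (strand_congr hlt hv h1).symm
    rcases le_total v (c + 1) with h2 | h2
    · have : g v = c := by
        simp only [hg]; rw [min_eq_right h1, max_eq_right (by linarith), add_zero]
      rw [this]
      ext1 k
      have h3 := strand_add ℓ c (s := v - c) (by linarith) (by linarith) k
      rw [add_sub_cancel, hc] at h3
      rw [h3, strand_natCast, hpc]
      rfl
    · have : g v = v - 1 := by
        simp only [hg]; rw [min_eq_right h1, max_eq_left (by linarith)]; ring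
      rw [this]
      ext1 k
      obtain ⟨j, s, h0, h1, hv'⟩ := exists_nat_add (v - 1) (by linarith)
      have hj : c ≤ j := by
        have : (c : ℝ) < j + 1 := by linarith
        have : c < j + 1 := by exact_mod_cast this
        omega
      have hv'' : v = ((j + 1 : ℕ) : ℝ) + s := by push_cast; linarith
      rw [hv', hv'', strand_add _ _ h0 h1.le, strand_add _ _ h0 h1.le, hge j hj, hp j hj]
  have hgN : g ((N + 1 : ℕ) : ℝ) = N := by
    have : (c : ℝ) ≤ N := by exact_mod_cast hcN
    simp only [hg]; push_cast
    rw [min_eq_right (by linarith), max_eq_left (by linarith)]; ring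
  have hgc : Continuous g := by simp only [hg]; fun_prop
  -- Both paths run through the strings of `ℓ'` from time 0 to time `N`; interpolating the two time
  -- functions fixes both ends, so the closing permutation is kept.
  refine (SameClosure.of_homotopicWith (σ := places ℓ' N) ⟨⟨⟨⟨fun p =>
    conf ℓ' ((1 - (p.1 : ℝ)) * (N * p.2) + p.1 * g ((N + 1 : ℕ) * p.2)), ?_⟩, ?_, ?_⟩, ?_⟩⟩).symm
  · exact (continuous_conf ℓ').comp (by fun_prop)
  · intro u
    simp [braid]
  · intro u
    refine Subtype.ext ?_
    have h0 : (0 : ℝ) ≤ (N + 1 : ℕ) * u := mul_nonneg (Nat.cast_nonneg _) u.2.1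
    rw [braid_val, hstrand _ h0, ← conf_val (hg0 _ h0)]
    simp
  · intro τ k
    change (conf ℓ' _).1 k = (conf ℓ' _).1 _
    have h1 : (1 - (τ : ℝ)) * (N * (1 : unitInterval)) + τ * g ((N + 1 : ℕ) * (1 : unitInterval))
        = N := by
      simp only [Set.Icc.coe_one, mul_one, hgN]; ring
    have h2 : (1 - (τ : ℝ)) * (N * (0 : unitInterval)) + τ * g ((N + 1 : ℕ) * (0 : unitInterval))
        = 0 := by
      have : g 0 = 0 := by
        simp only [hg]; rw [min_eq_left (by positivity), max_eq_right (by linarith [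
          (Nat.cast_nonneg c : (0 : ℝ) ≤ c)]), add_zero]
      simp [this]
    rw [h1, h2, conf_val le_rfl, conf_val (Nat.cast_nonneg _), strand_natCast, strand_zero]

/-- Moving the first letter to the end. -/
lemma sameClosure_rotate {N : ℕ} (hN : ℓ N = ℓ 0) (h : ∀ j, ℓ' j = ℓ (j + 1)) :
    SameClosure ℓ N ℓ' N := by
  have hp : ∀ j, places ℓ (j + 1) = places ℓ' j * letterPerm (ℓ 0) := by
    intro j
    induction j with
    | zero => simp [places]
    | succ j ih => rw [places, ih, places, h, mul_assoc]
  have hshift : ∀ v, 0 ≤ v → ∀ k, strand ℓ (v + 1) k = strand ℓ' v (letterPerm (ℓ 0) k) := by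
    intro v hv k
    obtain ⟨j, s, h0, h1, rfl⟩ := exists_nat_add v hv
    have : (j : ℝ) + s + 1 = (j + 1 : ℕ) + s := by push_cast; ring
    rw [this, strand_add _ _ h0 h1.le, strand_add _ _ h0 h1.le, h, hp, Equiv.Perm.mul_apply]
  -- The time window `[1, N + 1]` of `ℓ` is the closed braid of `ℓ'`, with the strings relabelled by
  -- the permutation of the first letter.
  set f : C(unitInterval, Conf) := ⟨fun u => conf ℓ (N * u + 1),
    (continuous_conf ℓ).comp (by fun_prop)⟩ with hf
  have hfv : ∀ u, (f u).1 = fun k => (braid ℓ' N u).1 (letterPerm (ℓ 0) k) := by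
    intro u
    have h0 : (0 : ℝ) ≤ N * u := mul_nonneg (Nat.cast_nonneg _) u.2.1
    ext1 k
    rw [braid_val, ← hshift _ h0, hf]
    simp only [ContinuousMap.coe_mk]
    rw [conf_val (by positivity)]
  have hlip : LipschitzWith N fun u => (f u).1 := by
    refine LipschitzWith.of_dist_le_mul fun u v => (dist_pi_le_iff (by positivity)).2 fun k => ?_
    rw [hfv, hfv]
    exact (dist_le_pi_dist _ _ _).trans ((lipschitz_braid ℓ' N).dist_le_mul u v)
  refine ⟨letterPerm (ℓ 0), ?_⟩
  -- The window `[τ, N + τ]` slides along `ℓ`. It closes up with `places ℓ N` at every stage because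
  -- the letter at `N` equals the letter at 0.
  have key := ambientIsotopic_trace_of_homotopicWith (f := braid ℓ N) (g := f) (σ := places ℓ N)
    ⟨⟨⟨⟨fun p => conf ℓ (N * p.2 + p.1), (continuous_conf ℓ).comp (by fun_prop)⟩, ?_, ?_⟩, ?_⟩⟩
    (lipschitz_braid _ _) hlip
  · have : (fun q : Fin 3 × unitInterval => closedBraid ℓ' N (letterPerm (ℓ 0) q.1, q.2))
        = trace fun u => (f u).1 := by
      ext1 q
      simp only [closedBraid, trace, hfv]
    rw [this]
    exact key
  · intro u
    simp [braid]
  · intro u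
    simp [hf]
  · intro τ k
    change (conf ℓ _).1 k = (conf ℓ _).1 _
    have h0 := τ.2.1
    have h1 := τ.2.2
    rw [conf_val (by simp; linarith), conf_val (by simp; linarith)]
    simp only [Set.Icc.coe_one, Set.Icc.coe_zero, mul_one, mul_zero]
    have := strand_add ℓ 0 h0 h1 (places ℓ N k)
    rw [Nat.cast_zero] at this
    rw [strand_add ℓ N h0 h1, this, hN]
    simp [places]

/-- The motion of an inverse letter is that of the letter run backwards; together with `height_inv`
this is what makes cancellation work. -/
lemma radius_inv (a : Letter) (p : Fin 3) (s : ℝ) :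
    radius (some a.inv) (letterPerm (some a) p) s = radius (some a) p (1 - s) := by
  obtain ⟨i, b⟩ := a
  fin_cases i <;> fin_cases p <;>
    simp [radius, letterPerm, Letter.inv, Equiv.swap_apply_def] <;> ring

lemma height_inv (a : Letter) (p : Fin 3) (s : ℝ) :
    height (some a.inv) (letterPerm (some a) p) s = height (some a) p (1 - s) := by
  obtain ⟨i, b⟩ := a
  fin_cases i <;> fin_cases p <;> cases b <;>
    simp [height, letterPerm, Letter.inv, Equiv.swap_apply_def] <;> ring

/-- Two successive inverse letters may be replaced by no letters. -/
lemma sameClosure_cancel {a : Letter} {c N : ℕ} (hcN : c + 2 ≤ N) (h0 : ℓ c = some a)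
    (h1 : ℓ (c + 1) = some a.inv) (h0' : ℓ' c = none) (h1' : ℓ' (c + 1) = none)
    (h : ∀ j, j ≠ c → j ≠ c + 1 → ℓ j = ℓ' j) : SameClosure ℓ N ℓ' N := by
  have hlt : ∀ j < c, ℓ j = ℓ' j := fun j hj => h j (by omega) (by omega)
  have hpc : places ℓ c = places ℓ' c := places_congr hlt
  have hp2 : places ℓ (c + 2) = places ℓ c := by
    rw [places, places, h0, h1]
    ext1 k
    simp [letterPerm, Letter.inv]
  have hp2' : places ℓ' (c + 2) = places ℓ' c := by
    rw [places, places, h0', h1']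
    simp [letterPerm]
  have hge : ∀ j, c + 2 ≤ j → ℓ j = ℓ' j := fun j hj => h j (by omega) (by omega)
  have hsymm : ∀ τ : ℝ, 0 ≤ τ → τ ≤ 1 → strand ℓ (c + 1 - τ) = strand ℓ (c + 1 + τ) := by
    intro τ ht0 ht1
    ext1 k
    have e1 : (c : ℝ) + 1 - τ = c + (1 - τ) := by ring
    have e2 : (c : ℝ) + 1 + τ = (c + 1 : ℕ) + τ := by push_cast; ring
    rw [e1, e2, strand_add _ _ (by linarith) (by linarith), strand_add _ _ ht0 ht1, h0, h1, places,
      h0, Equiv.Perm.mul_apply, radius_inv, height_inv]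
  have hconst : ∀ v : ℝ, (c : ℝ) ≤ v → v ≤ c + 2 → strand ℓ' v = strand ℓ (c + 2 : ℕ) := by
    intro v hv hv'
    ext1 k
    rw [strand_natCast, hp2, hpc]
    rcases le_total v (c + 1) with h2 | h2
    · have := strand_add ℓ' c (s := v - c) (by linarith) (by linarith) k
      rw [add_sub_cancel, h0'] at this
      rw [this]
      rfl
    · have := strand_add ℓ' (c + 1) (s := v - (c + 1 : ℕ)) (by push_cast; linarith)
        (by push_cast; linarith) k
      rw [add_sub_cancel, h1', places, h0'] at this
      rw [this]
      simp [radius, height, letterPerm]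
  have hN : (c : ℝ) + 2 ≤ N := by exact_mod_cast hcN
  -- At stage `τ` the motion is frozen while the time is within `τ` of the turning point `c + 1`.
  -- The two sides match since the configurations at `c + 1 - τ` and `c + 1 + τ` agree by `hsymm`.
  -- At `τ = 1` both letters have become idle.
  refine SameClosure.of_homotopicWith (σ := places ℓ N) ⟨⟨⟨⟨fun p =>
    if (p.1 : ℝ) ≤ |N * (p.2 : ℝ) - (c + 1)| then conf ℓ (N * p.2) else conf ℓ (c + 1 + p.1),
    ?_⟩, ?_, ?_⟩, ?_⟩⟩
  · refine Continuous.if_le ?_ ?_ (by fun_prop) (by fun_prop) ?_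
    · exact (continuous_conf ℓ).comp (by fun_prop)
    · exact (continuous_conf ℓ).comp (by fun_prop)
    · intro p hp
      refine Subtype.ext ?_
      have ht0 := p.1.2.1
      have ht1 := p.1.2.2
      have hc0 : (0 : ℝ) ≤ c := Nat.cast_nonneg _
      rw [conf_val (mul_nonneg (Nat.cast_nonneg _) p.2.2.1), conf_val (by positivity)]
      rcases abs_choice (N * (p.2 : ℝ) - (c + 1)) with h3 | h3
      · rw [h3] at hp
        congr 1; linarith
      · rw [h3] at hp
        rw [← hsymm _ ht0 ht1]
        congr 1; linarith
  · intro u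
    simp only [Set.Icc.coe_zero, abs_nonneg, if_true]
    rfl
  · intro u
    refine Subtype.ext ?_
    have hu : (0 : ℝ) ≤ N * u := mul_nonneg (Nat.cast_nonneg _) u.2.1
    simp only [Set.Icc.coe_one]
    rw [braid_val]
    split_ifs with h3
    · rw [conf_val hu]
      rcases le_abs.1 h3 with h4 | h4
      · exact strand_congr_of_le (c := c + 2) (by rw [hp2, hp2', hpc]) hge
          (by push_cast; linarith)
      · exact strand_congr hlt hu (by linarith)
    · rw [not_le, abs_lt] at h3
      rw [hconst _ (by linarith [h3.1]) (by linarith [h3.2]), conf_val (by positivity)]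
      push_cast
      congr 1; ring
  · intro τ k
    have ht1 := τ.2.2
    have hc0 : (0 : ℝ) ≤ c := Nat.cast_nonneg _
    change (if _ then conf ℓ _ else conf ℓ _ : Conf).1 k
      = (if _ then conf ℓ _ else conf ℓ _ : Conf).1 _
    rw [if_pos, if_pos]
    · rw [conf_val (by simp), conf_val (by simp)]
      simp only [Set.Icc.coe_one, Set.Icc.coe_zero, mul_one, mul_zero]
      rw [strand_natCast, strand_zero]
    · rw [Set.Icc.coe_zero, mul_zero, zero_sub, abs_neg, abs_of_nonneg (by positivity)]
      linarith
    · rw [Set.Icc.coe_one, mul_one, abs_of_nonneg (by linarith)]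
      linarith

end ThreeBraid

namespace ThreeBraid

variable {ℓ ℓ' : ℕ → Option Letter}

/-! ### The braid relation -/

lemma places_add (ℓ : ℕ → Option Letter) (c j : ℕ) :
    places ℓ (c + j) = places (fun i => ℓ (c + i)) j * places ℓ c := by
  induction j with
  | zero => simp [places]
  | succ j ih => rw [← add_assoc, places, ih, places, mul_assoc]

lemma strand_nat_add (ℓ : ℕ → Option Letter) (c : ℕ) {v : ℝ} (hv : 0 ≤ v) (k : Fin 3) :
    strand ℓ (c + v) k = strand (fun i => ℓ (c + i)) v (places ℓ c k) := by
  obtain ⟨j, s, h0, h1, rfl⟩ := exists_nat_add v hv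
  have : (c : ℝ) + (j + s) = (c + j : ℕ) + s := by push_cast; ring
  rw [this, strand_add _ _ h0 h1.le, strand_add _ _ h0 h1.le, places_add, Equiv.Perm.mul_apply]

/-- A coordinate that is ordered in the same strict sense at both ends stays so along the way. A
weak order of the heights at the start is enough, because `τ = 0` is covered by `hne` and every `τ >
0` brings in the strict order at the end. -/
lemma add_smul_sub_ne {a a' b b' : ℝ × ℝ} (hne : a ≠ a')
    (h : (a.1 < a'.1 ∧ b.1 < b'.1) ∨ (a'.1 < a.1 ∧ b'.1 < b.1) ∨ (a'.2 ≤ a.2 ∧ b'.2 < b.2) ∨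
      (a.2 ≤ a'.2 ∧ b.2 < b'.2)) (τ : unitInterval) :
    a + (τ : ℝ) • (b - a) ≠ a' + (τ : ℝ) • (b' - a') := by
  intro he
  have h1 : a.1 + τ * (b.1 - a.1) = a'.1 + τ * (b'.1 - a'.1) := congrArg Prod.fst he
  have h2 : a.2 + τ * (b.2 - a.2) = a'.2 + τ * (b'.2 - a'.2) := congrArg Prod.snd he
  have ht0 := τ.2.1
  have ht1 := τ.2.2
  rcases ht0.eq_or_lt with h0 | h0
  · rw [← h0] at h1 h2
    exact hne (Prod.ext (by linarith) (by linarith))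
  · rcases h with ⟨h, h'⟩ | ⟨h, h'⟩ | ⟨h, h'⟩ | ⟨h, h'⟩ <;> nlinarith

/-- The half turn of three points in line. -/
noncomputable def turn (p : Fin 3) (x : ℝ) : ℝ × ℝ :=
  (2 + ((p : ℝ) - 1) * (1 - 2 * x), -(((p : ℝ) - 1) * (x * (1 - x))))

/-- The word `σ_i σ_{i'} σ_i`. -/
def halfTwist (i i' : Fin 2) : ℕ → Option Letter
  | 0 => some (i, true)
  | 1 => some (i', true)
  | 2 => some (i, true)
  | _ => none

lemma places_halfTwist {i i' : Fin 2} (h : i ≠ i') (k : Fin 3) :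
    (places (halfTwist i i') 3 k : ℝ) = 2 - k := by
  fin_cases i <;> fin_cases i' <;> first | exact absurd rfl h | skip
  all_goals
    fin_cases k
    all_goals simp [places, halfTwist, letterPerm, Equiv.swap_apply_def]
    try norm_num

/-- At time 0 the radii separate the two strings. Afterwards the half turn has the string that
starts further in strictly above the other. Where the half twist does not put it lower, the heights
separate the pair throughout the motion; in the remaining cases the radii have the same order in
both pictures. -/
lemma halfTwist_turn_ne {i i' : Fin 2} (h : i ≠ i') {v : ℝ} (h0 : 0 ≤ v) (h3 : v < 3)
    {p q : Fin 3} (hpq : p < q) (τ : unitInterval) :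
    strand (halfTwist i i') v p + (τ : ℝ) • (turn p (v / 3) - strand (halfTwist i i') v p)
      ≠ strand (halfTwist i i') v q
        + (τ : ℝ) • (turn q (v / 3) - strand (halfTwist i i') v q) := by
  refine add_smul_sub_ne ((strand_injective _ h0).ne hpq.ne) ?_ τ
  rcases h0.eq_or_lt with rfl | hv
  · left
    have : (p : ℝ) < q := by exact_mod_cast hpq
    rw [strand_zero, strand_zero]
    constructor
    · simpa using this
    · simpa [turn] using this
  obtain ⟨j, s, hs0, hs1, rfl⟩ := exists_nat_add v h0
  have hj : j < 3 := by
    have : (j : ℝ) < 3 := by linarith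
    exact_mod_cast this
  have hs : 0 ≤ s * (1 - s) := mul_nonneg hs0 (by linarith)
  obtain ⟨x, hx⟩ : ∃ x : ℝ, x = (j + s) / 3 := ⟨_, rfl⟩
  have hx' : 0 < x * (1 - x) := by
    have : 0 < x := by rw [hx]; positivity
    have : x < 1 := by rw [hx, div_lt_one (by norm_num)]; exact h3
    nlinarith
  rw [← hx, strand_add _ _ hs0 hs1.le, strand_add _ _ hs0 hs1.le]
  have hx3 : 3 * x = j + s := by rw [hx]; ring
  clear hx hv h0 h3
  interval_cases j <;> fin_cases i <;> fin_cases i' <;> first | exact absurd rfl h | skip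
  all_goals
    fin_cases p <;> fin_cases q <;> first | exact absurd hpq (by decide) | skip
  all_goals
    simp [turn, halfTwist, places, letterPerm, Equiv.swap_apply_def, radius, height] at hx3 ⊢
    first
      | (left; constructor <;> linarith)
      | (right; left; constructor <;> linarith)
      | (right; right; left; constructor <;> linarith)

lemma turn_fst_pos (p : Fin 3) {x : ℝ} (h0 : 0 ≤ x) (h1 : x ≤ 1) : 0 < (turn p x).1 := by
  fin_cases p <;> simp [turn] <;> linarith

/-- A half twist may be deformed into a half turn of three points in line. -/
lemma exists_homotopicWith_turn {i i' : Fin 2} (hi : i ≠ i') {c N : ℕ} (hcN : c + 3 ≤ N)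
    (h0 : ℓ c = some (i, true)) (h1 : ℓ (c + 1) = some (i', true))
    (h2 : ℓ (c + 2) = some (i, true)) :
    ∃ J : C(unitInterval, Conf), (braid ℓ N).HomotopicWith J (Closes (places ℓ N)) ∧
      ∀ u k, (J u).1 k = if N * (u : ℝ) < c ∨ (c : ℝ) + 3 < N * u then strand ℓ (N * u) k
        else turn (places ℓ c k) ((N * u - c) / 3) := by
  have hblock : ∀ v : ℝ, 0 ≤ v → v ≤ 3 → ∀ k,
      strand ℓ (c + v) k = strand (halfTwist i i') v (places ℓ c k) := by
    intro v hv hv' k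
    rw [strand_nat_add _ _ hv]
    have : strand (fun j => ℓ (c + j)) v = strand (halfTwist i i') v := by
      refine strand_congr (N := 3) (fun j hj => ?_) hv (by exact_mod_cast hv')
      interval_cases j <;> simp [halfTwist, h0, h1, h2]
    rw [this]
  have hc0 : (0 : ℝ) ≤ c := Nat.cast_nonneg _
  have hN : (c : ℝ) + 3 ≤ N := by exact_mod_cast hcN
  -- The time within the block, clamped to `[0, 3]`. The half turn and the half twist agree at both
  -- ends of the block, so the displacement `E` vanishes outside it.
  set w : ℝ → ℝ := fun v => max 0 (min (v - c) 3) with hw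
  have hw0 : ∀ v, 0 ≤ w v := fun v => le_max_left _ _
  have hw3 : ∀ v, w v ≤ 3 := fun v => max_le (by norm_num) (min_le_right _ _)
  set E : ℝ → Fin 3 → ℝ × ℝ := fun v k =>
    turn (places ℓ c k) (w v / 3) - strand (halfTwist i i') (w v) (places ℓ c k) with hE
  have hE0 : ∀ v : ℝ, v ≤ c → ∀ k, E v k = 0 := by
    intro v hv k
    have : w v = 0 := max_eq_left ((min_le_left _ _).trans (by linarith))
    simp only [hE, this]
    rw [strand_zero]
    simp [turn]; ring
  have hE3 : ∀ v, (c : ℝ) + 3 ≤ v → ∀ k, E v k = 0 := by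
    intro v hv k
    have : w v = 3 := by
      simp only [hw]; rw [min_eq_right (by linarith)]; norm_num
    simp only [hE, this]
    have h3 := strand_natCast (halfTwist i i') 3 (places ℓ c k)
    rw [places_halfTwist hi] at h3
    push_cast at h3
    rw [h3]
    simp [turn]; ring
  have hwin : ∀ v, (c : ℝ) ≤ v → v ≤ c + 3 → w v = v - c := by
    intro v hv hv'
    simp only [hw]; rw [min_eq_left (by linarith), max_eq_right (by linarith)]
  have hEin : ∀ v, (c : ℝ) ≤ v → v ≤ c + 3 → ∀ k, strand ℓ v k
      = strand (halfTwist i i') (v - c) (places ℓ c k) := by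
    intro v hv hv' k
    have := hblock (v - c) (by linarith) (by linarith) k
    rwa [add_sub_cancel] at this
  have hsumin : ∀ v, (c : ℝ) ≤ v → v ≤ c + 3 → ∀ (τ : unitInterval) k,
      strand ℓ v k + (τ : ℝ) • E v k = strand (halfTwist i i') (v - c) (places ℓ c k)
        + (τ : ℝ) • (turn (places ℓ c k) ((v - c) / 3)
          - strand (halfTwist i i') (v - c) (places ℓ c k)) := by
    intro v hv hv' τ k
    rw [hEin v hv hv']
    simp only [hE, hwin v hv hv']
  have hconf : ∀ (τ : unitInterval) (v : ℝ), 0 ≤ v →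
      (∀ k, 0 < (strand ℓ v k + (τ : ℝ) • E v k).1) ∧
      Function.Injective fun k => strand ℓ v k + (τ : ℝ) • E v k := by
    intro τ v hv
    rcases le_or_gt v c with h | h
    · simp only [hE0 v h, smul_zero, add_zero]
      exact ⟨strand_fst_pos ℓ hv, strand_injective ℓ hv⟩
    rcases le_or_gt ((c : ℝ) + 3) v with h' | h'
    · simp only [hE3 v h', smul_zero, add_zero]
      exact ⟨strand_fst_pos ℓ hv, strand_injective ℓ hv⟩
    simp only [hsumin v h.le h'.le]
    have hvc : 0 ≤ v - c := by linarith
    constructor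
    · intro k
      have e1 := strand_fst_pos (halfTwist i i') hvc (places ℓ c k)
      have e2 := turn_fst_pos (places ℓ c k) (x := (v - c) / 3) (by positivity) (by linarith)
      have e3 := τ.2.1
      have e4 := τ.2.2
      simp only [Prod.fst_add, Prod.smul_fst, Prod.fst_sub, smul_eq_mul]
      rcases e3.eq_or_lt with h | h
      · rw [← h]; linarith
      · nlinarith
    · intro k l hkl
      by_contra hne
      have hne' : places ℓ c k ≠ places ℓ c l := (places ℓ c).injective.ne hne
      rcases lt_or_gt_of_ne hne' with hlt | hlt
      · exact halfTwist_turn_ne hi hvc (by linarith) hlt τ hkl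
      · exact halfTwist_turn_ne hi hvc (by linarith) hlt τ hkl.symm
  have hcE : Continuous E := by
    refine continuous_pi fun k => Continuous.sub ?_ ?_
    · simp only [turn, hw]; fun_prop
    · exact (continuous_pi_iff.1 (continuous_strand _) _).comp (by simp only [hw]; fun_prop)
  have hu : ∀ u : unitInterval, 0 ≤ (N : ℝ) * u := fun u => mul_nonneg (Nat.cast_nonneg _) u.2.1
  have hcS := continuous_strand ℓ
  have hcF : Continuous fun p : unitInterval × unitInterval =>
      (⟨fun k => strand ℓ (N * p.2) k + (p.1 : ℝ) • E (N * p.2) k,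
        hconf p.1 _ (hu p.2)⟩ : Conf) := by
    refine Continuous.subtype_mk (continuous_pi fun k => ?_) _
    have h1 : Continuous fun p : unitInterval × unitInterval => strand ℓ (N * (p.2 : ℝ)) k :=
      (continuous_pi_iff.1 hcS k).comp (by fun_prop)
    have h2 : Continuous fun p : unitInterval × unitInterval => E (N * (p.2 : ℝ)) k :=
      (continuous_pi_iff.1 hcE k).comp (by fun_prop)
    fun_prop
  refine ⟨⟨fun u => _, hcF.comp (continuous_const.prodMk continuous_id :
    Continuous fun u => ((1 : unitInterval), u))⟩, ⟨⟨⟨⟨_, hcF⟩, fun u => ?_, fun u => rfl⟩,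
    fun τ k => ?_⟩⟩, fun u k => ?_⟩
  · refine Subtype.ext ?_
    rw [braid_val]
    simp
  · change strand ℓ (N * ((1 : unitInterval) : ℝ)) k + (τ : ℝ) • E (N * ((1 : unitInterval) : ℝ)) k
      = strand ℓ (N * ((0 : unitInterval) : ℝ)) (places ℓ N k)
        + (τ : ℝ) • E (N * ((0 : unitInterval) : ℝ)) (places ℓ N k)
    rw [hE3 _ (by simpa using hN), hE0 _ (by simp)]
    simp [strand_natCast, strand_zero]
  · change strand ℓ (N * (u : ℝ)) k + ((1 : unitInterval) : ℝ) • E (N * (u : ℝ)) k = _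
    split_ifs with h
    · rcases h with h | h
      · rw [hE0 _ h.le]; simp
      · rw [hE3 _ h.le]; simp
    · rw [not_or, not_lt, not_lt] at h
      rw [hsumin _ h.1 h.2]
      simp

/-- The two half twists deform into one and the same half turn, which depends only on the places of
the strings at time `c`. -/
lemma sameClosure_braidRelation {i i' : Fin 2} (hi : i ≠ i') {c N : ℕ} (hcN : c + 3 ≤ N)
    (h0 : ℓ c = some (i, true)) (h1 : ℓ (c + 1) = some (i', true))
    (h2 : ℓ (c + 2) = some (i, true)) (h0' : ℓ' c = some (i', true))
    (h1' : ℓ' (c + 1) = some (i, true)) (h2' : ℓ' (c + 2) = some (i', true))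
    (h : ∀ j, j ≠ c → j ≠ c + 1 → j ≠ c + 2 → ℓ j = ℓ' j) : SameClosure ℓ N ℓ' N := by
  obtain ⟨J, hJ, hJv⟩ := exists_homotopicWith_turn hi hcN h0 h1 h2
  obtain ⟨J', hJ', hJv'⟩ := exists_homotopicWith_turn hi.symm hcN h0' h1' h2'
  have hlt : ∀ j < c, ℓ j = ℓ' j := fun j hj => h j (by omega) (by omega) (by omega)
  have hge : ∀ j, c + 3 ≤ j → ℓ j = ℓ' j := fun j hj => h j (by omega) (by omega) (by omega)
  have hpc : places ℓ c = places ℓ' c := places_congr hlt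
  have hp3 : places ℓ (c + 3) = places ℓ' (c + 3) := by
    have hb : letterPerm (some (i, true)) * (letterPerm (some (i', true))
        * letterPerm (some (i, true))) = letterPerm (some (i', true)) *
          (letterPerm (some (i, true)) * letterPerm (some (i', true))) := by
      fin_cases i <;> fin_cases i' <;> first | exact absurd rfl hi | skip
      all_goals simp only [letterPerm]; decide
    simp only [places, h0, h1, h2, h0', h1', h2', hpc]
    simp only [← mul_assoc] at hb ⊢
    rw [hb]
  have hJJ' : J = J' := by
    ext1 u
    refine Subtype.ext (funext fun k => ?_)
    rw [hJv, hJv', hpc]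
    split_ifs with h
    · rcases h with h | h
      · rw [strand_congr hlt (mul_nonneg (Nat.cast_nonneg _) u.2.1) h.le]
      · rw [strand_congr_of_le hp3 hge (by push_cast; linarith)]
    · rfl
  have hpN : places ℓ N = places ℓ' N := by
    have := strand_congr_of_le hp3 hge (v := N) (by exact_mod_cast hcN)
    ext1 k
    have := congrFun this k
    rw [strand_natCast, strand_natCast, Prod.mk.injEq] at this
    exact Fin.ext (by exact_mod_cast add_right_cancel this.1)
  rw [← hJJ', ← hpN] at hJ'
  exact SameClosure.of_homotopicWith (hJ.trans hJ'.symm)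

end ThreeBraid

namespace ThreeBraid

/-! ### The closures of `σ₁ σ₂` and `σ₁⁻¹ σ₂⁻¹` -/

/-- The angle at time `u` of the three corners of a triangle that makes a third of a turn. -/
noncomputable def corner (k : Fin 3) (u : ℝ) : ℝ :=
  ![5 * Real.pi / 6, -(Real.pi / 2), Real.pi / 6] k - 2 * Real.pi * u / 3

/-- Three points that make a third of a turn on a circle; the sense is given by `ε`. -/
noncomputable def triangle (ε : ℝ) (u : unitInterval) (k : Fin 3) : ℝ × ℝ :=
  (2 + Real.cos (corner k u), ε * Real.sin (corner k u))

lemma sin_corner_one_lt {u : ℝ} (h0 : 0 ≤ u) (h1 : u < 1) :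
    Real.sin (corner 1 u) < Real.sin (corner 0 u) := by
  have hpi := Real.pi_pos
  rw [← sub_pos, Real.sin_sub_sin]
  have e1 : (corner 0 u - corner 1 u) / 2 = 2 * Real.pi / 3 := by simp [corner]; ring
  have e2 : (corner 0 u + corner 1 u) / 2 = Real.pi / 6 - 2 * Real.pi * u / 3 := by
    simp [corner]; ring
  rw [e1, e2]
  have := Real.sin_pos_of_pos_of_lt_pi (x := 2 * Real.pi / 3) (by positivity) (by linarith)
  have := Real.cos_pos_of_mem_Ioo (x := Real.pi / 6 - 2 * Real.pi * u / 3)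
    ⟨by nlinarith, by nlinarith⟩
  positivity

lemma sin_corner_two_lt {u : ℝ} (h0 : 0 < u) (h1 : u < 1) :
    Real.sin (corner 2 u) < Real.sin (corner 0 u) := by
  have hpi := Real.pi_pos
  rw [← sub_pos, Real.sin_sub_sin]
  have e1 : (corner 0 u - corner 2 u) / 2 = Real.pi / 3 := by simp [corner]; ring
  have e2 : (corner 0 u + corner 2 u) / 2 = Real.pi / 2 - 2 * Real.pi * u / 3 := by
    simp [corner]; ring
  rw [e1, e2]
  have := Real.sin_pos_of_pos_of_lt_pi (x := Real.pi / 3) (by positivity) (by linarith)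
  have := Real.cos_pos_of_mem_Ioo (x := Real.pi / 2 - 2 * Real.pi * u / 3)
    ⟨by nlinarith, by nlinarith⟩
  positivity

lemma cos_corner_one_lt {u : ℝ} (h0 : 0 ≤ u) (h1 : u < 1) :
    Real.cos (corner 1 u) < Real.cos (corner 2 u) := by
  have hpi := Real.pi_pos
  rw [← sub_pos, Real.cos_sub_cos]
  have e1 : (corner 2 u - corner 1 u) / 2 = Real.pi / 3 := by simp [corner]; ring
  have e2 : (corner 2 u + corner 1 u) / 2 = -(Real.pi / 6 + 2 * Real.pi * u / 3) := by
    simp [corner]; ring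
  rw [e1, e2, Real.sin_neg]
  have := Real.sin_pos_of_pos_of_lt_pi (x := Real.pi / 3) (by positivity) (by linarith)
  have := Real.sin_pos_of_pos_of_lt_pi (x := Real.pi / 6 + 2 * Real.pi * u / 3)
    (by positivity) (by nlinarith)
  nlinarith

lemma cos_corner_zero_lt : Real.cos (corner 0 0) < Real.cos (corner 2 0) := by
  have e : corner 0 0 = Real.pi - Real.pi / 6 := by simp [corner]; ring
  have e' : corner 2 0 = Real.pi / 6 := by simp [corner]
  have hpi := Real.pi_pos
  have := Real.cos_pos_of_mem_Ioo (x := Real.pi / 6) ⟨by linarith, by linarith⟩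
  rw [e, e', Real.cos_pi_sub]
  linarith

/-- The word `σ₁ σ₂`, or `σ₁⁻¹ σ₂⁻¹` if `b` is `false`. -/
def thirdTwist (b : Bool) : ℕ → Option Letter
  | 0 => some (0, b)
  | 1 => some (1, b)
  | _ => none

/-- The sign of a letter as a real number. -/
def sign (b : Bool) : ℝ := if b then 1 else -1

/-- String 0 crosses the other two on the same side, above or below according to the sign, in the
word as in the rotating triangle; strings 1 and 2 do not cross and are separated by their radii. At
`u = 0` corners 0 and 2 have equal height, and the radii are used for them. -/
lemma thirdTwist_triangle_ne (b : Bool) {u : unitInterval} (h1 : (u : ℝ) < 1)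
    {p q : Fin 3} (hpq : p < q) (τ : unitInterval) :
    strand (thirdTwist b) (2 * u) p
        + (τ : ℝ) • (triangle (sign b) u p - strand (thirdTwist b) (2 * u) p)
      ≠ strand (thirdTwist b) (2 * u) q
        + (τ : ℝ) • (triangle (sign b) u q - strand (thirdTwist b) (2 * u) q) := by
  have hv0 : (0 : ℝ) ≤ 2 * u := mul_nonneg zero_le_two u.2.1
  refine add_smul_sub_ne ((strand_injective _ hv0).ne hpq.ne) ?_ τ
  have hsin1 := sin_corner_one_lt u.2.1 h1
  have hcos1 := cos_corner_one_lt u.2.1 h1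
  rcases u.2.1.eq_or_lt with hu | hu
  · have hcos2 := cos_corner_zero_lt
    rw [← hu] at hsin1 hcos1 ⊢
    rw [mul_zero, strand_zero, strand_zero]
    fin_cases p <;> fin_cases q <;> first | exact absurd hpq (by decide) | skip
    · cases b <;> simp [triangle, sign, ← hu, hsin1]
    · left; simp [triangle, ← hu, hcos2]
    · left; simp [triangle, ← hu, hcos1]
  have hsin2 := sin_corner_two_lt hu h1
  obtain ⟨j, s, hs0, hs1, hjs⟩ := exists_nat_add _ hv0
  have hj : j < 2 := by
    have : (j : ℝ) < 2 := by linarith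
    exact_mod_cast this
  have hs : 0 ≤ s * (1 - s) := mul_nonneg hs0 (by linarith)
  rw [hjs, strand_add _ _ hs0 hs1.le, strand_add _ _ hs0 hs1.le]
  simp only [triangle]
  clear hjs h1 hu hv0
  interval_cases j <;> fin_cases p <;> fin_cases q <;>
    first | exact absurd hpq (by decide) | skip
  all_goals
    cases b <;>
    simp [sign, thirdTwist, places, letterPerm, Equiv.swap_apply_def, radius, height] <;>
    first
      | (left; constructor <;> linarith)
      | (right; right; left; constructor <;> linarith)
      | (right; right; right; constructor <;> linarith)

lemma triangle_one (ε : ℝ) (b : Bool) (k : Fin 3) :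
    triangle ε 1 k = triangle ε 0 (places (thirdTwist b) 2 k) := by
  have h : ∀ k, Real.Angle.coe (corner k 1) = corner (places (thirdTwist b) 2 k) 0 := by
    intro k
    rw [Real.Angle.angle_eq_iff_two_pi_dvd_sub]
    fin_cases k
    · exact ⟨0, by simp [corner, places, thirdTwist, letterPerm]; ring⟩
    · exact ⟨-1, by simp [corner, places, thirdTwist, letterPerm, Equiv.swap_apply_def]; ring⟩
    · exact ⟨0, by simp [corner, places, thirdTwist, letterPerm, Equiv.swap_apply_def]; ring⟩
  have hk := h k
  simp only [triangle, Set.Icc.coe_one, Set.Icc.coe_zero]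
  rw [← Real.Angle.cos_coe, ← Real.Angle.sin_coe, hk, Real.Angle.cos_coe, Real.Angle.sin_coe]

lemma ambientIsotopic_triangle (b : Bool) :
    AmbientIsotopic (closedBraid (thirdTwist b) 2) (trace (triangle (sign b))) := by
  have hlip : ∃ K, LipschitzWith K (triangle (sign b)) := by
    have h1 : ∀ k, LipschitzWith ⟨2 * Real.pi, by have := Real.pi_pos; positivity⟩
        fun u : unitInterval => corner k u := by
      intro k
      refine LipschitzWith.of_dist_le_mul fun u v => ?_
      rw [Real.dist_eq, Subtype.dist_eq, Real.dist_eq]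
      have : corner k u - corner k v = -(2 * Real.pi / 3) * (u - v) := by simp only [corner]; ring
      have hpi := Real.pi_pos
      have hpi' : 0 < 2 * Real.pi / 3 := by positivity
      rw [this, abs_mul, abs_neg, abs_of_pos hpi']
      refine mul_le_mul_of_nonneg_right ?_ (abs_nonneg _)
      change 2 * Real.pi / 3 ≤ 2 * Real.pi
      linarith
    refine ⟨_, LipschitzWith.of_dist_le_mul (K := ⟨2 * Real.pi, by have := Real.pi_pos; positivity⟩)
      fun u v => (dist_pi_le_iff (mul_nonneg (NNReal.coe_nonneg _) dist_nonneg)).2 fun k => ?_⟩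
    refine le_trans ?_ ((h1 k).dist_le_mul u v)
    have hc := Real.lipschitzWith_cos.dist_le_mul (corner k u) (corner k v)
    have hs := Real.lipschitzWith_sin.dist_le_mul (corner k u) (corner k v)
    rw [NNReal.coe_one, one_mul] at hc hs
    rw [Prod.dist_eq, max_le_iff]
    refine ⟨?_, ?_⟩
    · simpa [triangle] using hc
    · refine le_trans (le_of_eq ?_) hs
      cases b <;> simp [triangle, sign, Real.dist_eq]
  obtain ⟨K, hK⟩ := hlip
  have hval : ∀ u, (braid (thirdTwist b) 2 u).1 = strand (thirdTwist b) (2 * u) := by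
    intro u; rw [braid_val]; norm_num
  have h1 : ∀ k, (braid (thirdTwist b) 2 1).1 k
      = (braid (thirdTwist b) 2 0).1 (places (thirdTwist b) 2 k) := by
    intro k
    have := strand_natCast (thirdTwist b) 2 k
    rw [hval, hval, Set.Icc.coe_zero, mul_zero, strand_zero, Set.Icc.coe_one, mul_one]
    exact_mod_cast this
  refine ambientIsotopic_trace_of_straight_line (σ := places (thirdTwist b) 2)
    (lipschitz_braid _ _) hK h1 (triangle_one _ b)
    (fun u k => (braid (thirdTwist b) 2 u).2.1 k) (fun u k => ?_) ?_
  · have := Real.neg_one_le_cos (corner k u)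
    simp only [triangle]
    linarith
  · have key : ∀ τ u : unitInterval, (u : ℝ) < 1 → ∀ k l, k ≠ l →
        (braid (thirdTwist b) 2 u).1 k
          + (τ : ℝ) • (triangle (sign b) u k - (braid (thirdTwist b) 2 u).1 k) ≠
        (braid (thirdTwist b) 2 u).1 l
          + (τ : ℝ) • (triangle (sign b) u l - (braid (thirdTwist b) 2 u).1 l) := by
      intro τ u hu k l hkl
      rw [hval]
      rcases lt_or_gt_of_ne hkl with h | h
      · exact thirdTwist_triangle_ne b hu h τ
      · exact (thirdTwist_triangle_ne b hu h τ).symm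
    intro τ u k l hkl
    rcases u.2.2.lt_or_eq with hu | hu
    · exact key τ u hu k l hkl
    · have : u = 1 := Subtype.ext hu
      subst this
      -- At `u = 1` the closing condition carries everything back to `u = 0` with permuted labels.
      rw [h1, h1, triangle_one _ b, triangle_one _ b]
      exact key τ 0 (by simp) _ _ ((places (thirdTwist b) 2).injective.ne hkl)

/-- A planar curve. -/
noncomputable def ellipse (ε : ℝ) (q : Fin 3 × unitInterval) : Space :=
  ![0, 2 * Real.cos (corner q.1 q.2) + 1, ε * Real.sin (corner q.1 q.2)]

/-- The two squares do not vanish together: if `1 - 4 z² = 0`, the first one equals 1. -/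
lemma unwind_det_pos (z : ℝ) : 0 < (3 * z - 4 * z ^ 3) ^ 2 + 4 * (1 - 4 * z ^ 2) ^ 2 := by
  have : (3 * z - 4 * z ^ 3) ^ 2 + 4 * (1 - 4 * z ^ 2) ^ 2
      = (4 * z ^ 3 - 3 * z) ^ 2 + (2 - 8 * z ^ 2) ^ 2 := by ring
  rcases eq_or_ne (1 - 4 * z ^ 2) 0 with h | h
  · have h2 : z ^ 2 = 1 / 4 := by linarith
    have : (3 * z - 4 * z ^ 3) ^ 2 = z ^ 2 * (3 - 4 * z ^ 2) ^ 2 := by ring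
    rw [this, h, h2]; norm_num
  · positivity

lemma affine_inverse {a b : ℝ} (p q : ℝ) {x y : ℝ} (h : b ^ 2 + 4 * a ^ 2 ≠ 0) :
    ((x - p) * b + (y - q) * (2 * a)) / (b ^ 2 + 4 * a ^ 2) * b
        - ((y - q) * b - (x - p) * (2 * a)) / (b ^ 2 + 4 * a ^ 2) * (2 * a) + p = x ∧
      ((x - p) * b + (y - q) * (2 * a)) / (b ^ 2 + 4 * a ^ 2) * (2 * a)
        + ((y - q) * b - (x - p) * (2 * a)) / (b ^ 2 + 4 * a ^ 2) * b + q = y := by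
  obtain ⟨d, hd⟩ : ∃ d, d = b ^ 2 + 4 * a ^ 2 := ⟨_, rfl⟩
  rw [← hd] at h ⊢
  constructor
  · field_simp
    linear_combination (p - x) * hd
  · field_simp
    linear_combination (q - y) * hd

/-- Homeomorphisms of three-space that preserve the height and are affine on every level. -/
noncomputable def unwind (ε t : ℝ) : Space ≃ₜ Space where
  toFun x := ![x 0 * (3 * (t * (ε * x 2)) - 4 * (t * (ε * x 2)) ^ 3)
      - x 1 * (2 * (1 - 4 * (t * (ε * x 2)) ^ 2)) + 2 * (3 * (t * (ε * x 2)) - 4 * (t * (ε * x 2)) ^ 3),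
    x 0 * (2 * (1 - 4 * (t * (ε * x 2)) ^ 2)) + x 1 * (3 * (t * (ε * x 2)) - 4 * (t * (ε * x 2)) ^ 3)
      + (1 - (t * (ε * x 2)) ^ 2) * (1 - 4 * (t * (ε * x 2)) ^ 2), x 2]
  invFun x :=
    let z := t * (ε * x 2)
    let b := 3 * z - 4 * z ^ 3
    let a := 1 - 4 * z ^ 2
    ![((x 0 - 2 * b) * b + (x 1 - (1 - z ^ 2) * a) * (2 * a)) / (b ^ 2 + 4 * a ^ 2),
      ((x 1 - (1 - z ^ 2) * a) * b - (x 0 - 2 * b) * (2 * a)) / (b ^ 2 + 4 * a ^ 2), x 2]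
  left_inv x := by
    have h := (unwind_det_pos (t * (ε * x 2))).ne'
    ext i
    fin_cases i
    · simp only [Fin.zero_eta, Matrix.cons_val_zero, Matrix.cons_val_one, Matrix.cons_val]
      rw [div_eq_iff h]; ring
    · simp only [Fin.mk_one, Matrix.cons_val_zero, Matrix.cons_val_one, Matrix.cons_val]
      rw [div_eq_iff h]; ring
    · rfl
  right_inv x := by
    have h := (unwind_det_pos (t * (ε * x 2))).ne'
    ext i
    fin_cases i
    · exact (affine_inverse _ _ h).1
    · exact (affine_inverse _ _ h).2
    · rfl
  continuous_toFun := by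
    refine continuous_pi fun i => ?_
    fin_cases i <;> simp <;> fun_prop
  continuous_invFun := by
    have h := fun x : Space => (unwind_det_pos (t * (ε * x 2))).ne'
    refine continuous_pi fun i => ?_
    fin_cases i
    · exact Continuous.div (by fun_prop) (by fun_prop) h
    · exact Continuous.div (by fun_prop) (by fun_prop) h
    · exact continuous_apply 2

/-- Modulo `2π`, three times any of the corner angles is `π / 2 - 2π u`. So the angle around the
axis is a function of the corner angle, and the three strings together are one closed curve
parametrized by it. -/
lemma cos_three_corner (k : Fin 3) (u : ℝ) :
    Real.sin (3 * corner k u) = Real.cos (2 * Real.pi * u) ∧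
      Real.cos (3 * corner k u) = Real.sin (2 * Real.pi * u) := by
  have h : ∃ n : ℤ, 3 * corner k u = Real.pi / 2 - 2 * Real.pi * u + n * (2 * Real.pi) := by
    fin_cases k
    · exact ⟨1, by simp [corner]; ring⟩
    · exact ⟨-1, by simp [corner]; ring⟩
    · exact ⟨0, by simp [corner]; ring⟩
  obtain ⟨n, hn⟩ := h
  rw [hn, Real.sin_add_int_mul_two_pi, Real.cos_add_int_mul_two_pi, Real.sin_pi_div_two_sub,
    Real.cos_pi_div_two_sub]
  exact ⟨rfl, rfl⟩

/-- Put `z = sin θ`, `b = 3 z - 4 z³ = sin 3θ` and `a = 1 - 4 z²`, so that `a cos θ = cos 3θ`. The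
affine map of `unwind` at level `ε z` and `t = 1` then sends `(cos θ, 0)` to `(2 + cos θ) (sin 3θ,
cos 3θ)`, a point of the closed braid. At `t = 0` the map is the same on every level and gives the
ellipse. -/
lemma ambientIsotopic_ellipse {ε : ℝ} (hε : ε * ε = 1) :
    AmbientIsotopic (ellipse ε) (trace (triangle ε)) := by
  refine ⟨fun t => (unwind ε 0).symm.trans (unwind ε t), ?_, ?_, ?_⟩
  · have h1 : Continuous fun p : unitInterval × Space => (unwind ε 0).symm p.2 :=
      (unwind ε 0).symm.continuous.comp continuous_snd
    have h2 : Continuous fun p : unitInterval × Space => unwind ε p.1 p.2 := by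
      refine continuous_pi fun i => ?_
      fin_cases i <;> simp [unwind] <;> fun_prop
    exact h2.comp (continuous_fst.prodMk h1)
  · intro x
    simp
  · rintro ⟨k, u⟩
    have h0 : ellipse ε (k, u)
        = unwind ε 0 ![Real.cos (corner k u), 0, ε * Real.sin (corner k u)] := by
      ext i
      fin_cases i <;> simp [ellipse, unwind]
      ring
    rw [h0]
    obtain ⟨h1, h2⟩ := cos_three_corner k u
    rw [Real.sin_three_mul] at h1
    rw [Real.cos_three_mul] at h2
    have hz : ε * (ε * Real.sin (corner k u)) = Real.sin (corner k u) := by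
      rw [← mul_assoc, hε, one_mul]
    have hc : Real.cos (corner k u) ^ 2 = 1 - Real.sin (corner k u) ^ 2 := Real.cos_sq' _
    ext i
    fin_cases i
    · simp [unwind, trace, triangle, cylindrical, hz, ← h1]
      ring
    · simp [unwind, trace, triangle, cylindrical, hz, ← h2]
      have : Real.cos (corner k u) ^ 3 = Real.cos (corner k u) * (1 - Real.sin (corner k u) ^ 2) := by
        rw [← hc]; ring
      rw [this]
      linear_combination (-(1 - 4 * Real.sin (corner k u) ^ 2)) * hc
    · simp [unwind, trace, triangle, cylindrical]

/-- The rotation about the second coordinate axis. -/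
noncomputable def rotation (θ : ℝ) : Space ≃ₜ Space where
  toFun x := ![x 0 * Real.cos θ - x 2 * Real.sin θ, x 1, x 0 * Real.sin θ + x 2 * Real.cos θ]
  invFun x := ![x 0 * Real.cos θ + x 2 * Real.sin θ, x 1, x 2 * Real.cos θ - x 0 * Real.sin θ]
  left_inv x := by
    have h := Real.sin_sq_add_cos_sq θ
    ext i
    fin_cases i
    · simp; linear_combination x 0 * h
    · simp
    · simp; linear_combination x 2 * h
  right_inv x := by
    have h := Real.sin_sq_add_cos_sq θ
    ext i
    fin_cases i
    · simp; linear_combination x 0 * h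
    · simp
    · simp; linear_combination x 2 * h
  continuous_toFun := by
    refine continuous_pi fun i => ?_
    fin_cases i <;> simp <;> fun_prop
  continuous_invFun := by
    refine continuous_pi fun i => ?_
    fin_cases i <;> simp <;> fun_prop

/-- The ellipse lies in the plane where the first coordinate is zero, so a half turn about the
second axis only reverses its height. -/
lemma ambientIsotopic_ellipse_neg : AmbientIsotopic (ellipse 1) (ellipse (-1)) := by
  refine ⟨fun t => rotation (Real.pi * t), ?_, ?_, ?_⟩
  · refine continuous_pi fun i => ?_
    fin_cases i <;> simp [rotation] <;> fun_prop
  · intro x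
    ext i
    fin_cases i <;> simp [rotation]
  · intro q
    ext i
    fin_cases i <;> simp [rotation, ellipse]

lemma sameClosure_thirdTwist : SameClosure (thirdTwist true) 2 (thirdTwist false) 2 := by
  have h1 := ambientIsotopic_triangle true
  have h2 := ambientIsotopic_triangle false
  have e1 : sign true = 1 := rfl
  have e2 : sign false = -1 := rfl
  rw [e1] at h1
  rw [e2] at h2
  exact ⟨1, h1.trans ((ambientIsotopic_ellipse (by norm_num)).symm.trans
    (ambientIsotopic_ellipse_neg.trans ((ambientIsotopic_ellipse (by norm_num)).trans h2.symm)))⟩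

end ThreeBraid

namespace ThreeBraid

/-! ### Closures of braid words -/

lemma place_eq_places (w : BraidWord) (j : ℕ) : place w j = places (letterAt w) j := by
  induction j with
  | zero => rfl
  | succ j ih => rw [place, places, ih]

lemma closedBraid_letterAt (w : BraidWord) (k : Fin 3) (u : unitInterval) :
    closedBraid (letterAt w) (w.length + 1) (k, u) = point w k (((w.length : ℝ) + 1) * u) := by
  have hn : (w.length : ℝ) + 1 ≠ 0 := by positivity
  simp only [closedBraid, trace, braid_val, point, strand, place_eq_places]
  push_cast
  rw [mul_div_cancel_left₀ _ hn]

lemma point_add_mul (w : BraidWord) (k : Fin 3) {v : ℝ} (hv : 0 ≤ v) (l : ℕ) :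
    point w k (v + ((w.length : ℝ) + 1) * l) = point w ((perm w ^ l) k) v := by
  have hn : (w.length : ℝ) + 1 ≠ 0 := by positivity
  have e : v + ((w.length : ℝ) + 1) * l = v + (((w.length + 1) * l : ℕ) : ℝ) := by push_cast; ring
  have hf : ⌊v + ((w.length : ℝ) + 1) * l⌋₊ = ⌊v⌋₊ + (w.length + 1) * l := by
    rw [e, Nat.floor_add_natCast hv]
  have hs : v + ((w.length : ℝ) + 1) * l - (⌊v⌋₊ + (w.length + 1) * l : ℕ) = v - ⌊v⌋₊ := by
    push_cast; ring
  have ha : 2 * Real.pi * ((v + ((w.length : ℝ) + 1) * l) / ((w.length : ℝ) + 1))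
      = 2 * Real.pi * (v / ((w.length : ℝ) + 1)) + l * (2 * Real.pi) := by
    field_simp
  simp only [point]
  rw [hf, hs, letterAt_add, place_add_mul, ha, cylindrical, cylindrical,
    Real.cos_add_nat_mul_two_pi,
    Real.sin_add_nat_mul_two_pi]
  rfl

lemma exists_component (w : BraidWord) (k : Fin 3) :
    ∃ c : Component w, ∃ j : ℕ, (perm w ^ j) c.1 = k := by
  obtain ⟨c, hc, hmin⟩ := Set.exists_min_image {l : Fin 3 | (perm w).SameCycle k l} id
    (Set.toFinite _) ⟨k, Equiv.Perm.SameCycle.refl _ _⟩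
  obtain ⟨j, -, hj⟩ := (Equiv.Perm.SameCycle.symm hc).exists_pow_eq'
  exact ⟨⟨c, fun l hl => hmin l (Equiv.Perm.SameCycle.trans hc hl)⟩, j, hj⟩

lemma component_ext {w : BraidWord} {c d : Component w} (h : (perm w).SameCycle c.1 d.1) : c = d :=
  Subtype.ext (le_antisymm (c.2 _ h) (d.2 _ h.symm))

/-- A component of `m` rounds traverses one string in the fraction `1 / m` of its period, so this
shift starts it at its `j`-th string. -/
lemma closureCurve_shift (w : BraidWord) (c : Component w) (j : ℕ) (t : ℝ) :
    closureCurve w c (t + j / (Function.minimalPeriod (perm w) c.1 : ℝ))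
      = point w ((perm w ^ j) c.1)
        (((w.length : ℝ) + 1) * (Function.minimalPeriod (perm w) c.1 * Int.fract t)) := by
  have hm0 := minimalPeriod_pos w c.1
  set m := Function.minimalPeriod (perm w) c.1 with hm
  have hm0' : (0 : ℝ) < m := by exact_mod_cast hm0
  have hfix : ∀ z : ℕ, (perm w ^ (m * z)) c.1 = c.1 := by
    intro z
    rw [← Equiv.Perm.iterate_eq_pow]
    exact (Function.isPeriodicPt_minimalPeriod (perm w) c.1).mul_const z
  obtain ⟨z, hz⟩ : ∃ z : ℕ, ⌊t + j / (m : ℝ)⌋ = ⌊t⌋ + z := by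
    have : ⌊t⌋ ≤ ⌊t + j / (m : ℝ)⌋ := Int.floor_le_floor (by
      have : (0 : ℝ) ≤ j / m := by positivity
      linarith)
    exact ⟨(⌊t + j / (m : ℝ)⌋ - ⌊t⌋).toNat, by omega⟩
  have hz' : (⌊t + j / (m : ℝ)⌋ : ℝ) = ⌊t⌋ + z := by exact_mod_cast hz
  have hf0 := Int.fract_nonneg t
  have hf1 := Int.fract_nonneg (t + j / (m : ℝ))
  rw [← point_add_mul _ _ (by positivity), closureCurve, period, ← hm]
  have e : ((w.length : ℝ) + 1) * (m * Int.fract t) + ((w.length : ℝ) + 1) * j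
      = m * ((w.length : ℝ) + 1) * Int.fract (t + j / (m : ℝ))
        + ((w.length : ℝ) + 1) * (m * z : ℕ) := by
    rw [Int.fract, Int.fract, hz']
    push_cast
    field_simp
    ring
  rw [e, point_add_mul _ _ (by positivity), hfix]

/-- `SameClosure` matches labelled arcs, whereas a component is a cycle based at its smallest label.
Since `ρ` need not respect smallest labels, each component is matched up to a shift of its
parameter. -/
theorem isotopic_of_sameClosure {w w' : BraidWord}
    (h : SameClosure (letterAt w) (w.length + 1) (letterAt w') (w'.length + 1)) :
    (closure w).Isotopic (closure w') := by
  obtain ⟨ρ, H, hHc, hH0, hH1⟩ := h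
  have hpt : ∀ k (u : unitInterval), H 1 (point w k (((w.length : ℝ) + 1) * u))
      = point w' (ρ k) (((w'.length : ℝ) + 1) * u) := by
    intro k u
    rw [← closedBraid_letterAt, ← closedBraid_letterAt, hH1]
  have hone : ∀ (w : BraidWord) k, point w k ((w.length : ℝ) + 1) = point w (perm w k) 0 := by
    intro w k
    simpa using point_add_mul w k le_rfl 1
  -- The end of string `k` is the beginning of string `perm w k`. Comparing their images shows that
  -- `ρ` intertwines the permutations.
  have hρ : ∀ k, ρ (perm w k) = perm w' (ρ k) := by
    intro k
    have h1 := hpt k 1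
    have h2 := hpt (perm w k) 0
    rw [Set.Icc.coe_one, mul_one, mul_one, hone, hone] at h1
    rw [Set.Icc.coe_zero, mul_zero, mul_zero, h1] at h2
    obtain ⟨l, hl, hk⟩ := point_inj w' _ _ le_rfl le_rfl h2
    have hl0 : l = 0 := by
      have hn : (w'.length : ℝ) + 1 ≠ 0 := by positivity
      rw [zero_add, eq_comm, mul_eq_zero, or_iff_right hn] at hl
      exact_mod_cast hl
    subst hl0
    simpa using hk.symm
  have hρpow : ∀ (l : ℕ) k, ρ ((perm w ^ l) k) = (perm w' ^ l) (ρ k) := by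
    intro l
    induction l with
    | zero => intro k; rfl
    | succ l ih => intro k; rw [pow_succ', pow_succ', Equiv.Perm.mul_apply, hρ, ih]; rfl
  have hpt' : ∀ k (v : ℝ), 0 ≤ v → H 1 (point w k (((w.length : ℝ) + 1) * v))
      = point w' (ρ k) (((w'.length : ℝ) + 1) * v) := by
    intro k v hv
    obtain ⟨l, s, h0, h1, rfl⟩ := exists_nat_add v hv
    have e : ∀ x : ℝ, x * (l + s) = x * s + x * l := fun x => by ring
    rw [e, e, point_add_mul _ _ (by positivity), point_add_mul _ _ (by positivity), ← hρpow]
    exact hpt _ ⟨s, h0, h1.le⟩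
  have hconj : perm w' = ρ * perm w * ρ⁻¹ := by
    ext1 k
    simp [hρ]
  have hcycle : ∀ k l, (perm w').SameCycle (ρ k) (ρ l) ↔ (perm w).SameCycle k l := by
    intro k l
    rw [hconj, Equiv.Perm.sameCycle_conj]
    simp
  -- `f c` is the component through the image of the base string of `c`, and `j c` is the number of
  -- rounds from its own base string to that image.
  choose f j hfj using fun c : Component w => exists_component w' (ρ c.1)
  have hf : ∀ c, (perm w').SameCycle (f c).1 (ρ c.1) := fun c =>
    ⟨j c, by rw [zpow_natCast]; exact hfj c⟩
  have hbij : Function.Bijective f := by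
    constructor
    · intro c d hcd
      refine component_ext ((hcycle _ _).1 ?_)
      exact (hf c).symm.trans (hcd ▸ hf d)
    · intro c'
      obtain ⟨c, i, hc⟩ := exists_component w (ρ⁻¹ c'.1)
      refine ⟨c, component_ext ((hf c).trans ?_)⟩
      have : (perm w).SameCycle c.1 (ρ⁻¹ c'.1) := ⟨i, by rw [zpow_natCast]; exact hc⟩
      simpa using (hcycle _ _).2 this
  have hfix : ∀ (x y : Fin 3) (i n : ℕ), (perm w' ^ i) x = ρ y →
      ((perm w' ^ n) x = x ↔ (perm w ^ n) y = y) := by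
    intro x y i n h
    rw [← ρ.injective.eq_iff (a := (perm w ^ n) y), hρpow, ← h, ← Equiv.Perm.mul_apply,
      ← pow_add, add_comm n, pow_add,
      Equiv.Perm.mul_apply, (perm w' ^ i).injective.eq_iff]
  have hperiod : ∀ c, Function.minimalPeriod (perm w') (f c).1
      = Function.minimalPeriod (perm w) c.1 := by
    intro c
    rw [Function.minimalPeriod_eq_minimalPeriod_iff]
    intro n
    simp only [Function.IsPeriodicPt, Function.IsFixedPt, Equiv.Perm.iterate_eq_pow]
    exact hfix _ _ _ n (hfj c)
  have hcurve : ∀ (c : Component w) (t : ℝ), H 1 (closureCurve w c t) = closureCurve w' (f c)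
      (t + j c / (Function.minimalPeriod (perm w') (f c).1 : ℝ)) := by
    intro c t
    refine Eq.trans ?_ (closureCurve_shift w' (f c) (j c) t).symm
    refine Eq.trans ?_ (congrArg (fun k => point w' k _) (hfj c)).symm
    rw [hperiod, closureCurve, period, mul_comm (_ : ℝ) ((w.length : ℝ) + 1), mul_assoc]
    exact hpt' _ _ (mul_nonneg (Nat.cast_nonneg _) (Int.fract_nonneg _))
  refine ⟨H, hHc, hH0, Equiv.ofBijective f hbij, fun c =>
    OrderIso.addRight (j c / (Function.minimalPeriod (perm w') (f c).1 : ℝ)), fun c t => ?_,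
    hcurve⟩
  simp only [OrderIso.addRight_apply]
  ring

/-! ### Moves of braid words -/

/-- Two braid words have the same closure up to an ambient isotopy. -/
def WordEquiv (w w' : BraidWord) : Prop :=
  SameClosure (fun j => w[j]?) w.length (fun j => w'[j]?) w'.length

namespace WordEquiv

variable {w w' w'' : BraidWord}

lemma refl (w : BraidWord) : WordEquiv w w := SameClosure.refl _ _

lemma symm (h : WordEquiv w w') : WordEquiv w' w := SameClosure.symm h

lemma trans (h : WordEquiv w w') (h' : WordEquiv w' w'') : WordEquiv w w'' :=
  SameClosure.trans h h'

lemma sameClosure_letterAt (w : BraidWord) :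
    SameClosure (letterAt w) (w.length + 1) (fun j => w[j]?) w.length := by
  refine (sameClosure_of_eq fun j hj => ?_).trans
    (sameClosure_delete (ℓ := fun j => w[j]?) le_rfl (fun j hj => rfl) ?_ fun j hj => ?_)
  · rw [letterAt, Nat.mod_eq_of_lt hj]
  · simp
  · rw [List.getElem?_eq_none hj, List.getElem?_eq_none (by omega)]

theorem isotopic (h : WordEquiv w w') : (closure w).Isotopic (closure w') :=
  isotopic_of_sameClosure
    ((sameClosure_letterAt w).trans (SameClosure.trans h (sameClosure_letterAt w').symm))

lemma rotate_cons (a : Letter) (w : BraidWord) : WordEquiv (a :: w) (w ++ [a]) := by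
  -- A copy of the first letter is appended so that the sequence satisfies the periodicity required
  -- by `sameClosure_rotate`; only the first `w.length + 1` letters enter the closed braid.
  have h1 : SameClosure (fun j => (a :: w)[j]?) (w.length + 1)
      (fun j => (a :: (w ++ [a]))[j]?) (w.length + 1) := by
    refine sameClosure_of_eq fun j hj => ?_
    have : a :: (w ++ [a]) = (a :: w) ++ [a] := rfl
    rw [this, List.getElem?_append_left (by simpa using hj)]
  have h2 : SameClosure (fun j => (a :: (w ++ [a]))[j]?) (w.length + 1)
      (fun j => (w ++ [a])[j]?) (w.length + 1) :=
    sameClosure_rotate (by simp) fun j => by simp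
  simpa [WordEquiv] using h1.trans h2

lemma rotate (u v : BraidWord) : WordEquiv (u ++ v) (v ++ u) := by
  induction u generalizing v with
  | nil => simpa using refl v
  | cons a u ih =>
    refine (rotate_cons a (u ++ v)).trans ?_
    simpa using ih (v ++ [a])

lemma cancel (u v : BraidWord) (a : Letter) : WordEquiv (u ++ a :: a.inv :: v) (u ++ v) := by
  set c := u.length with hc
  set ℓ : ℕ → Option Letter := fun j => (u ++ a :: a.inv :: v)[j]? with hℓ
  -- `ℓ₁` has two idle units in place of the cancelling letters, and `ℓ₂` has one of them left.
  set ℓ₁ : ℕ → Option Letter := fun j => if j = c ∨ j = c + 1 then none else ℓ j with hℓ₁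
  set ℓ₂ : ℕ → Option Letter := fun j => if j < c then ℓ j else if j = c then none else ℓ (j + 1)
    with hℓ₂
  have h1 : SameClosure ℓ (c + v.length + 2) ℓ₁ (c + v.length + 2) := by
    refine sameClosure_cancel (a := a) (c := c) (by omega) ?_ ?_ ?_ ?_ ?_
    · simp [hℓ, hc]
    · simp [hℓ, hc]
    · simp [hℓ₁]
    · simp [hℓ₁]
    · intro j h1 h2
      simp [hℓ₁, h1, h2]
  have h2 : SameClosure ℓ₁ (c + v.length + 2) ℓ₂ (c + v.length + 1) := by
    refine sameClosure_delete (c := c) (by omega) ?_ ?_ ?_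
    · intro j hj
      simp only [hℓ₁, hℓ₂, if_pos hj]
      rw [if_neg (by omega)]
    · simp [hℓ₁]
    · intro j hj
      simp only [hℓ₁, hℓ₂, if_neg (not_lt.2 hj)]
      split_ifs <;> first | rfl | omega
  have h3 : SameClosure ℓ₂ (c + v.length + 1) (fun j => (u ++ v)[j]?) (c + v.length) := by
    refine sameClosure_delete (c := c) (by omega) ?_ ?_ ?_
    · intro j hj
      simp only [hℓ₂, if_pos hj, hℓ]
      rw [List.getElem?_append_left hj, List.getElem?_append_left hj]
    · simp [hℓ₂]
    · intro j hj
      simp only [hℓ₂, hℓ]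
      rw [if_neg (by omega), if_neg (by omega), List.getElem?_append_right hj,
        List.getElem?_append_right (by omega)]
      have : j + 1 + 1 - u.length = (j - u.length) + 1 + 1 := by omega
      rw [this, List.getElem?_cons_succ, List.getElem?_cons_succ]
  have := h1.trans (h2.trans h3)
  simpa only [WordEquiv, List.length_append, List.length_cons, add_assoc] using this

lemma braidRelation (u v : BraidWord) {i i' : Fin 2} (hi : i ≠ i') :
    WordEquiv (u ++ (i, true) :: (i', true) :: (i, true) :: v)
      (u ++ (i', true) :: (i, true) :: (i', true) :: v) := by
  have := sameClosure_braidRelation (N := u.length + (v.length + 3)) (c := u.length)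
    (ℓ := fun j => (u ++ (i, true) :: (i', true) :: (i, true) :: v)[j]?)
    (ℓ' := fun j => (u ++ (i', true) :: (i, true) :: (i', true) :: v)[j]?) hi (by omega)
    (by simp) (by simp) (by simp) (by simp) (by simp) (by simp) ?_
  · simpa only [WordEquiv, List.length_append, List.length_cons] using this
  · intro j h0 h1 h2
    rcases lt_or_ge j u.length with hj | hj
    · simp only [List.getElem?_append_left hj]
    · simp only [List.getElem?_append_right hj]
      obtain ⟨n, hn⟩ : ∃ n, j - u.length = n + 1 + 1 + 1 := ⟨j - u.length - 3, by omega⟩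
      simp only [hn, List.getElem?_cons_succ]

end WordEquiv

/-! ### From equality and conjugacy in the braid group to isotopy of closures -/

/-- Braid words that may be replaced by each other in every braid word. -/
def wordCon : Con (FreeMonoid Letter) where
  r w w' := ∀ u v : BraidWord, WordEquiv (u ++ w.toList ++ v) (u ++ w'.toList ++ v)
  iseqv := ⟨fun _ _ _ => WordEquiv.refl _, fun h u v => (h u v).symm,
    fun h h' u v => (h u v).trans (h' u v)⟩
  mul' := by
    intro w x y z h h' u v
    have h1 := h u (y.toList ++ v)
    have h2 := h' (u ++ x.toList) v
    simp only [FreeMonoid.toList_mul, List.append_assoc] at h1 h2 ⊢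
    exact h1.trans h2

lemma Letter.inv_inv (a : Letter) : a.inv.inv = a := by simp [Letter.inv]

/-- The class of a letter modulo `wordCon`. -/
def letterUnit (a : Letter) : wordCon.Quotientˣ where
  val := (FreeMonoid.of a : FreeMonoid Letter)
  inv := (FreeMonoid.of a.inv : FreeMonoid Letter)
  val_inv := by
    rw [← Con.coe_mul, ← Con.coe_one, Con.eq]
    intro u v
    simpa using WordEquiv.cancel u v a
  inv_val := by
    rw [← Con.coe_mul, ← Con.coe_one, Con.eq]
    intro u v
    simpa [Letter.inv_inv] using WordEquiv.cancel u v a.inv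

lemma letterUnit_braid {i i' : Fin 2} (hi : i ≠ i') :
    letterUnit (i, true) * letterUnit (i', true) * letterUnit (i, true)
      = letterUnit (i', true) * letterUnit (i, true) * letterUnit (i', true) := by
  ext
  simp only [Units.val_mul, letterUnit]
  rw [← Con.coe_mul, ← Con.coe_mul, ← Con.coe_mul, ← Con.coe_mul, Con.eq]
  intro u v
  simpa using WordEquiv.braidRelation u v hi

/-- The class modulo `wordCon` of a braid. -/
def braidToQuotient : B3 →* wordCon.Quotientˣ :=
  PresentedGroup.toGroup (f := fun i => letterUnit (i, true)) (by
    intro r hr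
    rw [Set.mem_singleton_iff] at hr
    rw [hr, braidRelator]
    simp only [map_mul, map_inv, FreeGroup.lift_apply_of]
    rw [letterUnit_braid (by decide)]
    simp)

lemma toBraid_append (w w' : BraidWord) : toBraid (w ++ w') = toBraid w * toBraid w' := by
  simp only [toBraid, ← FreeGroup.mul_mk, map_mul]

lemma toBraid_nil : toBraid [] = 1 := by
  rw [toBraid, ← FreeGroup.one_eq_mk, map_one]

lemma toBraid_cons (a : Letter) (w : BraidWord) : toBraid (a :: w) = toBraid [a] * toBraid w :=
  toBraid_append [a] w

lemma toBraid_inv (a : Letter) : toBraid [a.inv] = (toBraid [a])⁻¹ := by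
  rw [toBraid, toBraid, ← map_inv, FreeGroup.inv_mk]
  rfl

lemma toBraid_surjective : Function.Surjective toBraid := by
  intro g
  obtain ⟨x, rfl⟩ := PresentedGroup.mk_surjective _ g
  obtain ⟨w, rfl⟩ := Quot.exists_rep x
  exact ⟨w, rfl⟩

lemma braidToQuotient_letter (a : Letter) : braidToQuotient (toBraid [a]) = letterUnit a := by
  have h : ∀ i, braidToQuotient (toBraid [(i, true)]) = letterUnit (i, true) := by
    intro i
    exact PresentedGroup.toGroup.of _
  obtain ⟨i, _ | _⟩ := a
  · have : ((i, false) : Letter) = Letter.inv (i, true) := rfl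
    rw [this, toBraid_inv, map_inv, h]
    rfl
  · exact h i

lemma braidToQuotient_toBraid (w : BraidWord) :
    (braidToQuotient (toBraid w) : wordCon.Quotient) = (FreeMonoid.ofList w : FreeMonoid Letter) := by
  induction w with
  | nil => rw [toBraid_nil, map_one]; rfl
  | cons a w ih =>
    rw [toBraid_cons, map_mul, Units.val_mul, ih, braidToQuotient_letter]
    rfl

/-- The universal property of the presentation replaces any analysis of chains of moves: the class
of a word modulo `wordCon` is the image of its braid under a homomorphism, and empty contexts give
the equivalence. -/
lemma wordEquiv_of_toBraid_eq {w w' : BraidWord} (h : toBraid w = toBraid w') : WordEquiv w w' := by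
  have h1 := braidToQuotient_toBraid w
  rw [h, braidToQuotient_toBraid, Con.eq] at h1
  have := h1 [] []
  simp only [List.nil_append, List.append_nil, FreeMonoid.toList_ofList] at this
  exact this.symm

theorem wordEquiv_of_isConj {w w' : BraidWord} (h : IsConj (toBraid w) (toBraid w')) :
    WordEquiv w w' := by
  obtain ⟨g, hg⟩ := isConj_iff.1 h
  obtain ⟨v, rfl⟩ := toBraid_surjective g
  obtain ⟨v', hv'⟩ := toBraid_surjective (toBraid v)⁻¹
  have h1 : WordEquiv (v ++ w ++ v') w' := wordEquiv_of_toBraid_eq (by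
    rw [toBraid_append, toBraid_append, hv', hg])
  have h2 : WordEquiv w (v' ++ (v ++ w)) := wordEquiv_of_toBraid_eq (by
    rw [toBraid_append, toBraid_append, hv', inv_mul_cancel_left])
  exact h2.trans ((WordEquiv.rotate _ _).trans h1)

lemma wordEquiv_alternate {a b : Letter} (hab : a.1 ≠ b.1) (h : a.2 = b.2) :
    WordEquiv [a, b] [a.inv, b.inv] := by
  have key : WordEquiv [(0, true), (1, true)] [(0, false), (1, false)] := by
    have h : ∀ b, SameClosure (fun j => [((0 : Fin 2), b), (1, b)][j]?) 2 (thirdTwist b) 2 := by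
      intro b
      refine sameClosure_of_eq fun j hj => ?_
      interval_cases j <;> rfl
    exact (h true).trans (sameClosure_thirdTwist.trans (h false).symm)
  have key' : WordEquiv [(1, true), (0, true)] [(1, false), (0, false)] :=
    (WordEquiv.rotate [(1, true)] [(0, true)]).trans
      (key.trans (WordEquiv.rotate [(0, false)] [(1, false)]))
  obtain ⟨i, s⟩ := a
  obtain ⟨i', s'⟩ := b
  simp only at h
  subst h
  fin_cases i <;> fin_cases i' <;> first | exact absurd rfl hab | skip
  all_goals cases s
  · exact key.symm
  · exact key
  · exact key'.symm
  · exact key'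

end ThreeBraid

namespace ThreeBraid

/-! ### Conjugate words after crossing switches -/

/-- The braid of a letter. -/
def letterBraid (a : Letter) : B3 := toBraid [a]

lemma toBraid_cons_eq (a : Letter) (w : BraidWord) :
    toBraid (a :: w) = letterBraid a * toBraid w := toBraid_cons a w

lemma letterBraid_inv (a : Letter) : letterBraid a.inv = (letterBraid a)⁻¹ := toBraid_inv a

lemma letterBraid_relation {x y : Letter} (h1 : x.1 ≠ y.1) (h2 : x.2 = y.2) :
    letterBraid x * (letterBraid y * letterBraid x)
      = letterBraid y * (letterBraid x * letterBraid y) := by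
  have key : letterBraid (0, true) * letterBraid (1, true) * letterBraid (0, true)
      = letterBraid (1, true) * letterBraid (0, true) * letterBraid (1, true) :=
    PresentedGroup.mk_eq_mk_of_mul_inv_mem (rels := {braidRelator}) (Set.mem_singleton _)
  have hinv : ∀ i, letterBraid (i, false) = (letterBraid (i, true))⁻¹ := fun i =>
    letterBraid_inv (i, true)
  have key' : letterBraid (0, false) * letterBraid (1, false) * letterBraid (0, false)
      = letterBraid (1, false) * letterBraid (0, false) * letterBraid (1, false) := by
    rw [hinv, hinv]
    simpa [mul_assoc] using congrArg (·⁻¹) key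
  obtain ⟨i, s⟩ := x
  obtain ⟨i', s'⟩ := y
  simp only at h2
  subst h2
  rw [← mul_assoc, ← mul_assoc]
  fin_cases i <;> fin_cases i' <;> first | exact absurd rfl h1 | skip
  all_goals cases s
  · exact key'
  · exact key
  · exact key'.symm
  · exact key.symm

lemma isConj_mul_comm {G : Type*} [Group G] (a b : G) : IsConj (a * b) (b * a) :=
  isConj_iff.2 ⟨b, by group⟩

lemma Letter.eq_or_eq_inv {a b : Letter} (h : a.1 = b.1) : a = b ∨ a = b.inv := by
  obtain ⟨i, s⟩ := a
  obtain ⟨i', s'⟩ := b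
  simp only at h
  subst h
  cases s <;> cases s' <;> simp [Letter.inv]

lemma Letter.eq_of_ne {a b c : Letter} (h : a.1 ≠ b.1) (h' : b.1 ≠ c.1) : a.1 = c.1 := by
  omega

/-- There are two places such that switching either one gives conjugate braids. -/
def HasConjugateSwitches (w : BraidWord) : Prop :=
  ∃ p x q y r, w = p ++ x :: (q ++ y :: r) ∧
    IsConj (toBraid (p ++ x.inv :: (q ++ y :: r))) (toBraid (p ++ x :: (q ++ y.inv :: r)))

namespace HasConjugateSwitches

variable {w w' : BraidWord}

lemma exists_switch (h : HasConjugateSwitches w) : ∃ i j : Fin w.length, i ≠ j ∧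
    IsConj (toBraid (switch w i)) (toBraid (switch w j)) := by
  obtain ⟨p, x, q, y, r, rfl, h⟩ := h
  have hi : p.length < (p ++ x :: (q ++ y :: r)).length := by simp
  have hj : p.length + (q.length + 1) < (p ++ x :: (q ++ y :: r)).length := by simp
  refine ⟨⟨_, hi⟩, ⟨_, hj⟩, ?_, ?_⟩
  · rw [Ne, Fin.mk.injEq]; omega
  · have e1 : switch (p ++ x :: (q ++ y :: r)) ⟨_, hi⟩ = p ++ x.inv :: (q ++ y :: r) := by
      simp [switch]
    have e2 : switch (p ++ x :: (q ++ y :: r)) ⟨_, hj⟩ = p ++ x :: (q ++ y.inv :: r) := by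
      simp [switch]
    rw [e1, e2]
    exact h

/-- Rotation conjugates both switched words. If the moved letter is one of the two switched
crossings, their roles are exchanged. -/
lemma rotate_cons {z : Letter} (h : HasConjugateSwitches (z :: w)) :
    HasConjugateSwitches (w ++ [z]) := by
  obtain ⟨p, x, q, y, r, hw, h⟩ := h
  rcases p with _ | ⟨z', p⟩
  · simp only [List.nil_append, List.cons.injEq] at hw h
    obtain ⟨rfl, rfl⟩ := hw
    refine ⟨q, y, r, z, [], by simp, ?_⟩
    have e1 := isConj_mul_comm (toBraid [z]) (toBraid (q ++ y.inv :: r))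
    have e2 := isConj_mul_comm (toBraid (q ++ y :: r)) (toBraid [z.inv])
    rw [← toBraid_append, ← toBraid_append] at e1 e2
    simpa using e1.symm.trans (h.symm.trans e2.symm)
  · simp only [List.cons_append, List.cons.injEq] at hw h
    obtain ⟨rfl, rfl⟩ := hw
    refine ⟨p, x, q, y, r ++ [z], by simp, ?_⟩
    have e1 := isConj_mul_comm (toBraid [z]) (toBraid (p ++ x :: (q ++ y.inv :: r)))
    have e2 := isConj_mul_comm (toBraid [z]) (toBraid (p ++ x.inv :: (q ++ y :: r)))
    rw [← toBraid_append, ← toBraid_append] at e1 e2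
    simpa using e2.symm.trans (h.trans e1)

lemma of_isRotated (h : w ~r w') (hw : HasConjugateSwitches w') : HasConjugateSwitches w := by
  obtain ⟨n, rfl⟩ := h.symm
  clear h
  induction n generalizing w' with
  | zero => simpa using hw
  | succ n ih =>
    rcases w' with _ | ⟨z, w'⟩
    · simpa using hw
    · rw [List.rotate_cons_succ]
      exact ih hw.rotate_cons

lemma of_isConj {x y : Letter} {q r : BraidWord} (hw : w ~r x :: (q ++ y :: r))
    (h : IsConj (toBraid (x.inv :: (q ++ y :: r))) (toBraid (x :: (q ++ y.inv :: r)))) :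
    HasConjugateSwitches w :=
  of_isRotated hw ⟨[], x, q, y, r, rfl, h⟩

/-- The switched words agree as braids already before the common tail `r`, so `r` is arbitrary. -/
lemma of_eq {x y : Letter} {q : BraidWord} (r : BraidWord) (hw : w ~r x :: (q ++ y :: r))
    (h : (letterBraid x)⁻¹ * (toBraid q * letterBraid y)
      = letterBraid x * (toBraid q * (letterBraid y)⁻¹)) : HasConjugateSwitches w := by
  refine of_isConj hw ?_
  have : toBraid (x.inv :: (q ++ y :: r)) = toBraid (x :: (q ++ y.inv :: r)) := by
    simp only [toBraid_cons_eq, toBraid_append, letterBraid_inv]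
    simp only [← mul_assoc] at h ⊢
    rw [h]
  rw [this]

lemma of_trivial {x : Letter} {T : BraidWord} (r : BraidWord) (hT : toBraid T = 1)
    (hw : w ~r x :: (T ++ x :: r)) : HasConjugateSwitches w :=
  of_eq r hw (by rw [hT]; group)

lemma of_trivial_trivial {x : Letter} {T T' : BraidWord} (r : BraidWord) (hT : toBraid T = 1)
    (hT' : toBraid T' = 1) (hw : w ~r x :: (T ++ x.inv :: (T' ++ x :: r))) :
    HasConjugateSwitches w := by
  refine of_eq (q := T ++ x.inv :: T') r (by simpa using hw) ?_
  rw [toBraid_append, toBraid_cons_eq, hT, hT', letterBraid_inv]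
  group

/-- Both switches turn `x y x y` into `y x`. -/
lemma of_alternating {x y : Letter} (r : BraidWord) (h1 : x.1 ≠ y.1) (h2 : x.2 = y.2)
    (hw : w ~r x :: y :: x :: y :: r) : HasConjugateSwitches w := by
  have h := letterBraid_relation h1 h2
  refine of_eq (q := [y, x]) r hw ?_
  simp only [toBraid_cons_eq, toBraid_nil, mul_one, mul_assoc]
  rw [← h, inv_mul_cancel_left, ← mul_assoc (letterBraid y), ← mul_assoc (letterBraid x), h]
  group

/-- Both switches of the outer letters give `x y`. -/
lemma of_run_two {x y : Letter} (r : BraidWord) (h1 : x.1 ≠ y.1) (h2 : x.2 = y.2)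
    (hw : w ~r y.inv :: x :: y :: x.inv :: r) : HasConjugateSwitches w := by
  have h := letterBraid_relation h1 h2
  refine of_eq (q := [x, y]) r hw ?_
  simp only [toBraid_cons_eq, toBraid_nil, mul_one, mul_assoc, letterBraid_inv, inv_inv]
  rw [h, inv_mul_cancel_left, ← mul_assoc (letterBraid x), ← mul_assoc (letterBraid y), ← h]
  group

/-- Switching either outer letter leaves `y`, since `x y x` and `y⁻¹ x⁻¹ y⁻¹` are inverse braids. -/
lemma of_run_three_run_three {x y : Letter} (r : BraidWord) (h1 : x.1 ≠ y.1) (h2 : x.2 = y.2)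
    (hw : w ~r y.inv :: x :: y :: x :: y.inv :: x.inv :: y.inv :: r) : HasConjugateSwitches w := by
  have h := letterBraid_relation h1 h2
  have h' : ∀ z, letterBraid x * (letterBraid y * (letterBraid x * z))
      = letterBraid y * (letterBraid x * (letterBraid y * z)) := fun z => by
    have := congrArg (· * z) h
    simpa only [mul_assoc] using this
  refine of_eq (q := [x, y, x, y.inv, x.inv]) r hw ?_
  simp only [toBraid_cons_eq, toBraid_nil, mul_one, mul_assoc, letterBraid_inv, inv_inv, h']
  group

lemma of_run_three_run_three' {x y : Letter} (r : BraidWord) (h1 : x.1 ≠ y.1) (h2 : x.2 = y.2)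
    (hw : w ~r y.inv :: x.inv :: y.inv :: x :: y :: x :: y.inv :: r) : HasConjugateSwitches w := by
  have h := letterBraid_relation h1 h2
  have h' : ∀ z, letterBraid x * (letterBraid y * (letterBraid x * z))
      = letterBraid y * (letterBraid x * (letterBraid y * z)) := fun z => by
    have := congrArg (· * z) h
    simpa only [mul_assoc] using this
  refine of_eq (q := [x.inv, y.inv, x, y, x]) r hw ?_
  simp only [toBraid_cons_eq, toBraid_nil, mul_one, mul_assoc, letterBraid_inv, inv_inv, h']
  group

/-- Switching either outer letter leaves `x`, because `y⁻¹ (x y x) y⁻¹ = x`. -/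
lemma of_isolated_run_three {x y : Letter} (r : BraidWord) (h1 : x.1 ≠ y.1) (h2 : x.2 = y.2)
    (hw : w ~r x :: y.inv :: x :: y :: x :: y.inv :: x :: r) : HasConjugateSwitches w := by
  have h := letterBraid_relation h1 h2
  have h' : ∀ z, letterBraid x * (letterBraid y * (letterBraid x * z))
      = letterBraid y * (letterBraid x * (letterBraid y * z)) := fun z => by
    have := congrArg (· * z) h
    simpa only [mul_assoc] using this
  refine of_eq (q := [y.inv, x, y, x, y.inv]) r hw ?_
  simp only [toBraid_cons_eq, toBraid_nil, mul_one, mul_assoc, letterBraid_inv, h']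
  group

/-- Conjugation by the half twist `x y x` exchanges `x` and `y`. -/
lemma isConj_letterBraid_sq {x y : Letter} (h1 : x.1 ≠ y.1) (h2 : x.2 = y.2) :
    IsConj (letterBraid x * letterBraid x) (letterBraid y * letterBraid y) := by
  have h := letterBraid_relation h1 h2
  refine isConj_iff.2 ⟨letterBraid x * (letterBraid y * letterBraid x), ?_⟩
  have hx : letterBraid x * (letterBraid y * letterBraid x) * letterBraid x
      = letterBraid y * (letterBraid x * (letterBraid y * letterBraid x)) := by
    nth_rewrite 1 [h]
    group
  rw [mul_inv_eq_iff_eq_mul, ← mul_assoc, hx, mul_assoc, hx, mul_assoc]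

lemma of_length_two {x y : Letter} (h1 : x.1 ≠ y.1) (h2 : x.2 = y.2) (hw : w ~r [x, y]) :
    HasConjugateSwitches w := by
  have h := letterBraid_relation h1 h2
  refine of_isConj (q := []) (r := []) hw (isConj_iff.2
    -- Conjugation by `x` takes `x⁻¹ y` to `y x⁻¹`, and the half twist takes this to `x y⁻¹`.
    ⟨letterBraid y * (letterBraid x * letterBraid y) * letterBraid x, ?_⟩)
  simp only [List.nil_append, toBraid_cons_eq, toBraid_nil, mul_one, letterBraid_inv]
  rw [mul_inv_eq_iff_eq_mul]
  calc letterBraid y * (letterBraid x * letterBraid y) * letterBraid x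
        * ((letterBraid x)⁻¹ * letterBraid y)
      = letterBraid y * (letterBraid x * letterBraid y) * letterBraid y := by group
    _ = letterBraid x * (letterBraid y * letterBraid x) * letterBraid y := by rw [h]
    _ = letterBraid x * (letterBraid y)⁻¹ *
          (letterBraid y * (letterBraid y * (letterBraid x * letterBraid y))) := by group
    _ = letterBraid x * (letterBraid y)⁻¹ *
          (letterBraid y * (letterBraid x * (letterBraid y * letterBraid x))) := by rw [h]
    _ = _ := by group

lemma of_length_four {x y : Letter} (h1 : x.1 ≠ y.1) (h2 : x.2 = y.2)
    (hw : w ~r [x, y, x, y.inv]) : HasConjugateSwitches w := by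
  have h := letterBraid_relation h1 h2
  refine of_isConj (q := [y]) (r := [y.inv]) hw ?_
  simp only [List.cons_append, List.nil_append, toBraid_cons_eq, toBraid_nil, mul_one,
    letterBraid_inv]
  generalize letterBraid x = a at h ⊢
  generalize letterBraid y = b at h ⊢
  refine isConj_iff.2 ⟨a * (b * a) * a, mul_inv_eq_iff_eq_mul.2 ?_⟩
  have ha : a * (b * a) * a = b * (a * (b * a)) := by
    nth_rewrite 1 [h]
    group
  have hb : a * (b * a) * b = a * (a * (b * a)) := by
    nth_rewrite 2 [h]
    group
  generalize a * (b * a) = D at ha hb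
  have ha' : D * a⁻¹ = b⁻¹ * D := by rw [eq_inv_mul_iff_mul_eq, ← mul_assoc, ← ha]; group
  have hb' : D * b⁻¹ = a⁻¹ * D := by rw [eq_inv_mul_iff_mul_eq, ← mul_assoc, ← hb]; group
  calc D * a * (a⁻¹ * (b * (a * b⁻¹))) = D * b * a * b⁻¹ := by group
    _ = a * (D * a) * b⁻¹ := by rw [hb]; group
    _ = a * b * (D * b⁻¹) := by rw [ha]; group
    _ = a * b * a⁻¹ * b⁻¹ * (b * D) := by rw [hb']; group
    _ = a * (b * (a⁻¹ * b⁻¹)) * (D * a) := by rw [ha]; group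

lemma of_length_six {x y : Letter} (h1 : x.1 ≠ y.1) (h2 : x.2 = y.2)
    (hw : w ~r [x, y, x, y.inv, x.inv, y.inv]) : HasConjugateSwitches w := by
  have h := letterBraid_relation h1 h2
  refine of_isConj (q := [y]) (r := [y.inv, x.inv, y.inv]) hw ?_
  simp only [List.cons_append, List.nil_append, toBraid_cons_eq, toBraid_nil, mul_one,
    letterBraid_inv]
  have h' : (letterBraid y)⁻¹ * ((letterBraid x)⁻¹ * (letterBraid y)⁻¹)
      = (letterBraid x * (letterBraid y * letterBraid x))⁻¹ := by rw [h]; group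
  rw [h']
  exact isConj_iff.2 ⟨letterBraid x * (letterBraid y * letterBraid x), by group⟩

lemma of_length_six' {x y : Letter} (h1 : x.1 ≠ y.1) (h2 : x.2 = y.2)
    (hw : w ~r [y.inv, x, y, x, y.inv, x]) : HasConjugateSwitches w := by
  have h := letterBraid_relation h1 h2
  refine of_isConj (q := [x, y, x]) (r := [x]) hw (isConj_iff.2 ⟨letterBraid x, ?_⟩)
  simp only [List.cons_append, List.nil_append, toBraid_cons_eq, toBraid_nil, mul_one,
    letterBraid_inv, inv_inv]
  generalize letterBraid x = a at h ⊢
  generalize letterBraid y = b at h ⊢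
  calc a * (b * (a * (b * (a * (b⁻¹ * a))))) * a⁻¹
      = a * (b * (a * (b * a) * b⁻¹)) := by group
    _ = b⁻¹ * (b * (a * b)) * (b * a) := by rw [h]; group
    _ = b⁻¹ * (a * (b * a)) * (b * a) := by rw [h]
    _ = _ := by group

end HasConjugateSwitches

end ThreeBraid

namespace ThreeBraid

/-! ### The choice of the two crossings -/

/-- Words that are reduced to the empty word by cancelling letters in the middle. -/
inductive Nested : BraidWord → Prop
  | nil : Nested []
  | cons (a : Letter) {T : BraidWord} : Nested T → Nested (a :: (T ++ [a.inv]))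

lemma Nested.toBraid_eq {T : BraidWord} (h : Nested T) : toBraid T = 1 := by
  induction h with
  | nil => exact toBraid_nil
  | cons a _ ih =>
    rw [toBraid_cons_eq, toBraid_append, ih, one_mul, toBraid_inv, letterBraid, mul_inv_cancel]

/-- The braid relation gives `a c² a⁻¹ = c⁻¹ a² c`, and `z` commutes with `c`, being `c` or its
inverse. -/
lemma isConj_letterBraid_conj_sq {a c z : Letter} (h1 : a.1 ≠ c.1) (h2 : a.2 = c.2)
    (hz : z.1 = c.1) :
    IsConj (letterBraid z * (letterBraid a * (letterBraid c * (letterBraid c * (letterBraid a)⁻¹))))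
      (letterBraid z * (letterBraid a * letterBraid a)) := by
  have h := letterBraid_relation h1 h2
  have hc : letterBraid c * letterBraid z = letterBraid z * letterBraid c := by
    rcases Letter.eq_or_eq_inv hz with rfl | rfl
    · rfl
    · rw [letterBraid_inv]; group
  generalize letterBraid a = a at *
  generalize letterBraid c = c at *
  generalize letterBraid z = z at *
  refine isConj_iff.2 ⟨c, ?_⟩
  calc c * (z * (a * (c * (c * a⁻¹)))) * c⁻¹ = c * z * (a * (c * (c * a⁻¹))) * c⁻¹ := by group
    _ = z * (c * (a * c)) * (c * a⁻¹) * c⁻¹ := by rw [hc]; group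
    _ = z * (a * (c * a)) * (c * a⁻¹) * c⁻¹ := by rw [h]
    _ = z * a * (c * (a * c)) * a⁻¹ * c⁻¹ := by group
    _ = z * (a * a) := by rw [← h]; group

namespace HasConjugateSwitches

variable {w : BraidWord}

/-- Induction on the part `v` outside the trivial block `a T a⁻¹`. Either the letters at the
boundary of the block settle the matter, or the block grows by one letter on each side and `v` loses
two. -/
lemma of_nested (n : ℕ) : ∀ {v T : BraidWord} {a : Letter}, v.length ≤ n → Nested T →
    w ~r v ++ a :: (T ++ [a.inv]) → ¬ Degenerate w → HasConjugateSwitches w := by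
  induction n using Nat.strong_induction_on with
  | _ n ih =>
  intro v T a hn hT hw hd
  rcases v with _ | ⟨s, v⟩
  · rcases hT with _ | @⟨b, T, hT⟩
    · obtain ⟨k, hk⟩ := hw.symm
      refine absurd (Or.inl ?_) hd
      rw [← List.rotate_mod] at hk
      rcases Nat.mod_two_eq_zero_or_one k with h | h
      · exact ⟨a, by simpa [h] using hk.symm⟩
      · exact ⟨a.inv, by simpa [h, Letter.inv_inv] using hk.symm⟩
    · by_cases h1 : b.1 = a.1
      · rcases Letter.eq_or_eq_inv h1 with rfl | rfl
        · exact of_trivial (T := []) _ toBraid_nil hw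
        · exact of_trivial_trivial (T := []) [a.inv] toBraid_nil hT.toBraid_eq
            (by simpa [Letter.inv_inv] using hw)
      -- The word is `a b T b⁻¹ a⁻¹`. Switching `a` leaves `a⁻²`; switching `b` or `b⁻¹` leaves a
      -- conjugate of `b⁻²` or `b²`. The choice makes the signs agree, so that the squares are
      -- conjugate.
      · by_cases h2 : a.2 = b.2
        · refine of_isConj (q := []) (r := T ++ [b.inv, a.inv]) (by simpa using hw) ?_
          have := isConj_letterBraid_sq (x := a.inv) (y := b.inv) (Ne.symm h1)
            (congrArg (!·) h2)
          simp only [List.nil_append, toBraid_cons_eq, toBraid_append, toBraid_nil, hT.toBraid_eq,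
            letterBraid_inv, one_mul, mul_one, mul_inv_cancel_left] at this ⊢
          refine this.trans ?_
          exact isConj_iff.2 ⟨letterBraid a, by group⟩
        · refine of_isConj (q := b :: T) (y := b.inv) (r := [a.inv]) (by simpa using hw) ?_
          have := isConj_letterBraid_sq (x := a.inv) (y := b) (Ne.symm h1)
            (by simpa [Letter.inv] using Bool.not_eq.2 h2)
          simp only [List.cons_append, toBraid_cons_eq, toBraid_append, toBraid_nil,
            hT.toBraid_eq, letterBraid_inv, one_mul, mul_one, mul_inv_cancel_left,
            inv_inv] at this ⊢
          refine this.trans ?_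
          exact isConj_iff.2 ⟨letterBraid a, by group⟩
  rcases v.eq_nil_or_concat' with rfl | ⟨v, t, rfl⟩
  · by_cases hs : s.1 = a.1
    · rcases Letter.eq_or_eq_inv hs with rfl | rfl
      · exact of_trivial (T := []) _ toBraid_nil hw
      · exact of_trivial_trivial (x := a.inv) (T := []) [] toBraid_nil hT.toBraid_eq
          (by simpa [Letter.inv_inv] using hw)
    rcases hT with _ | @⟨b, T, hT⟩
    · exact absurd (Or.inr ⟨a, s, Ne.symm hs, hw.trans (List.isRotated_append (l := [s]))⟩) hd
    · by_cases h1 : b.1 = a.1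
      · rcases Letter.eq_or_eq_inv h1 with rfl | rfl
        · exact of_trivial (T := []) _ toBraid_nil (hw.trans (List.isRotated_append (l := [s])))
        · refine of_trivial_trivial (x := a) (T := []) [a.inv, s] toBraid_nil hT.toBraid_eq
            (hw.trans ?_)
          simpa [Letter.inv_inv] using List.isRotated_append (l := [s])
            (l' := a :: a.inv :: (T ++ [a, a.inv]))
      · have hsb : s.1 = b.1 := Letter.eq_of_ne hs (Ne.symm h1)
        -- Switching the final `a⁻¹` leaves `s a²`. Switching `b⁻¹` or `b` leaves `s a b² a⁻¹` or `s
        -- a b⁻² a⁻¹`, with the sign chosen as in `isConj_letterBraid_conj_sq`.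
        by_cases h2 : a.2 = b.2
        · refine of_isConj (x := b.inv) (q := []) (y := a.inv) (r := s :: a :: b :: T)
            (hw.trans ?_) ?_
          · simpa using List.isRotated_append (l := s :: a :: b :: T) (l' := [b.inv, a.inv])
          have := isConj_letterBraid_conj_sq (Ne.symm h1) h2 hsb
          simp only [List.nil_append, toBraid_cons_eq, hT.toBraid_eq, letterBraid_inv, mul_one,
            inv_inv] at this ⊢
          refine (IsConj.trans ?_ this).trans ?_
          · exact isConj_iff.2 ⟨letterBraid a * (letterBraid b)⁻¹, by group⟩
          · exact isConj_iff.2 ⟨(letterBraid b)⁻¹ * letterBraid a, by group⟩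
        · refine of_isConj (x := b) (q := T ++ [b.inv]) (y := a.inv) (r := [s, a])
            (hw.trans ?_) ?_
          · simpa using List.isRotated_append (l := [s, a]) (l' := b :: (T ++ [b.inv, a.inv]))
          have := isConj_letterBraid_conj_sq (a := a) (c := b.inv) (z := s) (Ne.symm h1)
            (by simpa [Letter.inv] using Bool.eq_not.2 h2) hsb
          simp only [List.append_assoc, List.nil_append, List.cons_append, toBraid_cons_eq,
            toBraid_append, toBraid_nil, hT.toBraid_eq, letterBraid_inv, one_mul, mul_one,
            inv_inv] at this ⊢
          refine (IsConj.trans ?_ this).trans ?_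
          · exact isConj_iff.2 ⟨letterBraid a * (letterBraid b * letterBraid b), by group⟩
          · exact isConj_iff.2 ⟨letterBraid a, by group⟩
  · by_cases ht : t.1 = a.1
    · rcases Letter.eq_or_eq_inv ht with rfl | rfl
      · exact of_trivial (T := []) (T ++ t.inv :: s :: v) toBraid_nil (hw.trans (by
          simpa using List.isRotated_append (l := s :: v) (l' := t :: t :: (T ++ [t.inv]))))
      · refine of_trivial_trivial (x := a.inv) (T := []) (s :: v) toBraid_nil hT.toBraid_eq
          (hw.trans ?_)
        simpa [Letter.inv_inv] using
          List.isRotated_append (l := s :: v) (l' := a.inv :: a :: (T ++ [a.inv]))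
    by_cases hs : s.1 = a.1
    · rcases Letter.eq_or_eq_inv hs with rfl | rfl
      · refine of_trivial_trivial (x := s) (v ++ [t]) hT.toBraid_eq toBraid_nil (hw.trans ?_)
        simpa using List.isRotated_append (l := s :: (v ++ [t])) (l' := s :: (T ++ [s.inv]))
      · refine of_trivial (x := a.inv) (T := []) (v ++ t :: a :: T) toBraid_nil (hw.trans ?_)
        simpa using List.isRotated_append (l := a.inv :: (v ++ t :: a :: T)) (l' := [a.inv])
    rcases Letter.eq_or_eq_inv (Letter.eq_of_ne hs (Ne.symm ht)) with rfl | rfl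
    -- Equal letters on both sides of a trivial block.
    · refine of_trivial (x := s) v (hT.cons a).toBraid_eq (hw.trans ?_)
      simpa using List.isRotated_append (l := s :: v) (l' := s :: a :: (T ++ [a.inv]))
    · simp only [List.length_cons, List.length_append, List.length_nil] at hn
      refine ih (n - 1) (by omega) (v := v) (a := t) (by omega) (hT.cons a) (hw.trans ?_) hd
      simpa using List.isRotated_append (l := [t.inv]) (l' := v ++ t :: a :: (T ++ [a.inv]))

/-- The generators alternate, so `f = y⁻¹` and a run of equal signs starts at `x`. A run of two or
of at least four gives two crossings at once, so the run is `x y x`; the neighbouring runs then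
decide. -/
lemma false_of_sign_change (hN : ¬ HasConjugateSwitches w)
    (hadj : ∀ x y l, w ~r x :: y :: l → x.1 ≠ y.1) {f x y : Letter} {l : BraidWord}
    (hw : w ~r f :: x :: y :: l) (hf : f.2 ≠ x.2) (h2 : x.2 = y.2) : False := by
  have h1 : x.1 ≠ y.1 := hadj x y (l ++ [f]) (hw.trans (List.isRotated_append (l := [f])))
  obtain rfl | rfl := Letter.eq_or_eq_inv (Letter.eq_of_ne (hadj _ _ _ hw) h1)
  · exact hf h2.symm
  rcases l with _ | ⟨c, r⟩
  · exact hadj y y.inv [x]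
      (hw.trans (List.isRotated_append (l := [y.inv, x]) (l' := [y]))) rfl
  have hc : y.1 ≠ c.1 := hadj y c (r ++ [y.inv, x])
    (hw.trans (List.isRotated_append (l := [y.inv, x]) (l' := y :: c :: r)))
  obtain rfl | rfl := Letter.eq_or_eq_inv (Letter.eq_of_ne h1 hc).symm
  swap
  · exact hN (of_run_two r h1 h2 hw)
  rcases r with _ | ⟨d, r⟩
  · exact hN (of_length_four h1 h2
      (hw.trans (List.isRotated_append (l := [y.inv]) (l' := [c, y, c]))))
  have hd : c.1 ≠ d.1 := hadj c d (r ++ [y.inv, c, y])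
    (hw.trans (List.isRotated_append (l := [y.inv, c, y]) (l' := c :: d :: r)))
  obtain rfl | rfl := Letter.eq_or_eq_inv (Letter.eq_of_ne hc hd).symm
  · exact hN (of_alternating (r ++ [d.inv]) h1 h2
      (hw.trans (List.isRotated_append (l := [d.inv]) (l' := c :: d :: c :: d :: r))))
  rcases r with _ | ⟨e, r⟩
  · exact hadj y.inv y.inv [c, y, c]
      (hw.trans (List.isRotated_append (l := [y.inv, c, y, c]) (l' := [y.inv]))) rfl
  have he : y.1 ≠ e.1 := hadj y.inv e (r ++ [y.inv, c, y, c])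
    (hw.trans (List.isRotated_append (l := [y.inv, c, y, c]) (l' := y.inv :: e :: r)))
  have h2' : c.inv.2 = y.inv.2 := congrArg (!·) h2
  -- The word now begins `y⁻¹ x y x y⁻¹`. If `x` follows, the final `y⁻¹` is a run of length one,
  -- and the letters before the initial `y⁻¹` are examined; if `x⁻¹` follows, the next run has
  -- length at least two.
  obtain rfl | rfl := Letter.eq_or_eq_inv (Letter.eq_of_ne hd he).symm
  · rcases r.eq_nil_or_concat' with rfl | ⟨r, t, rfl⟩
    · exact hN (of_length_six' h1 h2 hw)
    have hrot := hw.trans (List.isRotated_append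
      (l := y.inv :: e :: y :: e :: y.inv :: e :: r) (l' := [t]))
    have ht : t.1 ≠ y.1 := hadj t y.inv (e :: y :: e :: y.inv :: e :: r) hrot
    obtain rfl | rfl := Letter.eq_or_eq_inv (Letter.eq_of_ne ht h1.symm)
    · exact hN (of_isolated_run_three r h1 h2 hrot)
    rcases r.eq_nil_or_concat' with rfl | ⟨r, q, rfl⟩
    · exact hadj e e.inv [y.inv, e, y, e, y.inv] (hw.trans
        (List.isRotated_append (l := [y.inv, e, y, e, y.inv]) (l' := [e, e.inv]))) rfl
    have hrot : w ~r q :: e.inv :: y.inv :: e :: y :: e :: y.inv :: e :: r := by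
      simpa using hw.trans (l'' := [q, e.inv] ++ y.inv :: e :: y :: e :: y.inv :: e :: r) (by
        simpa using List.isRotated_append
          (l := y.inv :: e :: y :: e :: y.inv :: e :: r) (l' := [q, e.inv]))
    obtain rfl | rfl := Letter.eq_or_eq_inv (Letter.eq_of_ne (hadj _ _ _ hrot) h1)
    · exact hN (of_run_two (x := e.inv) (y := q.inv) (q :: e :: q.inv :: e :: r) h1 h2'
        (by simpa only [Letter.inv_inv] using hrot))
    · exact hN (of_run_three_run_three' (e :: r) h1 h2 hrot)
  · rcases r with _ | ⟨f, r⟩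
    · exact hN (of_length_six h1 h2
        (hw.trans (List.isRotated_append (l := [y.inv]) (l' := [c, y, c, y.inv, c.inv]))))
    have hf' : c.1 ≠ f.1 := hadj c.inv f (r ++ [y.inv, c, y, c, y.inv]) (hw.trans
      (List.isRotated_append (l := [y.inv, c, y, c, y.inv]) (l' := c.inv :: f :: r)))
    obtain rfl | rfl := Letter.eq_or_eq_inv (Letter.eq_of_ne h1.symm hf').symm
    · refine hN (of_run_two (x := f.inv) (y := c.inv) (r ++ [f.inv, c, f]) h1.symm h2'.symm ?_)
      simpa only [Letter.inv_inv, List.cons_append] using hw.trans (List.isRotated_append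
        (l := [f.inv, c, f]) (l' := c :: f.inv :: c.inv :: f :: r))
    · exact hN (of_run_three_run_three r h1 h2 hw)

/-- By `false_of_sign_change` the letter before two letters of equal sign has the same sign. Two
steps backwards give four alternating letters of one sign. -/
lemma false_of_eq_sign (hN : ¬ HasConjugateSwitches w) (h3 : 3 ≤ w.length)
    (hadj : ∀ x y l, w ~r x :: y :: l → x.1 ≠ y.1) {y z : Letter} {l : BraidWord}
    (hw : w ~r y :: z :: l) (h2 : y.2 = z.2) : False := by
  have step : ∀ {x y z : Letter} {l : BraidWord}, w ~r x :: y :: z :: l → y.2 = z.2 →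
      x.2 = y.2 := fun hw h => by
    by_contra hx
    exact false_of_sign_change hN hadj hw hx h
  have h1 := hadj _ _ _ hw
  rcases l.eq_nil_or_concat' with rfl | ⟨l, x, rfl⟩
  · have := hw.perm.length_eq
    simp at this
    omega
  have hx : w ~r x :: y :: z :: l := hw.trans (List.isRotated_append (l := y :: z :: l) (l' := [x]))
  have hxy := step hx h2
  have hxz : x = z := Prod.ext (Letter.eq_of_ne (hadj _ _ _ hx) h1) (hxy.trans h2)
  subst hxz
  rcases l.eq_nil_or_concat' with rfl | ⟨l, x', rfl⟩
  · exact hadj x x [y] (hx.trans (List.isRotated_append (l := [x, y]) (l' := [x]))) rfl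
  have hx' : w ~r x' :: x :: y :: x :: l :=
    hx.trans (List.isRotated_append (l := x :: y :: x :: l) (l' := [x']))
  have hxy' := step hx' hxy
  have : x' = y := Prod.ext (Letter.eq_of_ne (hadj _ _ _ hx') h1.symm) (hxy'.trans hxy)
  subst this
  exact hN (of_alternating l h1 h2 hx')

/-- The letters repeat with period two, so what follows `x y` is a power of `x y`, possibly with one
more `x`; around the cycle that last `x` would meet the first one. -/
lemma toBraid_eq_pow_or_concat {x y : Letter}
    (hnext : ∀ x y z l, w ~r x :: y :: z :: l → z = x) (n : ℕ) :
    ∀ {l p : BraidWord}, l.length ≤ n → w ~r x :: y :: (l ++ p) →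
      (∃ k, toBraid l = (letterBraid x * letterBraid y) ^ k) ∨ ∃ l', l = l' ++ [x] := by
  induction n using Nat.strong_induction_on with
  | _ n ih =>
  intro l p hl hw
  rcases l with _ | ⟨c, _ | ⟨d, l⟩⟩
  · exact Or.inl ⟨0, toBraid_nil⟩
  · exact Or.inr ⟨[], by rw [hnext _ _ _ _ hw]; rfl⟩
  · obtain rfl := hnext _ _ _ _ hw
    have hrot := hw.trans (List.isRotated_append (l := [c]) (l' := y :: c :: d :: (l ++ p)))
    obtain rfl := hnext _ _ _ _ hrot
    simp only [List.length_cons] at hl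
    rcases ih (n - 1) (by omega) (l := l) (p := p ++ [c, d]) (by omega) (by
      simpa using hw.trans (List.isRotated_append (l := [c, d]) (l' := c :: d :: (l ++ p)))) with
      ⟨k, hk⟩ | ⟨l', rfl⟩
    · exact Or.inl ⟨k + 1, by rw [toBraid_cons_eq, toBraid_cons_eq, hk, pow_succ', mul_assoc]⟩
    · exact Or.inr ⟨c :: d :: l', rfl⟩

lemma of_alternating_signs (h3 : 3 ≤ w.length)
    (hadj : ∀ x y l, w ~r x :: y :: l → x.1 ≠ y.1)
    (hsign : ∀ x y l, w ~r x :: y :: l → x.2 ≠ y.2) : HasConjugateSwitches w := by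
  have hnext : ∀ x y z l, w ~r x :: y :: z :: l → z = x := fun x y z l hw => by
    have hrot := hw.trans (List.isRotated_append (l := [x]) (l' := y :: z :: l))
    have h := hsign _ _ _ hw
    have h' := hsign _ _ _ hrot
    exact Prod.ext (Letter.eq_of_ne (hadj _ _ _ hw) (hadj _ _ _ hrot)).symm
      (by cases hx : x.2 <;> cases hy : y.2 <;> cases hz : z.2 <;> simp_all)
  rcases w with _ | ⟨x, _ | ⟨y, _ | ⟨c, l⟩⟩⟩
  · simp at h3
  · simp at h3
  · simp at h3
  obtain rfl := hnext x y c l (List.IsRotated.refl _)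
  rcases l with _ | ⟨d, l⟩
  · exact absurd rfl (hadj c c [y] (List.isRotated_append (l := [c, y]) (l' := [c])))
  obtain rfl := hnext y c d (l ++ [c]) (List.isRotated_append (l := [c]))
  rcases toBraid_eq_pow_or_concat hnext l.length (x := c) (y := d) (p := [c, d]) le_rfl (by
    simpa using List.isRotated_append (l := [c, d]) (l' := c :: d :: l)) with ⟨k, hk⟩ | ⟨l', rfl⟩
  -- The word is `c d c d (c d)^k`. Conjugation by one period `c d` carries the switch of the first
  -- `c` to that of the second.
  · refine of_isConj (x := c) (q := [d]) (y := c) (r := d :: l) (List.IsRotated.refl _)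
      (isConj_iff.2 ⟨letterBraid c * letterBraid d, ?_⟩)
    simp only [List.cons_append, List.nil_append, toBraid_cons_eq, letterBraid_inv, hk]
    rw [mul_inv_eq_iff_eq_mul]
    have := (Commute.self_pow (letterBraid c * letterBraid d) k).eq
    simp only [mul_assoc] at this ⊢
    rw [← this]
  · exact absurd rfl (hadj c c (d :: c :: d :: l')
      (List.isRotated_append (l := c :: d :: c :: d :: l') (l' := [c])))

theorem of_not_degenerate (hlen : 2 ≤ w.length) (hdeg : ¬ Degenerate w)
    (halt : ¬ AlternatingPair w) : HasConjugateSwitches w := by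
  by_contra hN
  have hadj : ∀ x y l, w ~r x :: y :: l → x.1 ≠ y.1 := fun x y l hw h => by
    rcases Letter.eq_or_eq_inv h.symm with rfl | rfl
    · exact hN (of_trivial (T := []) l toBraid_nil hw)
    · exact hN (of_nested l.length le_rfl Nested.nil
        (hw.trans (List.isRotated_append (l := [x, x.inv]) (l' := l))) hdeg)
  rcases hlen.eq_or_lt with h | h
  · obtain ⟨x, y, rfl⟩ := List.length_eq_two.1 h.symm
    have h1 := hadj _ _ _ (List.IsRotated.refl _)
    by_cases h2 : x.2 = y.2
    · exact hN (of_length_two h1 h2 (List.IsRotated.refl _))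
    · exact halt ⟨x, y, h1, h2, rfl⟩
  · exact hN (of_alternating_signs h hadj fun x y l hw h2 => false_of_eq_sign hN h hadj hw h2)

end HasConjugateSwitches

end ThreeBraid

/-! ### The theorem, with the exceptional pair treated separately -/

theorem propositionp2 (w : ThreeBraid.BraidWord) (hlen : 2 ≤ w.length)
    (hdeg : ¬ ThreeBraid.Degenerate w) :
    ¬ ThreeBraid.EverywhereDifferent w ∧
    (¬ ThreeBraid.AlternatingPair w →
      ∃ i j : Fin w.length, i ≠ j ∧
        IsConj (ThreeBraid.toBraid (ThreeBraid.switch w i))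
          (ThreeBraid.toBraid (ThreeBraid.switch w j)) ∧
        (ThreeBraid.closure (ThreeBraid.switch w i)).Isotopic
          (ThreeBraid.closure (ThreeBraid.switch w j))) := by
  have key : ¬ ThreeBraid.AlternatingPair w →
      ∃ i j : Fin w.length, i ≠ j ∧
        IsConj (ThreeBraid.toBraid (ThreeBraid.switch w i))
          (ThreeBraid.toBraid (ThreeBraid.switch w j)) ∧
        (ThreeBraid.closure (ThreeBraid.switch w i)).Isotopic
          (ThreeBraid.closure (ThreeBraid.switch w j)) := fun halt => by
    obtain ⟨i, j, hij, h⟩ :=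
      (ThreeBraid.HasConjugateSwitches.of_not_degenerate hlen hdeg halt).exists_switch
    exact ⟨i, j, hij, h, (ThreeBraid.wordEquiv_of_isConj h).isotopic⟩
  refine ⟨fun hw => ?_, key⟩
  by_cases halt : ThreeBraid.AlternatingPair w
  · obtain ⟨a, b, h1, h2, rfl⟩ := halt
    -- The signs of `a` and `b` differ, so both letters of the switched word `a⁻¹ b` have the same
    -- sign, as do both letters of `a b⁻¹`.
    have h := ThreeBraid.wordEquiv_alternate (a := a.inv) (b := b) h1 (Bool.not_eq.2 h2)
    rw [ThreeBraid.Letter.inv_inv] at h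
    exact hw (0 : Fin 2) (1 : Fin 2) Fin.zero_ne_one h.isotopic
  · obtain ⟨i, j, hij, -, h⟩ := key halt
    exact hw i j hij h
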